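/- **Setting.** An IQP circuit on $n$ qubits is $C=H^{\otimes n}DH^{\otimes n}$, where $D$ is a sequence of $m$ gates, each a $Z$, $CZ$ or $CCZ$ gate; $p(x)=|\langle x|C|0^n\rangle|^2$ is its output distribution on $\{0,1\}^n$. For $0<\varepsilon<1$ let $D_\varepsilon(\rho)=(1-\varepsilon)\rho+\varepsilon I/2$ be the one-qubit depolarizing channel. For rates $\varepsilon_1,\dots,\varepsilon_n\in(0,1)$ let $\widetilde p_{\rm in}$ be the distribution of the outcome of $Z$-basis measurements of all qubits when $D_{\varepsilon_j}$ is applied to the $j$-th qubit, for every $j$, at the start of the computation (to the input $|0^n\rangle\langle 0^n|$, before $C$), and $\widetilde p_{\rm out}$ the distribution when these channels are instead applied after $C$, just before the measurement. Put $K=\frac{10\sqrt\alpha}{\delta}\log_2\frac{10\sqrt\alpha}{\delta}$ for constants $\alpha\ge 1$, $0<\delta<1$, and $\|f\|_1=\sum_x|f(x)|$. Algorithms are randomized with fair coins and receive a classical description of $C$; $\exp(n)=e^n$. **(1) Equality.** For every IQP circuit, $\widetilde p_{\rm in}=\widetilde p_{\rm out}$, both for a uniform rate ($\varepsilon_j=\varepsilon$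 for all $j$) and for arbitrary individual rates $\varepsilon_j\in(0,1)$. **(2) Uniform rate.** For all real constants $\alpha\ge1$, $0<\delta<1$ and $\lambda$ there is a randomized algorithm, running in time polynomial in $n+m$, that on the description of any IQP circuit $C$ on $n\ge1$ qubits with $m$ gates outputs a description of a probability distribution $\widetilde q$ on $\{0,1\}^n$ from which one can sample classically in time polynomial in $n+m$ (by one fixed algorithm that gets only this description), such that the following holds. If $\sum_x p(x)^2\le\alpha/2^n$ and if $0<\varepsilon<1$ (unknown to the algorithm) satisfies $1\le\varepsilon/\lambda\le1+1/K$, then for the input-noise model with uniform rate $\varepsilon$ $$\Pr\big[\|\widetilde p_{\rm in}-\widetilde q\|_1\le\delta\big]\ \ge\ 1-\frac1{\exp(n)} .$$ **(3) Individual rates.** For all real constants $\alpha\ge1$, $0<\delta<1$ and $\lambda_{\min}$ there is a randomized algorithm as in (2) which receives in addition the set $J\subseteq\{1,\dots,n\}$ and rational numbers $\lambda_j$ for $j\in J$, with both running times polynomial in $n+m$ plus the total bit length of these $\lambda_j$, such that the following holds. If $\sum_x p(x)^2\le\alpha/2^n$, $\varepsilon_1,\dots,\varepsilon_n\in(0,1)$,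 $\varepsilon_{\min}=\min_j\varepsilon_j$, $J=\{j:\varepsilon_j\ne\varepsilon_{\min}\}$, $1\le\varepsilon_{\min}/\lambda_{\min}\le1+1/K$, and $0\le\varepsilon_j-\lambda_j\le\lambda_{\min}/K$ for all $j\in J$, then for the input-noise model with rates $\varepsilon_1,\dots,\varepsilon_n$ $$\Pr\Big[\|\widetilde p_{\rm in}-\widetilde q\|_1\le\Big(1+\frac1{1-\lambda_{\min}}\Big)\delta\Big]\ \ge\ 1-\frac1{\exp(n)} .$$ -/

import Mathlib

open scoped Matrix

noncomputable section

/-! ### Qubits, IQP circuits, depolarizing noise -/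

/-- `n`-bit strings; they index the computational basis of `n` qubits. -/
abbrev Bits (n : ℕ) := Fin n → Fin 2

/-- Operators on `n` qubits, as matrices in the computational (`Z`) basis. -/
abbrev QOp (n : ℕ) := Matrix (Bits n) (Bits n) ℂ

def pauliX : Matrix (Fin 2) (Fin 2) ℂ := !![0, 1; 1, 0]

def pauliZ : Matrix (Fin 2) (Fin 2) ℂ := !![1, 0; 0, -1]

/-- The Hadamard operation `H = (X + Z) / √2`. -/
def hadamardGate : Matrix (Fin 2) (Fin 2) ℂ := ((Real.sqrt 2 : ℝ) : ℂ)⁻¹ • (pauliX + pauliZ)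

/-- The layer `H ⊗ ⋯ ⊗ H` on `n` qubits. -/
def hadamardLayer (n : ℕ) : QOp n := Matrix.of fun x y => ∏ j, hadamardGate (x j) (y j)

/-- The gates `Z`, `CZ`, `CCZ`, applied to pairwise distinct qubits among `n`. -/
inductive DiagGate (n : ℕ) : Type
  | z (i : Fin n)
  | cz (i j : Fin n) (hij : i ≠ j)
  | ccz (i j k : Fin n) (hij : i ≠ j) (hik : i ≠ k) (hjk : j ≠ k)

/-- The operator of a gate: the sign `-1` is applied exactly to the basis states in which all
qubits that the gate acts on are `1`. -/
def DiagGate.op {n : ℕ} : DiagGate n → QOp n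
  | .z i => Matrix.diagonal fun x => if x i = 1 then -1 else 1
  | .cz i j _ => Matrix.diagonal fun x => if x i = 1 ∧ x j = 1 then -1 else 1
  | .ccz i j k _ _ _ => Matrix.diagonal fun x => if x i = 1 ∧ x j = 1 ∧ x k = 1 then -1 else 1

/-- An IQP circuit on `n` qubits, `H^{⊗n} D H^{⊗n}`: it is given by the list of the gates of `D`,
in the order in which they are applied. -/
structure IQPCircuit (n : ℕ) : Type where
  gates : List (DiagGate n)

namespace IQPCircuit

variable {n : ℕ}

/-- The number of gates of the diagonal part `D`. -/
def size (C : IQPCircuit n) : ℕ := C.gates.length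

/-- The operator `D`; a gate that comes later in the list multiplies from the left. -/
def diagOp (C : IQPCircuit n) : QOp n := C.gates.foldl (fun A g => g.op * A) 1

/-- The operator `H^{⊗n} D H^{⊗n}`. -/
def op (C : IQPCircuit n) : QOp n := hadamardLayer n * C.diagOp * hadamardLayer n

/-- The noise-free output distribution `p(x) = |⟨x| C |0ⁿ⟩|²`. -/
def outputDist (C : IQPCircuit n) (x : Bits n) : ℝ := ‖C.op x 0‖ ^ 2

end IQPCircuit

/-- The one-qubit depolarizing channel `D_ε(ρ) = (1 - ε) ρ + ε tr(ρ) I / 2`. -/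
def depolarizing (ε : ℝ) : Matrix (Fin 2) (Fin 2) ℂ →ₗ[ℂ] Matrix (Fin 2) (Fin 2) ℂ :=
  (1 - (ε : ℂ)) • LinearMap.id
    + ((ε : ℂ) / 2) • (Matrix.traceLinearMap (Fin 2) ℂ ℂ).smulRight (1 : Matrix (Fin 2) (Fin 2) ℂ)

/-- The tensor product `Φ₁ ⊗ ⋯ ⊗ Φₙ` of one-qubit linear maps (the `j`-th one acts on the `j`-th
qubit), the linear map on `n`-qubit operators that sends `|a⟩⟨b|` to `⨂ⱼ Φⱼ(|aⱼ⟩⟨bⱼ|)`. -/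
def tensorChannel {n : ℕ}
    (Φ : Fin n → (Matrix (Fin 2) (Fin 2) ℂ →ₗ[ℂ] Matrix (Fin 2) (Fin 2) ℂ)) (ρ : QOp n) : QOp n :=
  Matrix.of fun x y =>
    ∑ a : Bits n, ∑ b : Bits n, ρ a b * ∏ j, Φ j (Matrix.single (a j) (b j) 1) (x j) (y j)

/-- The channel `D_{ε₁} ⊗ ⋯ ⊗ D_{εₙ}`. -/
def depolarizeAll {n : ℕ} (ε : Fin n → ℝ) (ρ : QOp n) : QOp n :=
  tensorChannel (fun j => depolarizing (ε j)) ρ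

/-- The state `|0ⁿ⟩⟨0ⁿ|`. -/
def zeroState (n : ℕ) : QOp n := Matrix.single 0 0 1

/-- The outcome distribution of `Z`-basis measurements of all qubits in the state `ρ`. -/
def measureZ {n : ℕ} (ρ : QOp n) (x : Bits n) : ℝ := (ρ x x).re

namespace IQPCircuit

variable {n : ℕ}

/-- The output distribution when `D_{ε_j}` is applied to the `j`-th qubit, for every `j`, at the
end of the computation. -/
def outputNoiseDist (C : IQPCircuit n) (ε : Fin n → ℝ) : Bits n → ℝ :=
  measureZ (depolarizeAll ε (C.op * zeroState n * C.opᴴ))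

/-- The output distribution when `D_{ε_j}` is applied to the `j`-th qubit, for every `j`, at the
start of the computation. -/
def inputNoiseDist (C : IQPCircuit n) (ε : Fin n → ℝ) : Bits n → ℝ :=
  measureZ (C.op * depolarizeAll ε (zeroState n) * C.opᴴ)

end IQPCircuit

/-- The `l₁` distance of two functions on bit strings. -/
def l1Dist {n : ℕ} (p q : Bits n → ℝ) : ℝ := ∑ x, |p x - q x|

/-! ### Randomized random access machines with logarithmic cost

Programs act on integers of arbitrary size, held in finitely many named arrays with random access.
An operation is charged the bit lengths of all the numbers (addresses included) that it handles,
so that time is polynomially related to the time of a (randomized) Turing machine. -/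

/-- The number of bits of an integer, sign included. -/
def bitLen (z : ℤ) : ℕ := Nat.size z.natAbs + 1

/-- Memory: cell `i` of array `a` holds the integer `μ a i`. -/
abbrev Mem := ℕ → ℤ → ℤ

inductive BinOp : Type
  | add | sub | mul | div | lt | eq

def BinOp.eval : BinOp → ℤ → ℤ → ℤ
  | .add, u, v => u + v
  | .sub, u, v => u - v
  | .mul, u, v => u * v
  | .div, u, v => u / v
  | .lt, u, v => if u < v then 1 else 0
  | .eq, u, v => if u = v then 1 else 0

/-- Expressions: integer constants, the content of the cell of array `a` whose address is the value
of an expression, and binary operations. -/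
inductive Expr : Type
  | lit (k : ℤ)
  | read (a : ℕ) (i : Expr)
  | bin (o : BinOp) (e f : Expr)

def Expr.eval (μ : Mem) : Expr → ℤ
  | .lit k => k
  | .read a i => μ a (i.eval μ)
  | .bin o e f => o.eval (e.eval μ) (f.eval μ)

/-- The cost of evaluating an expression: the total bit length of the values of all its
subexpressions. -/
def Expr.cost (μ : Mem) : Expr → ℕ
  | .lit k => bitLen k
  | .read a i => i.cost μ + bitLen (μ a (i.eval μ))
  | .bin o e f => e.cost μ + f.cost μ + bitLen (o.eval (e.eval μ) (f.eval μ))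

/-- Programs. `write a i e` stores the value of `e` in cell `i` of array `a`, `flip a i` stores the
outcome (`0` or `1`) of a fair coin flip there, `emit e` appends the value of `e` to the output;
conditions hold when they are nonzero. -/
inductive Prog : Type
  | skip
  | write (a : ℕ) (i e : Expr)
  | flip (a : ℕ) (i : Expr)
  | emit (e : Expr)
  | seq (c d : Prog)
  | ite (b : Expr) (c d : Prog)
  | loop (b : Expr) (c : Prog)

/-- A configuration: memory, number of coins already used, output written so far. -/
structure Config : Type where
  mem : Mem
  pos : ℕ
  out : List ℤ

def Mem.set (μ : Mem) (a : ℕ) (i v : ℤ) : Mem :=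
  Function.update μ a (Function.update (μ a) i v)

/-- `Exec ω c s t s'`: with coin outcomes `ω`, the program `c` started in `s` halts in `s'` after
time exactly `t`. -/
inductive Exec (ω : ℕ → Bool) : Prog → Config → ℕ → Config → Prop
  | skip (s : Config) : Exec ω .skip s 1 s
  | write (a : ℕ) (i e : Expr) (s : Config) :
      Exec ω (.write a i e) s (i.cost s.mem + e.cost s.mem + 1)
        { s with mem := s.mem.set a (i.eval s.mem) (e.eval s.mem) }
  | flip (a : ℕ) (i : Expr) (s : Config) :
      Exec ω (.flip a i) s (i.cost s.mem + 1)
        { s with mem := s.mem.set a (i.eval s.mem) (if ω s.pos then 1 else 0), pos := s.pos + 1 }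
  | emit (e : Expr) (s : Config) :
      Exec ω (.emit e) s (e.cost s.mem + 1) { s with out := s.out ++ [e.eval s.mem] }
  | seq {c d : Prog} {s s' s'' : Config} {t t' : ℕ} :
      Exec ω c s t s' → Exec ω d s' t' s'' → Exec ω (.seq c d) s (t + t') s''
  | ite_true {b : Expr} {c d : Prog} {s s' : Config} {t : ℕ} :
      b.eval s.mem ≠ 0 → Exec ω c s t s' → Exec ω (.ite b c d) s (b.cost s.mem + t + 1) s'
  | ite_false {b : Expr} {c d : Prog} {s s' : Config} {t : ℕ} :
      b.eval s.mem = 0 → Exec ω d s t s' → Exec ω (.ite b c d) s (b.cost s.mem + t + 1) s'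
  | loop_false {b : Expr} {c : Prog} {s : Config} :
      b.eval s.mem = 0 → Exec ω (.loop b c) s (b.cost s.mem + 1) s
  | loop_true {b : Expr} {c : Prog} {s s' s'' : Config} {t t' : ℕ} :
      b.eval s.mem ≠ 0 → Exec ω c s t s' → Exec ω (.loop b c) s' t' s'' →
      Exec ω (.loop b c) s (b.cost s.mem + t + t' + 1) s''

/-- The initial configuration on the input list `x`: array `0` holds the length of `x` in cell `0`
and the entries of `x` in the cells `1, 2, …`; every other cell of the memory holds `0`. -/
def startConfig (x : List ℤ) : Config where
  mem := fun a i =>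
    if a = 0 then (if i = 0 then (x.length : ℤ) else if 0 < i then x.getD (i.toNat - 1) 0 else 0)
    else 0
  pos := 0
  out := []

/-- `HaltsWith c x T r w`: on input `x` and with coin outcomes `r`, the program `c` halts within
time `T` with output `w`. (A coin flip takes time at least `1`, so `T` coins are enough.) -/
def HaltsWith (c : Prog) (x : List ℤ) (T : ℕ) (r : Fin T → Bool) (w : List ℤ) : Prop :=
  ∃ (t : ℕ) (s : Config), t ≤ T ∧
    Exec (fun i => if h : i < T then r ⟨i, h⟩ else false) c (startConfig x) t s ∧ s.out = w

/-- The probability of an event under `T` independent fair coin flips. -/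
def coinProb (T : ℕ) (E : (Fin T → Bool) → Prop) : ℝ := (Set.ncard {r | E r} : ℝ) / 2 ^ T

/-- A bit string as an output list of zeros and ones. -/
def bitList {n : ℕ} (x : Bits n) : List ℤ := List.ofFn fun j => ((x j : ℕ) : ℤ)

/-- `q` is a probability distribution on bit strings, and on input `w` the program `S` always halts
within time `T` and samples exactly from `q`. -/
def SamplesWithin {n : ℕ} (S : Prog) (w : List ℤ) (T : ℕ) (q : Bits n → ℝ) : Prop :=
  (∀ x, 0 ≤ q x) ∧ ∑ x, q x = 1 ∧
  (∀ r : Fin T → Bool, ∃ v, HaltsWith S w T r v) ∧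
  ∀ x, coinProb T (fun r => HaltsWith S w T r (bitList x)) = q x

/-- On input `x`, whatever the outcomes of its coins, `G` halts within time `T` and outputs a
description of a probability distribution on `n`-bit strings, from which `S` (given only this
description) samples within time `T`. -/
def OutputsDist (n : ℕ) (G S : Prog) (x : List ℤ) (T : ℕ) : Prop :=
  ∀ r : Fin T → Bool, ∃ (w : List ℤ) (q : Bits n → ℝ),
    HaltsWith G x T r w ∧ SamplesWithin S w T q

/-- The probability, over the coins of `G`, that the distribution which `G` describes on input `x`
has `l₁` distance at most `η` from `p`. -/
def closeProb {n : ℕ} (G S : Prog) (x : List ℤ) (T : ℕ) (p : Bits n → ℝ) (η : ℝ) : ℝ :=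
  coinProb T fun r => ∃ (w : List ℤ) (q : Bits n → ℝ),
    HaltsWith G x T r w ∧ SamplesWithin S w T q ∧ l1Dist p q ≤ η

/-! ### Inputs of the algorithms -/

/-- The description of a gate: its number of qubits and these qubits, padded to four entries. -/
def DiagGate.code {n : ℕ} : DiagGate n → List ℤ
  | .z i => [1, (i : ℕ), 0, 0]
  | .cz i j _ => [2, (i : ℕ), (j : ℕ), 0]
  | .ccz i j k _ _ _ => [3, (i : ℕ), (j : ℕ), (k : ℕ)]

/-- The classical description of an IQP circuit: number of qubits, number of gates, gates. -/
def IQPCircuit.code {n : ℕ} (C : IQPCircuit n) : List ℤ :=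
  (n : ℤ) :: (C.size : ℤ) :: C.gates.flatMap DiagGate.code

/-- An optional rational number as three integers. -/
def rateCode : Option ℚ → List ℤ
  | none => [0, 0, 0]
  | some q => [1, q.num, (q.den : ℤ)]

/-- The number of bits in the description of an optional rational number. -/
def rateBits : Option ℚ → ℕ
  | none => 0
  | some q => bitLen q.num + bitLen (q.den : ℤ)

open Classical in
/-- What is known about the individual rates: which of them differ from the minimum `εmin`, and for
these an approximate value. -/
def knownRates {n : ℕ} (ε : Fin n → ℝ) (εmin : ℝ) (lam : Fin n → ℚ) (j : Fin n) : Option ℚ :=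
  if ε j = εmin then none else some (lam j)

/-- The description of an IQP circuit together with what is known about the individual rates. -/
def IQPCircuit.codeWithRates {n : ℕ} (C : IQPCircuit n) (κ : Fin n → Option ℚ) : List ℤ :=
  C.code ++ (List.ofFn fun j => rateCode (κ j)).flatten

/-- The quantity `(10 √α / δ) log₂ (10 √α / δ)`. -/
def precision (α δ : ℝ) : ℝ :=
  (10 * Real.sqrt α / δ) * Real.logb 2 (10 * Real.sqrt α / δ)

end

/-! ### Polynomially bounded functions -/

/-! Between two Hadamard layers a diagonal operator becomes a convolution: the matrix entry of `C`
at `(x, y)` depends only on `x + y` (`op_apply`). Flipping an input bit is therefore the same as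
flipping the output bit. Depolarizing noise on `|0ⁿ⟩`, or just before a `Z` measurement, amounts to
independent bit flips with probabilities `ε_j / 2`, so both noise models give `noisyDist`.

For the simulation, pass to Fourier coefficients. Noise multiplies the coefficient at `s` by the
product of `1 - ε_j` over the ones of `s` (`noisyDist_eq`), and by Parseval the collision bound says
that the squared coefficients of `p` sum to at most `α`. Coefficients of large weight are damped so
strongly that a constant degree suffices. The polynomially many others are means of signs
(`coeff_eq`) and are estimated from random strings, with a Chernoff bound and a union bound. An
inexact rate changes each damping factor by an amount that does not grow with the weight
(`bitWeight_sub_le`). Cauchy–Schwarz and Parseval convert all errors into an `l₁` error of at most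
`δ / 3` (`sum_abs_noisyDist_sub_le`).

The resulting function may take negative values. Its marginals on prefixes are again short sums of
coefficients (`marginal_fourierSum`), so a string can be drawn bit by bit, with marginals cut off
where they are negative or too large; this costs a factor `3` (`sum_abs_descendCount_le`).
Everything is done in integers: coefficients are rounded to multiples of `1 / scale`, the one at `0`
is exact, and the total mass is a power of two. One uniform integer made of coins then decides the
whole string, with exact probabilities.

On the machine, the generator only copies its input and appends coins, which are the random strings;
the sampler does the arithmetic. Expressions with nested bounded sums are compiled once and for all,
with a proof of correctness and a time bound (`runs_compile`). The nesting depth is the constant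
degree, which makes the time polynomial (`exists_polynomial`). The method reaches the error `δ` for
individual rates too. -/

/-- A function on the natural numbers that is bounded by a polynomial. -/
def PolyBounded (f : ℕ → ℕ) : Prop := ∃ P : Polynomial ℕ, ∀ x, f x ≤ P.eval x

namespace PolyBounded

theorem const (c : ℕ) : PolyBounded fun _ => c := ⟨Polynomial.C c, fun x => by simp⟩

theorem id : PolyBounded fun x => x := ⟨Polynomial.X, fun x => by simp⟩

theorem add {f g : ℕ → ℕ} (hf : PolyBounded f) (hg : PolyBounded g) :
    PolyBounded fun x => f x + g x := by
  obtain ⟨P, hP⟩ := hf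
  obtain ⟨Q, hQ⟩ := hg
  exact ⟨P + Q, fun x => by simpa using add_le_add (hP x) (hQ x)⟩

theorem mul {f g : ℕ → ℕ} (hf : PolyBounded f) (hg : PolyBounded g) :
    PolyBounded fun x => f x * g x := by
  obtain ⟨P, hP⟩ := hf
  obtain ⟨Q, hQ⟩ := hg
  exact ⟨P * Q, fun x => by simpa using Nat.mul_le_mul (hP x) (hQ x)⟩

theorem pow {f : ℕ → ℕ} (hf : PolyBounded f) (k : ℕ) : PolyBounded fun x => f x ^ k := by
  obtain ⟨P, hP⟩ := hf
  exact ⟨P ^ k, fun x => by simpa using Nat.pow_le_pow_left (hP x) k⟩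

end PolyBounded

/-- Natural coefficients make a polynomial monotone, which is what allows polynomial bounds to be
composed. -/
theorem Polynomial.eval_nat_mono (P : Polynomial ℕ) {a b : ℕ} (h : a ≤ b) :
    P.eval a ≤ P.eval b := by
  rw [Polynomial.eval_eq_sum, Polynomial.eval_eq_sum]
  exact Finset.sum_le_sum fun i _ => Nat.mul_le_mul le_rfl (Nat.pow_le_pow_left h i)

theorem PolyBounded.comp {f g : ℕ → ℕ} (hf : PolyBounded f) (hg : PolyBounded g) :
    PolyBounded fun x => f (g x) := by
  obtain ⟨P, hP⟩ := hf
  obtain ⟨Q, hQ⟩ := hg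
  exact ⟨P.comp Q, fun x => by
    simpa using (hP (g x)).trans (P.eval_nat_mono (hQ x))⟩

/-! ### Bit lengths -/

theorem bitLen_pos (z : ℤ) : 1 ≤ bitLen z := Nat.le_add_left _ _

theorem bitLen_le_iff {z : ℤ} {k : ℕ} : bitLen z ≤ k + 1 ↔ z.natAbs < 2 ^ k := by
  rw [bitLen, Nat.add_le_add_iff_right, Nat.size_le]

theorem natAbs_lt_two_pow_bitLen (z : ℤ) : z.natAbs < 2 ^ (bitLen z - 1) := by
  rw [← bitLen_le_iff]; have := bitLen_pos z; omega

theorem bitLen_le_natAbs (z : ℤ) : bitLen z ≤ z.natAbs + 1 := by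
  rw [bitLen_le_iff]; exact Nat.lt_two_pow_self

/-- Every operation returns a number of absolute value at most `|u| + |v|`, `|u| * |v|` or `1`, and
a product needs no more digits than its factors together. The two sign bits on the right leave one
spare bit, which covers sums. -/
theorem bitLen_eval_le (o : BinOp) (u v : ℤ) : bitLen (o.eval u v) ≤ bitLen u + bitLen v := by
  have hu := bitLen_pos u
  have hv := bitLen_pos v
  have hu' := natAbs_lt_two_pow_bitLen u
  have hv' := natAbs_lt_two_pow_bitLen v
  obtain ⟨a, ha⟩ : ∃ a, bitLen u = a + 1 := ⟨bitLen u - 1, by omega⟩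
  obtain ⟨b, hb⟩ : ∃ b, bitLen v = b + 1 := ⟨bitLen v - 1, by omega⟩
  rw [ha, Nat.add_sub_cancel] at hu'
  rw [hb, Nat.add_sub_cancel] at hv'
  rw [ha, hb]
  have key : ∀ w : ℤ, w.natAbs ≤ u.natAbs + v.natAbs ∨ w.natAbs ≤ u.natAbs * v.natAbs ∨
      w.natAbs ≤ 1 → bitLen w ≤ (a + 1) + (b + 1) := by
    intro w hw
    rw [show (a + 1) + (b + 1) = (a + b + 1) + 1 by ring, bitLen_le_iff]
    have h1 : 1 ≤ 2 ^ a := Nat.one_le_two_pow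
    have h2 : 1 ≤ 2 ^ b := Nat.one_le_two_pow
    have h3 : 2 ^ (a + b + 1) = 2 * (2 ^ a * 2 ^ b) := by rw [pow_succ, pow_add]; ring
    rw [h3]
    rcases hw with h | h | h
    · nlinarith
    · have := Nat.mul_le_mul hu'.le hv'.le
      have : 0 < 2 ^ a * 2 ^ b := by positivity
      omega
    · nlinarith
  apply key
  cases o with
  | add => left; exact Int.natAbs_add_le u v
  | sub => left; exact Int.natAbs_sub_le u v
  | mul => right; left; exact (Int.natAbs_mul u v).le
  | div => left; exact (Int.natAbs_ediv_le_natAbs u v).trans (Nat.le_add_right _ _)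
  | lt => right; right; simp only [BinOp.eval]; split <;> simp
  | eq => right; right; simp only [BinOp.eval]; split <;> simp

theorem bitLen_add_le (u v : ℤ) : bitLen (u + v) ≤ bitLen u + bitLen v := bitLen_eval_le .add u v

/-- The number of terms is below `X < 2 ^ X`, so it contributes at most `X` extra bits. Replacing a
logarithm by `X` is crude but sufficient. -/
theorem bitLen_sum_le (b X B : ℕ) (v : ℕ → ℤ) (hb : b < X) (hv : ∀ i < b, bitLen (v i) ≤ B) :
    bitLen (∑ i ∈ Finset.range b, v i) ≤ X + B := by
  rcases Nat.eq_zero_or_pos b with rfl | hb0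
  · simp [bitLen]; omega
  · have hB : 1 ≤ B := (bitLen_pos _).trans (hv 0 hb0)
    obtain ⟨B, rfl⟩ : ∃ a, B = a + 1 := ⟨B - 1, by omega⟩
    rw [← add_assoc, bitLen_le_iff]
    calc (∑ i ∈ Finset.range b, v i).natAbs ≤ ∑ i ∈ Finset.range b, (v i).natAbs :=
          Int.natAbs_sum_le _ _
      _ ≤ ∑ _i ∈ Finset.range b, 2 ^ B :=
          Finset.sum_le_sum fun i hi => (bitLen_le_iff.1 (hv i (Finset.mem_range.1 hi))).le
      _ = b * 2 ^ B := by simp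
      _ < 2 ^ X * 2 ^ B :=
          Nat.mul_lt_mul_of_pos_right (hb.trans Nat.lt_two_pow_self) (by positivity)
      _ = 2 ^ (X + B) := (pow_add _ _ _).symm

/-! ### Costs of expressions -/

theorem Expr.bitLen_eval_le_cost (μ : Mem) (e : Expr) : bitLen (e.eval μ) ≤ e.cost μ := by
  cases e <;> simp [Expr.eval, Expr.cost]

/-- The weight of an expression: a factor that bounds its cost in terms of the bit lengths of the
numbers in the memory. -/
def Expr.wt : Expr → ℕ
  | .lit k => bitLen k
  | .read _ i => i.wt + 1
  | .bin _ e f => 2 * (e.wt + f.wt)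

/-- The expression does not read array `3`, and of array `2` it reads only cells with fixed
addresses below `d`. -/
def Expr.Scoped (d : ℕ) : Expr → Prop
  | .lit _ => True
  | .read a i => i.Scoped d ∧ a ≠ 3 ∧ (a = 2 → ∃ k < d, i = .lit (k : ℕ))
  | .bin _ e f => e.Scoped d ∧ f.Scoped d

/-- All numbers in the memory outside of array `3` have at most `X` bits. -/
def Mem.BitsLE (μ : Mem) (X : ℕ) : Prop := ∀ a i, a ≠ 3 → bitLen (μ a i) ≤ X

theorem Mem.BitsLE.pos {μ : Mem} {X : ℕ} (h : μ.BitsLE X) : 1 ≤ X :=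
  (bitLen_pos _).trans (h 0 0 (by decide))

/-- The value of a binary node is no longer than its two operands together, whose lengths their
costs already cover; hence the factor `2` in `Expr.wt`. Array `3` is left out of `Mem.BitsLE`
because it holds intermediate results, which may outgrow `X` bits. -/
theorem Expr.cost_le {d X : ℕ} {μ : Mem} (hμ : μ.BitsLE X) :
    ∀ {e : Expr}, e.Scoped d → e.cost μ ≤ e.wt * X
  | .lit k, _ => by
      simpa [Expr.cost, Expr.wt] using Nat.le_mul_of_pos_right (bitLen k) hμ.pos
  | .read a i, h => by
      have := Expr.cost_le hμ h.1
      have := hμ a (i.eval μ) h.2.1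
      simp only [Expr.cost, Expr.wt]; linarith
  | .bin o e f, h => by
      have h1 := Expr.cost_le hμ h.1
      have h2 := Expr.cost_le hμ h.2
      have h3 := bitLen_eval_le o (e.eval μ) (f.eval μ)
      have h4 := e.bitLen_eval_le_cost μ
      have h5 := f.bitLen_eval_le_cost μ
      simp only [Expr.cost, Expr.wt]; linarith

/-- Two memories that look the same to expressions with scope `d`. -/
def Mem.Agree (d : ℕ) (μ ν : Mem) : Prop :=
  (∀ a i, a ≠ 2 → a ≠ 3 → μ a i = ν a i) ∧ ∀ k < d, μ 2 (k : ℕ) = ν 2 (k : ℕ)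

theorem Mem.Agree.trans {d : ℕ} {μ ν ξ : Mem} (h : μ.Agree d ν) (h' : ν.Agree d ξ) :
    μ.Agree d ξ :=
  ⟨fun a i h2 h3 => (h.1 a i h2 h3).trans (h'.1 a i h2 h3),
    fun k hk => (h.2 k hk).trans (h'.2 k hk)⟩

theorem Mem.Agree.mono {d d' : ℕ} {μ ν : Mem} (h : μ.Agree d' ν) (hd : d ≤ d') : μ.Agree d ν :=
  ⟨h.1, fun k hk => h.2 k (hk.trans_le hd)⟩

theorem Expr.eval_congr {d : ℕ} {μ ν : Mem} (h : μ.Agree d ν) :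
    ∀ {e : Expr}, e.Scoped d → e.eval μ = e.eval ν
  | .lit k, _ => rfl
  | .read a i, he => by
      have hi := Expr.eval_congr h he.1
      simp only [Expr.eval, hi]
      by_cases h2 : a = 2
      · obtain ⟨k, hk, rfl⟩ := he.2.2 h2
        subst h2
        exact h.2 k hk
      · exact h.1 a _ h2 he.2.1
  | .bin o e f, he => by
      simp only [Expr.eval, Expr.eval_congr h he.1, Expr.eval_congr h he.2]

/-! ### Running programs -/

/-- Makes the output a function of the input and the coins. Without it, halting with one string
would not exclude another, and sampling probabilities could not be computed. -/
theorem Exec.deterministic {ω : ℕ → Bool} {c : Prog} {s s₁ : Config} {t₁ : ℕ}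
    (h₁ : Exec ω c s t₁ s₁) : ∀ {t₂ : ℕ} {s₂ : Config}, Exec ω c s t₂ s₂ → t₁ = t₂ ∧ s₁ = s₂ := by
  induction h₁ with
  | skip s => intro _ _ h; cases h; exact ⟨rfl, rfl⟩
  | write a i e s => intro _ _ h; cases h; exact ⟨rfl, rfl⟩
  | flip a i s => intro _ _ h; cases h; exact ⟨rfl, rfl⟩
  | emit e s => intro _ _ h; cases h; exact ⟨rfl, rfl⟩
  | seq _ _ ih ih' =>
      intro _ _ h
      cases h with
      | seq h h' =>
          obtain ⟨rfl, rfl⟩ := ih h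
          obtain ⟨rfl, rfl⟩ := ih' h'
          exact ⟨rfl, rfl⟩
  | ite_true hb _ ih =>
      intro _ _ h
      cases h with
      | ite_true _ h => obtain ⟨rfl, rfl⟩ := ih h; exact ⟨rfl, rfl⟩
      | ite_false hb' _ => exact absurd hb' hb
  | ite_false hb _ ih =>
      intro _ _ h
      cases h with
      | ite_true hb' _ => exact absurd hb hb'
      | ite_false _ h => obtain ⟨rfl, rfl⟩ := ih h; exact ⟨rfl, rfl⟩
  | loop_false hb =>
      intro _ _ h
      cases h with
      | loop_false _ => exact ⟨rfl, rfl⟩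
      | loop_true hb' _ _ => exact absurd hb hb'
  | loop_true hb _ _ ih ih' =>
      intro _ _ h
      cases h with
      | loop_false hb' => exact absurd hb' hb
      | loop_true _ h h' =>
          obtain ⟨rfl, rfl⟩ := ih h
          obtain ⟨rfl, rfl⟩ := ih' h'
          exact ⟨rfl, rfl⟩

/-- Started in `s`, the program halts within time `T` in a configuration that satisfies `Q`. -/
def Runs (ω : ℕ → Bool) (c : Prog) (s : Config) (T : ℕ) (Q : Config → Prop) : Prop :=
  ∃ t s', t ≤ T ∧ Exec ω c s t s' ∧ Q s'

namespace Runs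

variable {ω : ℕ → Bool} {c d : Prog} {s : Config} {T T' : ℕ} {Q R : Config → Prop}

theorem mono (h : Runs ω c s T Q) (hT : T ≤ T') (hQ : ∀ s', Q s' → R s') : Runs ω c s T' R := by
  obtain ⟨t, s', ht, he, hq⟩ := h
  exact ⟨t, s', ht.trans hT, he, hQ _ hq⟩

theorem skip (h : Q s) : Runs ω .skip s 1 Q := ⟨1, s, le_rfl, .skip s, h⟩

theorem write {a : ℕ} {i e : Expr} (hT : i.cost s.mem + e.cost s.mem + 1 ≤ T)
    (h : Q { s with mem := s.mem.set a (i.eval s.mem) (e.eval s.mem) }) :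
    Runs ω (.write a i e) s T Q := ⟨_, _, hT, .write a i e s, h⟩

theorem flip {a : ℕ} {i : Expr} (hT : i.cost s.mem + 1 ≤ T)
    (h : Q { s with mem := s.mem.set a (i.eval s.mem) (if ω s.pos then 1 else 0),
                    pos := s.pos + 1 }) :
    Runs ω (.flip a i) s T Q := ⟨_, _, hT, .flip a i s, h⟩

theorem emit {e : Expr} (hT : e.cost s.mem + 1 ≤ T)
    (h : Q { s with out := s.out ++ [e.eval s.mem] }) : Runs ω (.emit e) s T Q :=
  ⟨_, _, hT, .emit e s, h⟩

theorem seq (h : Runs ω c s T fun s' => Runs ω d s' T' Q) : Runs ω (.seq c d) s (T + T') Q := by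
  obtain ⟨t, s', ht, he, t', s'', ht', he', hq⟩ := h
  exact ⟨_, s'', add_le_add ht ht', .seq he he', hq⟩

theorem ite {b : Expr} {B : ℕ} (hB : b.cost s.mem ≤ B) (h1 : b.eval s.mem ≠ 0 → Runs ω c s T Q)
    (h2 : b.eval s.mem = 0 → Runs ω d s T Q) : Runs ω (.ite b c d) s (B + T + 1) Q := by
  by_cases hb : b.eval s.mem = 0
  · obtain ⟨t, s', ht, he, hq⟩ := h2 hb
    exact ⟨_, s', by omega, .ite_false hb he, hq⟩
  · obtain ⟨t, s', ht, he, hq⟩ := h1 hb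
    exact ⟨_, s', by omega, .ite_true hb he, hq⟩

/-- The invariant is indexed by the number of completed iterations, and the induction runs over
those still to come. The final `B + 1` pays for the test that fails. -/
theorem loop {b : Expr} (Inv : ℕ → Config → Prop) {N B : ℕ}
    (hB : ∀ i ≤ N, ∀ s, Inv i s → b.cost s.mem ≤ B)
    (hstep : ∀ i < N, ∀ s, Inv i s → b.eval s.mem ≠ 0 ∧ Runs ω c s T (Inv (i + 1)))
    (hend : ∀ s, Inv N s → b.eval s.mem = 0) (h0 : Inv 0 s) :
    Runs ω (.loop b c) s (N * (B + T + 1) + (B + 1)) (Inv N) := by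
  suffices H : ∀ k i, i + k = N → ∀ s, Inv i s →
      Runs ω (.loop b c) s (k * (B + T + 1) + (B + 1)) (Inv N) from H N 0 (by simp) s h0
  intro k
  induction k with
  | zero =>
      intro i hi s hs
      obtain rfl : i = N := by omega
      have := hB i le_rfl s hs
      exact ⟨_, s, by omega, .loop_false (hend s hs), hs⟩
  | succ k ih =>
      intro i hi s hs
      obtain ⟨hb, t, s', ht, he, hs'⟩ := hstep i (by omega) s hs
      obtain ⟨t', s'', ht', he', hs''⟩ := ih (i + 1) (by omega) s' hs'
      have := hB i (by omega) s hs
      refine ⟨_, s'', ?_, .loop_true hb he he', hs''⟩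
      rw [Nat.succ_mul]
      omega

end Runs

theorem Mem.set_apply (μ : Mem) (a : ℕ) (i v : ℤ) (b : ℕ) (j : ℤ) :
    μ.set a i v b j = if b = a ∧ j = i then v else μ b j := by
  unfold Mem.set
  by_cases h : b = a
  · subst h
    by_cases h' : j = i <;> simp [h']
  · simp [h]

theorem Mem.set_self (μ : Mem) (a : ℕ) (i v : ℤ) : μ.set a i v a i = v := by
  simp [Mem.set_apply]

theorem Mem.BitsLE.set {μ : Mem} {X : ℕ} (h : μ.BitsLE X) {a : ℕ} {i v : ℤ}
    (hv : a ≠ 3 → bitLen v ≤ X) : (μ.set a i v).BitsLE X := by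
  intro b j hb
  rw [Mem.set_apply]
  split
  · rename_i h'; exact hv (h'.1 ▸ hb)
  · exact h b j hb

/-! ### Expressions with bounded sums -/

/-- Expressions with sums; the number of terms of a sum is the content of a cell of array `4`. -/
inductive SumExpr : Type
  | ex (e : Expr)
  | bin (o : BinOp) (e f : SumExpr)
  | sum (r : ℕ) (e : SumExpr)

namespace SumExpr

/-- The value of an expression inside of `d` sums, with the summation variables in the cells
`0, …, d - 1` of array `2`. -/
def eval : ℕ → Mem → SumExpr → ℤ
  | _, μ, .ex e => e.eval μ
  | d, μ, .bin o e f => o.eval (e.eval d μ) (f.eval d μ)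
  | d, μ, .sum r e => ∑ i ∈ Finset.range (μ 4 r).toNat, e.eval (d + 1) (μ.set 2 d i)

def Scoped : ℕ → SumExpr → Prop
  | d, .ex e => e.Scoped d
  | d, .bin _ e f => e.Scoped d ∧ f.Scoped d
  | d, .sum _ e => e.Scoped (d + 1)

/-- A program that stores the value of the expression in cell `k` of array `3`. -/
def compile : ℕ → ℕ → SumExpr → Prog
  | _, k, .ex e => .write 3 (.lit k) e
  | d, k, .bin o e f =>
      .seq (e.compile d k) (.seq (f.compile d (k + 1))
        (.write 3 (.lit k) (.bin o (.read 3 (.lit k)) (.read 3 (.lit (k + 1 : ℕ))))))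
  | d, k, .sum r e =>
      .seq (.write 3 (.lit k) (.lit 0)) (.seq (.write 2 (.lit d) (.lit 0))
        (.loop (.bin .lt (.read 2 (.lit d)) (.read 4 (.lit r)))
          (.seq (e.compile (d + 1) (k + 1))
            (.seq (.write 3 (.lit k) (.bin .add (.read 3 (.lit k)) (.read 3 (.lit (k + 1 : ℕ)))))
              (.write 2 (.lit d) (.bin .add (.read 2 (.lit d)) (.lit 1)))))))

/-- A bound for the bit length of the value. -/
def lenBound : SumExpr → ℕ → ℕ
  | .ex e, X => e.wt * X
  | .bin _ e f, X => e.lenBound X + f.lenBound X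
  | .sum _ e, X => X + e.lenBound X

/-- A bound for the running time of the compiled program. -/
def timeBound : ℕ → ℕ → SumExpr → ℕ → ℕ
  | _, k, .ex e, X => bitLen k + e.wt * X + 1
  | d, k, .bin _ e f, X => e.timeBound d k X + (f.timeBound d (k + 1) X +
      (2 * bitLen k + bitLen (k + 1 : ℕ) + 2 * (e.lenBound X + f.lenBound X) + 1))
  | d, k, .sum r e, X =>
      (bitLen k + 2) + ((bitLen d + 2) + (X * ((bitLen d + bitLen r + 4 * X) +
        (e.timeBound (d + 1) (k + 1) X +
          ((2 * bitLen k + bitLen (k + 1 : ℕ) + 3 * (X + e.lenBound X) + 1) +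
            (2 * bitLen d + 2 * X + 6))) + 1) + ((bitLen d + bitLen r + 4 * X) + 1)))

theorem polyBounded_lenBound (e : SumExpr) : PolyBounded e.lenBound := by
  induction e with
  | ex e => exact (PolyBounded.const _).mul .id
  | bin o e f ihe ihf => exact ihe.add ihf
  | sum r e ih => exact PolyBounded.id.add ih

theorem polyBounded_timeBound (e : SumExpr) : ∀ d k, PolyBounded (e.timeBound d k) := by
  induction e with
  | ex e => exact fun d k => ((PolyBounded.const _).add ((PolyBounded.const _).mul .id)).add (.const _)
  | bin o e f ihe ihf =>
      exact fun d k => (ihe d k).add ((ihf d (k + 1)).add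
        (((PolyBounded.const _).add ((PolyBounded.const _).mul
          (e.polyBounded_lenBound.add f.polyBounded_lenBound))).add (.const _)))
  | sum r e ih =>
      have h4 : ∀ d r : ℕ, PolyBounded fun X => bitLen d + bitLen r + 4 * X := fun d r =>
        (PolyBounded.const _).add ((PolyBounded.const 4).mul .id)
      exact fun d k => (PolyBounded.const _).add ((PolyBounded.const _).add ((PolyBounded.id.mul
        (((h4 d r).add ((ih (d + 1) (k + 1)).add ((((PolyBounded.const _).add ((PolyBounded.const 3).mul
          (PolyBounded.id.add e.polyBounded_lenBound))).add (.const 1)).add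
          (((PolyBounded.const _).add ((PolyBounded.const 2).mul .id)).add (.const 6))))).add
            (.const 1))).add ((h4 d r).add (.const 1))))

/-- All bounds of sums, stored in array `4`, are less than `X`. -/
def _root_.Mem.SizesLT (μ : Mem) (X : ℕ) : Prop := ∀ r : ℕ, (μ 4 r).toNat < X

theorem bitLen_natCast_le {i X : ℕ} (h : i < X) : bitLen (i : ℤ) ≤ X :=
  (bitLen_le_natAbs _).trans (by simpa using h)

theorem _root_.Mem.SizesLT.set {μ : Mem} {X : ℕ} (h : μ.SizesLT X) {a : ℕ} {i v : ℤ}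
    (ha : a ≠ 4) : (μ.set a i v).SizesLT X := by
  intro r
  rw [Mem.set_apply, if_neg (by omega)]
  exact h r

theorem bitLen_eval_le {X : ℕ} (e : SumExpr) : ∀ {d : ℕ} {μ : Mem}, e.Scoped d → μ.BitsLE X →
    μ.SizesLT X → bitLen (e.eval d μ) ≤ e.lenBound X := by
  induction e with
  | ex e => exact fun h hμ _ => (e.bitLen_eval_le_cost _).trans (e.cost_le hμ h)
  | bin o e f ihe ihf =>
      exact fun h hμ hX => (_root_.bitLen_eval_le o _ _).trans
        (add_le_add (ihe h.1 hμ hX) (ihf h.2 hμ hX))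
  | sum r e ih =>
      intro d μ h hμ hX
      refine bitLen_sum_le _ _ _ _ (hX r) fun i hi => ih h (hμ.set fun _ => ?_) (hX.set (by decide))
      exact bitLen_natCast_le (hi.trans (hX r))

theorem eval_congr (e : SumExpr) : ∀ {d : ℕ} {μ ν : Mem}, e.Scoped d → μ.Agree d ν →
    e.eval d μ = e.eval d ν := by
  induction e with
  | ex e => exact fun h hμ => Expr.eval_congr hμ h
  | bin o e f ihe ihf => exact fun h hμ => by simp only [eval, ihe h.1 hμ, ihf h.2 hμ]
  | sum r e ih =>
      intro d μ ν h hμ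
      simp only [eval, hμ.1 4 r (by decide) (by decide)]
      refine Finset.sum_congr rfl fun i _ => ih h ⟨fun a j h2 h3 => ?_, fun k hk => ?_⟩
      · simp only [Mem.set_apply, h2, false_and, if_false, hμ.1 a j h2 h3]
      · simp only [Mem.set_apply, true_and]
        split
        · rfl
        · exact hμ.2 k (by omega)

/-- What a run of a compiled expression leaves unchanged. -/
structure Frame (d k : ℕ) (s s' : Config) : Prop where
  agree : s'.mem.Agree d s.mem
  slots : ∀ j < k, s'.mem 3 (j : ℕ) = s.mem 3 (j : ℕ)
  pos : s'.pos = s.pos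
  out : s'.out = s.out

theorem Frame.trans {d k : ℕ} {s s' s'' : Config} (h : Frame d k s s') (h' : Frame d k s' s'') :
    Frame d k s s'' :=
  ⟨h'.agree.trans h.agree, fun j hj => (h'.slots j hj).trans (h.slots j hj), h'.pos.trans h.pos,
    h'.out.trans h.out⟩

theorem Frame.mono {d d' k k' : ℕ} {s s' : Config} (h : Frame d' k' s s') (hd : d ≤ d')
    (hk : k ≤ k') : Frame d k s s' :=
  ⟨h.agree.mono hd, fun j hj => h.slots j (hj.trans_le hk), h.pos, h.out⟩

theorem Frame.sizesLT {d k X : ℕ} {s s' : Config} (h : Frame d k s s') (hX : s.mem.SizesLT X) :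
    s'.mem.SizesLT X := fun r => by
  rw [h.agree.1 4 r (by decide) (by decide)]; exact hX r

theorem frame_set_three (d k : ℕ) (s : Config) (v : ℤ) :
    Frame d k s { s with mem := s.mem.set 3 (k : ℕ) v } :=
  ⟨⟨fun a i _ h3 => by simp [Mem.set_apply, h3], fun j _ => by simp [Mem.set_apply]⟩,
    fun j hj => by dsimp only; rw [Mem.set_apply, if_neg]; omega, rfl, rfl⟩

theorem frame_set_two (d k : ℕ) (s : Config) (v : ℤ) :
    Frame d k s { s with mem := s.mem.set 2 (d : ℕ) v } :=
  ⟨⟨fun a i h2 _ => by simp [Mem.set_apply, h2],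
    fun j hj => by dsimp only; rw [Mem.set_apply, if_neg]; omega⟩, fun j _ => by simp [Mem.set_apply],
    rfl, rfl⟩

/-- Array `3` serves as a stack of results and array `2` as a stack of loop counters. A subprogram
started with `d` and `k` leaves the cells below these alone, as `Frame` records; so a first operand
or a running total survives the computation of the next operand or summand. -/
theorem runs_compile {ω : ℕ → Bool} {X : ℕ} (e : SumExpr) : ∀ {d k : ℕ} {s : Config},
    e.Scoped d → s.mem.BitsLE X → s.mem.SizesLT X →
    Runs ω (e.compile d k) s (e.timeBound d k X) fun s' =>
      Frame d k s s' ∧ s'.mem.BitsLE X ∧ s'.mem 3 (k : ℕ) = e.eval d s.mem := by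
  induction e with
  | ex e =>
      intro d k s h hμ hX
      have := e.cost_le hμ h
      refine Runs.write (by simp only [Expr.cost, timeBound]; omega) ?_
      exact ⟨frame_set_three _ _ _ _, hμ.set (absurd rfl), s.mem.set_self 3 k (e.eval s.mem)⟩
  | bin o e f ihe ihf =>
      intro d k s h hμ hX
      refine Runs.seq ((ihe h.1 hμ hX).mono le_rfl ?_)
      rintro s₁ ⟨hF₁, hμ₁, he₁⟩
      have hX₁ := hF₁.sizesLT hX
      refine Runs.seq ((ihf h.2 hμ₁ hX₁).mono le_rfl ?_)
      rintro s₂ ⟨hF₂, hμ₂, he₂⟩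
      have hv : s₂.mem 3 (k : ℕ) = e.eval d s.mem := (hF₂.slots k (by omega)).trans he₁
      have hw : s₂.mem 3 (k + 1 : ℕ) = f.eval d s.mem :=
        he₂.trans (f.eval_congr h.2 hF₁.agree)
      have b1 := e.bitLen_eval_le h.1 hμ hX
      have b2 := f.bitLen_eval_le h.2 hμ hX
      have b3 := _root_.bitLen_eval_le o (e.eval d s.mem) (f.eval d s.mem)
      refine Runs.write ?_ ⟨?_, ?_, ?_⟩
      · simp only [Expr.cost, Expr.eval, hv, hw]; omega
      · exact (hF₁.trans (hF₂.mono le_rfl (by omega))).trans (frame_set_three _ _ _ _)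
      · exact hμ₂.set (absurd rfl)
      · simp only [Expr.eval, hv, hw, Mem.set_self, eval]
  | sum r e ih =>
      intro d k s h hμ hX
      set b := (s.mem 4 r).toNat with hb
      have hbX : b < X := hX r
      set v : ℕ → ℤ := fun i => e.eval (d + 1) (s.mem.set 2 d i) with hv
      have hvB : ∀ i < b, bitLen (v i) ≤ e.lenBound X := fun i hi =>
        e.bitLen_eval_le h (hμ.set fun _ => bitLen_natCast_le (hi.trans hbX)) (hX.set (by decide))
      have hsum : ∀ i ≤ b, bitLen (∑ j ∈ Finset.range i, v j) ≤ X + e.lenBound X := fun i hi =>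
        bitLen_sum_le _ _ _ _ (hi.trans_lt hbX) fun j hj => hvB j (hj.trans_le hi)
      let Inv : ℕ → Config → Prop := fun i s' => Frame d k s s' ∧ s'.mem.BitsLE X ∧
        s'.mem 2 (d : ℕ) = i ∧ s'.mem 3 (k : ℕ) = ∑ j ∈ Finset.range i, v j
      have h1 : bitLen 0 = 1 := rfl
      have h2 : bitLen 1 = 2 := rfl
      refine Runs.seq (Runs.write (by simp only [Expr.cost, h1]; omega) (Runs.seq (Runs.write
        (by simp only [Expr.cost, h1]; omega) ((Runs.loop Inv (N := b)
          (B := bitLen d + bitLen r + 4 * X)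
          (T := e.timeBound (d + 1) (k + 1) X +
            ((2 * bitLen k + bitLen (k + 1 : ℕ) + 3 * (X + e.lenBound X) + 1) +
            (2 * bitLen d + 2 * X + 6))) ?_ ?_ ?_ ?_).mono ?_ ?_))))
      · rintro i hi s' ⟨hF, hB, -, -⟩
        have c1 := hB 2 d (by decide)
        have c2 := hB 4 r (by decide)
        have c3 := _root_.bitLen_eval_le .lt (s'.mem 2 d) (s'.mem 4 r)
        simp only [Expr.cost, Expr.eval]; omega
      · rintro i hi s' ⟨hF, hB, hi', hacc⟩
        have h4 : s'.mem 4 r = s.mem 4 r := hF.agree.1 4 r (by decide) (by decide)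
        refine ⟨?_, Runs.seq ((ih h hB (hF.sizesLT hX)).mono le_rfl ?_)⟩
        · have : (i : ℤ) < s.mem 4 r := by omega
          simp [Expr.eval, BinOp.eval, hi', h4, this]
        rintro s₂ ⟨hF₂, hB₂, he₂⟩
        -- Within scope `d + 1`, the current memory differs from `s.mem` only in the counter.
        have hval : e.eval (d + 1) s'.mem = v i := by
          refine e.eval_congr h ⟨fun a j h2 h3 => ?_, fun j hj => ?_⟩
          · rw [hF.agree.1 a j h2 h3, Mem.set_apply, if_neg (by omega)]
          · rw [Mem.set_apply]
            split
            · rename_i h; rw [h.2, hi']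
            · exact hF.agree.2 j (by omega)
        rw [hval] at he₂
        have hacc₂ : s₂.mem 3 (k : ℕ) = ∑ j ∈ Finset.range i, v j :=
          (hF₂.slots k (by omega)).trans hacc
        have hi₂ : s₂.mem 2 (d : ℕ) = i := (hF₂.agree.2 d (by omega)).trans hi'
        have c1 := hsum i hi.le
        have c2 := hsum (i + 1) hi
        have c3 := hvB i hi
        refine Runs.seq (Runs.write ?_ (Runs.write ?_ ⟨?_, ?_, ?_, ?_⟩))
        · simp only [Expr.cost, Expr.eval, BinOp.eval, hacc₂, he₂, ← Finset.sum_range_succ]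
          omega
        · have c4 := bitLen_natCast_le (hi.trans hbX)
          have c5 := bitLen_add_le i 1
          simp only [Expr.cost, Expr.eval, BinOp.eval, Mem.set_apply, hi₂, h2]
          simp only [Nat.reduceEqDiff, false_and, if_false]
          omega
        · exact ((hF.trans (hF₂.mono (by omega) (by omega))).trans
            (frame_set_three _ _ _ _)).trans (frame_set_two _ _ _ _)
        · refine (hB₂.set (absurd rfl)).set fun _ => ?_
          have : (s₂.mem 2 (d : ℕ) + 1) = ((i + 1 : ℕ) : ℤ) := by rw [hi₂]; simp
          simp only [Expr.eval, BinOp.eval, Mem.set_apply, Nat.reduceEqDiff, false_and, if_false,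
            this]
          exact bitLen_natCast_le (by omega)
        · simp [Expr.eval, BinOp.eval, Mem.set_apply, hi₂]
        · push_cast at he₂
          simp [Expr.eval, BinOp.eval, Mem.set_apply, hacc₂, he₂, Finset.sum_range_succ]
      · rintro s' ⟨hF, hB, hi', -⟩
        have h4 : s'.mem 4 r = s.mem 4 r := hF.agree.1 4 r (by decide) (by decide)
        have : ¬ ((b : ℤ) < s.mem 4 r) := by omega
        simp [Expr.eval, BinOp.eval, hi', h4, this]
      · refine ⟨(frame_set_three _ _ _ _).trans (frame_set_two _ _ _ _),
          (hμ.set (absurd rfl)).set fun _ => by simpa [Expr.eval, h1] using hμ.pos, ?_, ?_⟩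
        · simp [Expr.eval, Mem.set_apply]
        · simp [Expr.eval, Mem.set_apply]
      -- `timeBound` charges `X` iterations, because the true number `b` depends on the memory.
      · exact Nat.add_le_add_right (Nat.mul_le_mul_right _ hbX.le) _
      · rintro s' ⟨hF, hB, -, hacc⟩
        exact ⟨hF, hB, hacc⟩

end SumExpr

/-! ### Signs and Fourier analysis on bit strings -/

/-- Functions that factorize over the qubits are summed one bit at a time. Characters, noise weights
and marginals are all reduced to single bits in this way. -/
theorem prod_sum_bits {R : Type*} [CommSemiring R] {n : ℕ} (f : Fin n → Fin 2 → R) :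
    ∏ j, ∑ b, f j b = ∑ x : Bits n, ∏ j, f j (x j) := by
  rw [Finset.prod_univ_sum, Fintype.piFinset_univ]

def bitSign (a b : Fin 2) : ℤ := if a = 1 ∧ b = 1 then -1 else 1

/-- The sign `(-1)^(x · y)`. -/
def bitsSign {n : ℕ} (x y : Bits n) : ℤ := ∏ j, bitSign (x j) (y j)

section BitsSign

variable {n : ℕ}

theorem bitSign_comm (a b : Fin 2) : bitSign a b = bitSign b a := by revert a b; decide

theorem bitSign_add (a b c : Fin 2) : bitSign a (b + c) = bitSign a b * bitSign a c := by
  revert a b c; decide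

theorem bitsSign_comm (x y : Bits n) : bitsSign x y = bitsSign y x :=
  Finset.prod_congr rfl fun _ _ => bitSign_comm _ _

theorem bitsSign_add_right (x y z : Bits n) :
    bitsSign x (y + z) = bitsSign x y * bitsSign x z := by
  simp only [bitsSign, ← Finset.prod_mul_distrib, Pi.add_apply, bitSign_add]

theorem bitsSign_add_left (x y z : Bits n) :
    bitsSign (x + y) z = bitsSign x z * bitsSign y z := by
  rw [bitsSign_comm, bitsSign_add_right, bitsSign_comm z, bitsSign_comm z]

theorem bits_add_self (x : Bits n) : x + x = 0 := by
  ext j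
  have : ∀ b : Fin 2, b + b = 0 := by decide
  simp [this]

theorem bits_add_eq_zero {x y : Bits n} : x + y = 0 ↔ x = y := by
  constructor
  · intro h
    have : x + y + y = y := by rw [h, zero_add]
    rwa [add_assoc, bits_add_self, add_zero] at this
  · rintro rfl; exact bits_add_self x

theorem bitsSign_zero_left (x : Bits n) : bitsSign 0 x = 1 := by
  refine Finset.prod_eq_one fun j _ => ?_
  have : ∀ b : Fin 2, bitSign 0 b = 1 := by decide
  exact this _

theorem sum_bitsSign (x : Bits n) : ∑ y, bitsSign x y = if x = 0 then 2 ^ n else 0 := by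
  have h : ∑ y, bitsSign x y = ∏ j, ∑ b, bitSign (x j) b := (prod_sum_bits _).symm
  have h' : ∀ a : Fin 2, ∑ b, bitSign a b = if a = 0 then 2 else 0 := by decide
  rw [h]
  simp only [h']
  split
  · rename_i hx; simp [hx]
  · rename_i hx
    obtain ⟨j, hj⟩ := Function.ne_iff.1 hx
    exact Finset.prod_eq_zero (Finset.mem_univ j) (by simpa using hj)

theorem sum_bitsSign_mul (x y : Bits n) :
    ∑ z, bitsSign x z * bitsSign y z = if x = y then 2 ^ n else 0 := by
  simp only [← bitsSign_add_left, sum_bitsSign, bits_add_eq_zero]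

theorem sum_bitsSign_mul_cast (x y : Bits n) :
    ∑ z, (bitsSign x z : ℝ) * bitsSign y z = if x = y then 2 ^ n else 0 := by
  have := sum_bitsSign_mul x y
  exact_mod_cast congrArg (Int.cast : ℤ → ℝ) this

/-- Parseval's identity. -/
theorem sum_sq_fourier (a : Bits n → ℝ) :
    ∑ s, (∑ x, a x * bitsSign s x) ^ 2 = 2 ^ n * ∑ x, a x ^ 2 := by
  calc ∑ s, (∑ x, a x * bitsSign s x) ^ 2
      = ∑ s, ∑ x, ∑ y, a x * a y * (bitsSign x s * bitsSign y s) := by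
        refine Finset.sum_congr rfl fun s _ => ?_
        rw [sq, Finset.sum_mul_sum]
        refine Finset.sum_congr rfl fun x _ => Finset.sum_congr rfl fun y _ => ?_
        rw [bitsSign_comm s x, bitsSign_comm s y]; ring
    _ = ∑ x, ∑ y, a x * a y * ∑ s, ((bitsSign x s : ℝ) * bitsSign y s) := by
        rw [Finset.sum_comm]
        refine Finset.sum_congr rfl fun x _ => ?_
        rw [Finset.sum_comm]
        simp only [Finset.mul_sum]
    _ = 2 ^ n * ∑ x, a x ^ 2 := by
        simp only [sum_bitsSign_mul_cast, mul_ite, mul_zero, Finset.sum_ite_eq,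
          Finset.mem_univ, if_true, Finset.mul_sum]
        exact Finset.sum_congr rfl fun x _ => by ring

/-- The `l₁` norm of a function is at most the `l₂` norm of its Fourier coefficients. -/
theorem sum_abs_fourier_le (e : Bits n → ℝ) {η : ℝ} (hη : 0 ≤ η) (h : ∑ s, e s ^ 2 ≤ η ^ 2) :
    ∑ x, |(2 ^ n)⁻¹ * ∑ s, e s * bitsSign x s| ≤ η := by
  refine abs_le_of_sq_le_sq' ?_ hη |>.2
  -- Cauchy–Schwarz over the `2 ^ n` strings, then Parseval; the powers of two cancel exactly.
  calc (∑ x, |(2 ^ n)⁻¹ * ∑ s, e s * bitsSign x s|) ^ 2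
      ≤ (Finset.univ : Finset (Bits n)).card *
          ∑ x, |(2 ^ n)⁻¹ * ∑ s, e s * bitsSign x s| ^ 2 := sq_sum_le_card_mul_sum_sq
    _ = ∑ s, e s ^ 2 := by
        have h2 : ((2 : ℝ) ^ n) ≠ 0 := by positivity
        simp only [sq_abs, mul_pow, ← Finset.mul_sum, sum_sq_fourier]
        rw [Finset.card_univ]
        simp only [Fintype.card_fun, Fintype.card_fin, Nat.cast_pow, Nat.cast_ofNat]
        field_simp
    _ ≤ η ^ 2 := h

end BitsSign

/-! ### Amplitudes of IQP circuits -/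

/-- `1` if all qubits of the gate are `1` in the basis state `z`, and `0` otherwise. -/
def DiagGate.bit {n : ℕ} : DiagGate n → Bits n → ℕ
  | .z i, x => x i
  | .cz i j _, x => x i * x j
  | .ccz i j k _ _ _, x => x i * x j * x k

theorem DiagGate.op_eq {n : ℕ} (g : DiagGate n) :
    g.op = Matrix.diagonal fun z => (((-1) ^ g.bit z : ℤ) : ℂ) := by
  have h : ∀ a b c : Fin 2, ((if a = 1 ∧ b = 1 ∧ c = 1 then -1 else 1 : ℤ) =
      (-1) ^ ((a : ℕ) * (b : ℕ) * (c : ℕ))) := by decide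
  have h' : ∀ a b : Fin 2, ((if a = 1 ∧ b = 1 then -1 else 1 : ℤ) =
      (-1) ^ ((a : ℕ) * (b : ℕ))) := by decide
  have h'' : ∀ a : Fin 2, ((if a = 1 then -1 else 1 : ℤ) = (-1) ^ (a : ℕ)) := by decide
  cases g
  · simp only [op, bit, ← h'']; congr 1; ext z; split <;> simp
  · simp only [op, bit, ← h']; congr 1; ext z; split <;> simp
  · simp only [op, bit, ← h]; congr 1; ext z; split <;> simp

namespace IQPCircuit

variable {n : ℕ}

/-- The exponent of `-1` in the diagonal entry of `D` at `z`. -/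
def phase (C : IQPCircuit n) (z : Bits n) : ℕ := (C.gates.map fun g => g.bit z).sum

def diagSign (C : IQPCircuit n) (z : Bits n) : ℤ := (-1) ^ C.phase z

theorem diagSign_mul_self (C : IQPCircuit n) (z : Bits n) : C.diagSign z * C.diagSign z = 1 := by
  rw [diagSign, ← mul_pow]; simp

theorem diagOp_eq (C : IQPCircuit n) :
    C.diagOp = Matrix.diagonal fun z => ((C.diagSign z : ℤ) : ℂ) := by
  -- Generalized from the identity to a diagonal of signs with arbitrary exponents, since `foldl`
  -- carries along the product of the earlier gates.
  have h : ∀ (l : List (DiagGate n)) (e : Bits n → ℕ),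
      l.foldl (fun A g => g.op * A) (Matrix.diagonal fun z => (((-1) ^ e z : ℤ) : ℂ)) =
        Matrix.diagonal fun z => (((-1) ^ (e z + (l.map fun g => g.bit z).sum) : ℤ) : ℂ) := by
    intro l
    induction l with
    | nil => intro e; simp
    | cons g l ih =>
        intro e
        rw [List.foldl_cons, DiagGate.op_eq, Matrix.diagonal_mul_diagonal]
        have h1 : (fun i => (((-1) ^ g.bit i : ℤ) : ℂ) * (((-1) ^ e i : ℤ) : ℂ)) =
            fun i => (((-1) ^ (e i + g.bit i) : ℤ) : ℂ) := by
          ext i; push_cast; rw [pow_add]; ring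
        rw [h1, ih fun i => e i + g.bit i]
        simp only [List.map_cons, List.sum_cons, add_assoc]
  have := h C.gates fun _ => 0
  simpa [diagOp, diagSign, phase] using this

theorem hadamardLayer_apply (x y : Bits n) :
    hadamardLayer n x y = ((√2 : ℝ) : ℂ)⁻¹ ^ n * (bitsSign x y : ℤ) := by
  have h : ∀ a b : Fin 2, hadamardGate a b = ((√2 : ℝ) : ℂ)⁻¹ * (bitSign a b : ℤ) := by
    intro a b
    fin_cases a <;> fin_cases b <;>
      simp [hadamardGate, pauliX, pauliZ, bitSign]
  simp only [hadamardLayer, Matrix.of_apply, h, Finset.prod_mul_distrib, bitsSign]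
  simp

/-- The amplitude `⟨x| C |0ⁿ⟩`. -/
noncomputable def amplitude (C : IQPCircuit n) (x : Bits n) : ℝ :=
  (2 ^ n)⁻¹ * ∑ z, (bitsSign x z : ℝ) * C.diagSign z

/-- The Hadamard layers contribute the characters of `x` and of `y` at the same diagonal index `z`,
and these combine to the character of `x + y`. Thus `C` commutes with bit flips, on which the
equality of the two noise models rests. -/
theorem op_apply (C : IQPCircuit n) (x y : Bits n) : C.op x y = (C.amplitude (x + y) : ℂ) := by
  have h2 : (((√2 : ℝ) : ℂ)⁻¹ ^ n) * (((√2 : ℝ) : ℂ)⁻¹ ^ n) = (2 ^ n)⁻¹ := by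
    rw [← mul_pow, ← mul_inv, ← Complex.ofReal_mul, Real.mul_self_sqrt (by norm_num), inv_pow]
    simp
  rw [op, Matrix.mul_apply]
  simp only [diagOp_eq, Matrix.mul_diagonal, hadamardLayer_apply, amplitude, bitsSign_add_left]
  push_cast
  rw [← h2, Finset.mul_sum]
  refine Finset.sum_congr rfl fun z _ => ?_
  rw [bitsSign_comm z y]
  ring

theorem outputDist_eq (C : IQPCircuit n) (x : Bits n) : C.outputDist x = C.amplitude x ^ 2 := by
  rw [outputDist, op_apply, add_zero, Complex.norm_real, Real.norm_eq_abs, sq_abs]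

theorem outputDist_nonneg (C : IQPCircuit n) (x : Bits n) : 0 ≤ C.outputDist x := sq_nonneg _

/-- The Fourier coefficients of the output distribution. -/
noncomputable def coeff (C : IQPCircuit n) (s : Bits n) : ℝ := ∑ x, C.outputDist x * bitsSign s x

theorem sum_sq_coeff (C : IQPCircuit n) :
    ∑ s, C.coeff s ^ 2 = 2 ^ n * ∑ x, C.outputDist x ^ 2 := sum_sq_fourier _

/-- The Fourier coefficients of the output distribution as mean values of signs. -/
theorem coeff_eq (C : IQPCircuit n) (s : Bits n) :
    C.coeff s = (2 ^ n)⁻¹ * ∑ z, (C.diagSign z : ℝ) * C.diagSign (z + s) := by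
  have h2 : ((2 : ℝ) ^ n) ≠ 0 := by positivity
  -- Expand the square of the amplitude and sum over `x` first; orthogonality of characters then
  -- leaves only `w = z + s`.
  have h : C.coeff s = ((2 ^ n)⁻¹ * (2 ^ n)⁻¹) * ∑ z, ∑ w, ((C.diagSign z : ℝ) * C.diagSign w) *
      ∑ x, (bitsSign (z + s) x : ℝ) * bitsSign w x := by
    have h1 : ∀ x, C.outputDist x * bitsSign s x = ∑ z, ∑ w, ((2 ^ n)⁻¹ * (2 ^ n)⁻¹) *
        (((C.diagSign z : ℝ) * C.diagSign w) * ((bitsSign (z + s) x : ℝ) * bitsSign w x)) := by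
      intro x
      rw [outputDist_eq, amplitude, mul_pow, sq (∑ z, _), Finset.sum_mul_sum, Finset.mul_sum,
        Finset.sum_mul]
      refine Finset.sum_congr rfl fun z _ => ?_
      rw [Finset.mul_sum, Finset.sum_mul]
      refine Finset.sum_congr rfl fun w _ => ?_
      rw [bitsSign_add_left, bitsSign_comm x z, bitsSign_comm x w]
      push_cast
      ring
    simp only [coeff, h1, Finset.mul_sum]
    rw [Finset.sum_comm]
    exact Finset.sum_congr rfl fun z _ => Finset.sum_comm
  rw [h]
  simp only [sum_bitsSign_mul_cast, mul_ite, mul_zero, Finset.sum_ite_eq, Finset.mem_univ, if_true]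
  rw [← Finset.sum_mul]
  field_simp

end IQPCircuit

/-! ### Depolarizing noise -/

/-- The probability with which depolarizing noise adds `b` to a bit. -/
noncomputable def flipWeight (ε : ℝ) (b : Fin 2) : ℝ := if b = 0 then 1 - ε / 2 else ε / 2

/-- Diagonal entries suffice here, since a `Z` measurement follows; to these the off-diagonal matrix
units contribute nothing. -/
theorem depolarizing_single (ε : ℝ) (a b x : Fin 2) :
    depolarizing ε (Matrix.single a b 1) x x = if a = b then (flipWeight ε (x + a) : ℂ) else 0 := by
  fin_cases a <;> fin_cases b <;> fin_cases x <;>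
    simp [depolarizing, flipWeight] <;> ring

/-- At the input all entries are needed, because `C` still acts. The noise turns `|0⟩⟨0|` into a
mixture of basis states without coherences. -/
theorem depolarizing_single_zero (ε : ℝ) (x y : Fin 2) :
    depolarizing ε (Matrix.single 0 0 1) x y = if x = y then (flipWeight ε x : ℂ) else 0 := by
  fin_cases x <;> fin_cases y <;>
    simp [depolarizing, flipWeight] <;> ring

theorem prod_ite_eq_apply {R : Type*} [CommMonoidWithZero R] {n : ℕ} (x y : Bits n)
    (w : Fin n → R) : (∏ j, if x j = y j then w j else 0) = if x = y then ∏ j, w j else 0 := by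
  split
  · rename_i h; simp [h]
  · rename_i h
    obtain ⟨j, hj⟩ := Function.ne_iff.1 h
    exact Finset.prod_eq_zero (Finset.mem_univ j) (by simp [hj])

namespace IQPCircuit

variable {n : ℕ}

/-- The output distribution with independent bit flips. -/
noncomputable def noisyDist (C : IQPCircuit n) (ε : Fin n → ℝ) (x : Bits n) : ℝ :=
  ∑ y, C.outputDist y * ∏ j, flipWeight (ε j) (x j + y j)

theorem outputNoiseDist_eq (C : IQPCircuit n) (ε : Fin n → ℝ) :
    C.outputNoiseDist ε = C.noisyDist ε := by
  ext x
  have hρ : ∀ a, (C.op * zeroState n * C.opᴴ) a a = (C.outputDist a : ℂ) := by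
    intro a
    rw [outputDist_eq, Matrix.mul_assoc, Matrix.mul_apply, Finset.sum_eq_single 0]
    · rw [Matrix.mul_apply, Finset.sum_eq_single 0]
      · simp [zeroState, op_apply, sq]
      · intro b _ hb; simp [zeroState, hb.symm]
      · simp
    · intro b _ hb
      rw [Matrix.mul_apply, Finset.sum_eq_zero, mul_zero]
      intro c _; simp [zeroState, hb.symm]
    · simp
  simp only [outputNoiseDist, measureZ, depolarizeAll, tensorChannel, Matrix.of_apply,
    depolarizing_single, prod_ite_eq_apply, mul_ite, mul_zero, Finset.sum_ite_eq, Finset.mem_univ,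
    if_true, hρ, noisyDist]
  rw [Complex.re_sum]
  refine Finset.sum_congr rfl fun y _ => ?_
  rw [← Complex.ofReal_prod, ← Complex.ofReal_mul, Complex.ofReal_re]

/-- The noisy input is a random basis state `y` whose bit `j` is `1` with probability `ε_j / 2`. By
`op_apply` the outcome `x` then has probability `p (x + y)`, as if the outcome of a noise-free run
had been flipped by `y`. -/
theorem inputNoiseDist_eq (C : IQPCircuit n) (ε : Fin n → ℝ) :
    C.inputNoiseDist ε = C.noisyDist ε := by
  ext x
  have hρ : depolarizeAll ε (zeroState n) =
      Matrix.diagonal fun y => ((∏ j, flipWeight (ε j) (y j) : ℝ) : ℂ) := by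
    ext y z
    rw [depolarizeAll, tensorChannel, Matrix.of_apply, Finset.sum_eq_single 0,
      Finset.sum_eq_single 0]
    · simp only [zeroState, Matrix.single_apply_same, one_mul, Pi.zero_apply,
        depolarizing_single_zero, prod_ite_eq_apply, Matrix.diagonal_apply, Complex.ofReal_prod]
    · intro b _ hb; simp [zeroState, hb.symm]
    · simp
    · intro b _ hb
      refine Finset.sum_eq_zero fun c _ => ?_
      simp [zeroState, hb.symm]
    · simp
  rw [inputNoiseDist, measureZ, hρ, Matrix.mul_apply, Complex.re_sum]
  rw [noisyDist, ← Equiv.sum_comp (Equiv.addLeft x)]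
  refine Finset.sum_congr rfl fun y _ => ?_
  rw [Matrix.mul_diagonal, Matrix.conjTranspose_apply, op_apply, outputDist_eq,
    Equiv.coe_addLeft]
  have hx : x + (x + y) = y := by rw [← add_assoc, bits_add_self, zero_add]
  rw [RCLike.star_def, Complex.conj_ofReal, ← Complex.ofReal_mul, ← Complex.ofReal_mul,
    Complex.ofReal_re, hx]
  simp only [Pi.add_apply]
  ring

/-- The Fourier expansion of the noisy output distribution. -/
theorem noisyDist_eq (C : IQPCircuit n) (ε : Fin n → ℝ) (x : Bits n) :
    C.noisyDist ε x = (2 ^ n)⁻¹ *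
      ∑ s : Bits n, ((∏ j, if s j = 1 then 1 - ε j else 1) * C.coeff s) * bitsSign x s := by
  have h : ∀ y : Bits n, ∏ j, flipWeight (ε j) (x j + y j) = (2 ^ n)⁻¹ *
      ∑ s : Bits n, (∏ j, if s j = 1 then 1 - ε j else 1) * (bitsSign s x * bitsSign s y : ℤ) := by
    intro y
    -- On a single bit, the flip distribution has the Fourier coefficients `1` and `(1 - ε / 2) - ε
    -- / 2 = 1 - ε`.
    have h1 : ∀ (ε : ℝ) (b : Fin 2), flipWeight ε b =
        2⁻¹ * ∑ s, (if s = 1 then 1 - ε else 1) * (bitSign s b : ℝ) := by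
      intro ε b
      fin_cases b <;> simp [flipWeight, bitSign] <;> ring
    simp only [h1, Finset.prod_mul_distrib, prod_sum_bits, bitsSign, bitSign_add]
    push_cast
    simp [Finset.prod_mul_distrib]
  simp only [noisyDist, h, coeff, Finset.mul_sum]
  rw [Finset.sum_comm]
  refine Finset.sum_congr rfl fun s _ => ?_
  rw [Finset.sum_mul, Finset.mul_sum]
  refine Finset.sum_congr rfl fun y _ => ?_
  rw [bitsSign_comm x s]
  push_cast
  ring

theorem noisyDist_nonneg (C : IQPCircuit n) {ε : Fin n → ℝ} (h : ∀ j, 0 < ε j ∧ ε j < 1)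
    (x : Bits n) : 0 ≤ C.noisyDist ε x := by
  refine Finset.sum_nonneg fun y _ => mul_nonneg (C.outputDist_nonneg y)
    (Finset.prod_nonneg fun j _ => ?_)
  have := h j
  unfold flipWeight
  split <;> linarith

end IQPCircuit

/-! ### A tail bound for empirical means -/

section TailBound

variable {A : Type*} [Fintype A]

/-- For `|u| ≤ 1` one has `exp u ≤ 1 + u + u ^ 2`. Summed over `A`, the linear term vanishes and the
variance controls the quadratic one; `1 + t ^ 2 ≤ exp (t ^ 2)` gives a form that can be raised to
the power `N`. -/
theorem sum_exp_le {h : A → ℝ} {t : ℝ} (ht : |t| ≤ 1 / 2) (h2 : ∀ a, |h a| ≤ 2)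
    (h0 : ∑ a, h a = 0) (hsq : ∑ a, h a ^ 2 ≤ Fintype.card A) :
    ∑ a, Real.exp (t * h a) ≤ Fintype.card A * Real.exp (t ^ 2) := by
  have hp : ∀ a, Real.exp (t * h a) ≤ 1 + t * h a + t ^ 2 * h a ^ 2 := fun a => by
    have h1 : |t * h a| ≤ 1 := by
      rw [abs_mul]
      calc |t| * |h a| ≤ 1 / 2 * 2 := mul_le_mul ht (h2 a) (abs_nonneg _) (by norm_num)
        _ = 1 := by norm_num
    have := (abs_le.1 (Real.abs_exp_sub_one_sub_id_le h1)).2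
    rw [mul_pow] at this
    linarith
  calc ∑ a, Real.exp (t * h a) ≤ ∑ a, (1 + t * h a + t ^ 2 * h a ^ 2) :=
        Finset.sum_le_sum fun a _ => hp a
    _ = Fintype.card A + t ^ 2 * ∑ a, h a ^ 2 := by
        simp [Finset.sum_add_distrib, ← Finset.mul_sum, h0]
    _ ≤ Fintype.card A + t ^ 2 * Fintype.card A := by gcongr
    _ = Fintype.card A * (t ^ 2 + 1) := by ring
    _ ≤ Fintype.card A * Real.exp (t ^ 2) := by gcongr; exact Real.add_one_le_exp _

/-- Chernoff's method: Markov's inequality for `exp (t * ∑ h)`, which factorizes over independent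
samples. The choice `t = η / 2` minimizes `N * t ^ 2 - t * N * η`, with value `-N * η ^ 2 / 4`. -/
theorem card_sum_ge_le {h : A → ℝ} {η : ℝ} (hη : 0 ≤ η) (hη1 : η ≤ 1) (h2 : ∀ a, |h a| ≤ 2)
    (h0 : ∑ a, h a = 0) (hsq : ∑ a, h a ^ 2 ≤ Fintype.card A) (N : ℕ) :
    (({z : Fin N → A | N * η ≤ ∑ i, h (z i)} : Set (Fin N → A)).ncard : ℝ) ≤
      Real.exp (-(N * η ^ 2 / 4)) * Fintype.card A ^ N := by
  classical
  have hM : ∑ z : Fin N → A, Real.exp (η / 2 * ∑ i, h (z i)) ≤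
      (Fintype.card A * Real.exp ((η / 2) ^ 2)) ^ N := by
    calc ∑ z : Fin N → A, Real.exp (η / 2 * ∑ i, h (z i))
        = ∑ z : Fin N → A, ∏ i, Real.exp (η / 2 * h (z i)) := by
          simp only [Finset.mul_sum, Real.exp_sum]
      _ = ∏ _i : Fin N, ∑ a, Real.exp (η / 2 * h a) := by
          rw [Finset.prod_univ_sum, Fintype.piFinset_univ]
      _ = (∑ a, Real.exp (η / 2 * h a)) ^ N := by simp
      _ ≤ _ := by
          refine pow_le_pow_left₀ (Finset.sum_nonneg fun a _ => (Real.exp_pos _).le)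
            (sum_exp_le ?_ h2 h0 hsq) N
          rw [abs_of_nonneg (by linarith)]; linarith
  rw [Set.ncard_eq_toFinset_card', Set.toFinset_ofPred]
  have hL : ((Finset.univ.filter fun z : Fin N → A => N * η ≤ ∑ i, h (z i)).card : ℝ) *
      Real.exp (η / 2 * (N * η)) ≤ ∑ z : Fin N → A, Real.exp (η / 2 * ∑ i, h (z i)) := by
    rw [← nsmul_eq_mul]
    refine le_trans (Finset.card_nsmul_le_sum _ (fun z : Fin N → A =>
      Real.exp (η / 2 * ∑ i, h (z i))) _ fun z hz => ?_) (Finset.sum_le_sum_of_subset_of_nonneg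
        (Finset.subset_univ _) fun _ _ _ => (Real.exp_pos _).le)
    rw [Finset.mem_filter] at hz
    exact Real.exp_le_exp.2 (mul_le_mul_of_nonneg_left hz.2 (by linarith))
  have hE : Real.exp (-(N * η ^ 2 / 4)) =
      Real.exp ((η / 2) ^ 2) ^ N / Real.exp (η / 2 * (N * η)) := by
    rw [← Real.exp_nat_mul, ← Real.exp_sub]
    congr 1; ring
  rw [hE, div_mul_eq_mul_div, le_div_iff₀ (Real.exp_pos _), mul_comm (_ ^ N), ← mul_pow]
  exact hL.trans hM

theorem card_abs_sum_sub_ge_le [Nonempty A] {g : A → ℝ} {η : ℝ} (hη : 0 ≤ η) (hη1 : η ≤ 1)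
    (hg : ∀ a, |g a| ≤ 1) (N : ℕ) :
    (({z : Fin N → A | N * η ≤ |∑ i, g (z i) - N * ((Fintype.card A : ℝ)⁻¹ * ∑ a, g a)|} :
      Set (Fin N → A)).ncard : ℝ) ≤
      2 * Real.exp (-(N * η ^ 2 / 4)) * Fintype.card A ^ N := by
  set b := (Fintype.card A : ℝ)⁻¹ * ∑ a, g a with hb
  have hc : (0 : ℝ) < Fintype.card A := by exact_mod_cast Fintype.card_pos
  have hS : ∑ a, g a = Fintype.card A * b := by rw [hb]; field_simp
  have hb1 : |b| ≤ 1 := by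
    rw [hb, abs_mul, abs_of_pos (inv_pos.2 hc), inv_mul_le_iff₀ hc, mul_one]
    refine (Finset.abs_sum_le_sum_abs _ _).trans ((Finset.sum_le_sum fun a _ => hg a).trans ?_)
    simp
  -- The variance is at most the second moment, hence at most `1`, although `g - b` itself may be as
  -- large as `2`.
  have hsq : ∑ a, (g a - b) ^ 2 ≤ Fintype.card A := by
    have h1 : ∑ a, (g a - b) ^ 2 = ∑ a, g a ^ 2 - Fintype.card A * b ^ 2 := by
      simp only [sub_sq, Finset.sum_add_distrib, Finset.sum_sub_distrib, ← Finset.sum_mul,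
        ← Finset.mul_sum, hS]
      simp; ring
    have h2 : ∑ a, g a ^ 2 ≤ ∑ _a : A, (1 : ℝ) :=
      Finset.sum_le_sum fun a _ => (sq_le_one_iff_abs_le_one _).2 (hg a)
    rw [h1]
    simp only [Finset.sum_const, Finset.card_univ, nsmul_eq_mul, mul_one] at h2
    nlinarith [sq_nonneg b]
  have habs : ∀ a, |g a - b| ≤ 2 := fun a => by
    have := abs_sub (g a) b; have := hg a; linarith
  have h1 := card_sum_ge_le (h := fun a => g a - b) hη hη1 habs (by simp [hS]) hsq N
  have h2 := card_sum_ge_le (h := fun a => b - g a) hη hη1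
    (fun a => by rw [abs_sub_comm]; exact habs a) (by simp [hS])
    (by simpa only [← neg_sub b, neg_sq] using hsq) N
  have hsub : ({z : Fin N → A | N * η ≤ |∑ i, g (z i) - N * b|} : Set (Fin N → A)) ⊆
      {z | N * η ≤ ∑ i, (g (z i) - b)} ∪ {z | N * η ≤ ∑ i, (b - g (z i))} := by
    intro z hz
    simp only [Set.mem_ofPred_eq, Set.mem_union, Finset.sum_sub_distrib, Finset.sum_const,
      Finset.card_univ, Fintype.card_fin, nsmul_eq_mul] at hz ⊢
    rcases le_abs.1 hz with h | h
    · exact Or.inl h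
    · right; linarith
  have h3 := (Set.ncard_le_ncard hsub (Set.toFinite _)).trans (Set.ncard_union_le _ _)
  have h4 := (Nat.cast_le (α := ℝ)).2 h3
  push_cast at h4
  linarith

end TailBound

/-! ### Sampling from a signed distribution -/

section Descend

variable {n : ℕ}

/-- The strings `x` and `y` agree in their first `k` bits. -/
def PrefixEq (k : ℕ) (x y : Bits n) : Prop := ∀ j : Fin n, (j : ℕ) < k → x j = y j

instance (k : ℕ) (x y : Bits n) : Decidable (PrefixEq k x y) :=
  inferInstanceAs (Decidable (∀ j : Fin n, (j : ℕ) < k → x j = y j))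

/-- The sum of `F` over all strings that agree with `y` in their first `k` bits. -/
def marginal {R : Type*} [AddCommMonoid R] (F : Bits n → R) (k : ℕ) (y : Bits n) : R :=
  ∑ x, if PrefixEq k x y then F x else 0

def setBit (y : Bits n) (k : ℕ) (b : Fin 2) : Bits n := fun j => if (j : ℕ) = k then b else y j

theorem prefixEq_succ_iff {k : ℕ} (hk : k < n) {x y : Bits n} {b : Fin 2} :
    PrefixEq (k + 1) x (setBit y k b) ↔ PrefixEq k x y ∧ x ⟨k, hk⟩ = b := by
  constructor
  · intro h
    refine ⟨fun j hj => ?_, ?_⟩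
    · have := h j (by omega); rwa [setBit, if_neg hj.ne] at this
    · have := h ⟨k, hk⟩ (by simp); simpa [setBit] using this
  · rintro ⟨h, hb⟩ j hj
    by_cases hjk : (j : ℕ) = k
    · rw [setBit, if_pos hjk, ← hb]; congr 1; exact Fin.ext hjk
    · rw [setBit, if_neg hjk]; exact h j (by omega)

theorem marginal_step {R : Type*} [AddCommMonoid R] (F : Bits n → R) {k : ℕ} (hk : k < n)
    (y : Bits n) :
    marginal F k y = marginal F (k + 1) (setBit y k 0) + marginal F (k + 1) (setBit y k 1) := by
  simp only [marginal, ← Finset.sum_add_distrib, prefixEq_succ_iff hk]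
  refine Finset.sum_congr rfl fun x _ => ?_
  have : ∀ b : Fin 2, b = 0 ∨ b = 1 := by decide
  by_cases h : PrefixEq k x y <;> rcases this (x ⟨k, hk⟩) with h' | h' <;> simp [h, h']

theorem prefixEq_full {x y : Bits n} : PrefixEq n x y ↔ x = y :=
  ⟨fun h => funext fun j => h j j.2, fun h _ _ => h ▸ rfl⟩

theorem marginal_full {R : Type*} [AddCommMonoid R] (F : Bits n → R) (y : Bits n) :
    marginal F n y = F y := by
  simp [marginal, prefixEq_full]

theorem marginal_zero {R : Type*} [AddCommMonoid R] (F : Bits n → R) (y : Bits n) :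
    marginal F 0 y = ∑ x, F x := by
  simp [marginal, PrefixEq]

theorem marginal_congr {R : Type*} [AddCommMonoid R] {F G : Bits n → R} {k : ℕ} {y : Bits n}
    (h : ∀ x, PrefixEq k x y → F x = G x) : marginal F k y = marginal G k y :=
  Finset.sum_congr rfl fun x _ => by split <;> simp_all

/-- The part of a mass `M` that goes to the strings whose next bit is `0`. -/
def massZero (F : Bits n → ℤ) (k : ℕ) (y : Bits n) (M : ℕ) : ℕ :=
  min (marginal F (k + 1) (setBit y k 0)).toNat M

/-- Choose the bits `k, k + 1, …` of a string one by one: of the `M` possible values of `u`,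
those below the marginal of `F` (as far as possible) go to the strings with next bit `0`. -/
def descend (F : Bits n → ℤ) : ℕ → ℕ → Bits n → ℕ → ℕ → Bits n
  | 0, _, y, _, _ => y
  | j + 1, k, y, M, u =>
      if u < massZero F k y M then descend F j (k + 1) (setBit y k 0) (massZero F k y M) u
      else descend F j (k + 1) (setBit y k 1) (M - massZero F k y M) (u - massZero F k y M)

theorem prefixEq_descend (F : Bits n → ℤ) (j : ℕ) : ∀ (k : ℕ) (y : Bits n) (M u : ℕ),
    PrefixEq k (descend F j k y M u) y := by
  induction j with
  | zero => exact fun k y M u i _ => rfl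
  | succ j ih =>
      intro k y M u i hi
      have h : ∀ b, setBit y k b i = y i := fun b => by rw [setBit, if_neg hi.ne]
      unfold descend
      split
      · rw [ih _ _ _ _ i (by omega), h]
      · rw [ih _ _ _ _ i (by omega), h]

/-- The number of values of `u` that lead to the string `x`. -/
def descendCount (F : Bits n → ℤ) (j k : ℕ) (y : Bits n) (M : ℕ) (x : Bits n) : ℕ :=
  ((Finset.range M).filter fun u => descend F j k y M u = x).card

/-- Values of `u` below `massZero` go to the strings with next bit `0`; the others, shifted down by
`massZero`, go to those with next bit `1`. Neither branch reaches a string of the other. -/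
theorem descendCount_succ (F : Bits n → ℤ) (j : ℕ) {k : ℕ} (hk : k < n) (y : Bits n) (M : ℕ)
    (x : Bits n) : descendCount F (j + 1) k y M x =
      if x ⟨k, hk⟩ = 0 then descendCount F j (k + 1) (setBit y k 0) (massZero F k y M) x
      else descendCount F j (k + 1) (setBit y k 1) (M - massZero F k y M) x := by
  set a := massZero F k y M with ha
  have haM : a ≤ M := min_le_right _ _
  have hbit : ∀ b M u, descend F j (k + 1) (setBit y k b) M u ⟨k, hk⟩ = b := fun b M u =>
    ((prefixEq_succ_iff hk).1 (prefixEq_descend F j (k + 1) (setBit y k b) M u)).2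
  unfold descendCount
  split
  · rename_i hx
    congr 1
    ext u
    simp only [Finset.mem_filter, Finset.mem_range, descend, ← ha]
    constructor
    · rintro ⟨_, h⟩
      by_cases hu : u < a
      · rw [if_pos hu] at h; exact ⟨hu, h⟩
      · rw [if_neg hu] at h
        rw [← h, hbit] at hx
        exact absurd hx (by decide)
    · rintro ⟨hu, h⟩
      rw [if_pos hu]; exact ⟨by omega, h⟩
  · rename_i hx
    refine Finset.card_bij' (fun u _ => u - a) (fun u _ => u + a) ?_ ?_ ?_ ?_
    · intro u hu
      simp only [Finset.mem_filter, Finset.mem_range, descend, ← ha] at hu ⊢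
      by_cases hua : u < a
      · rw [if_pos hua] at hu
        rw [← hu.2, hbit] at hx
        exact absurd rfl hx
      · rw [if_neg hua] at hu; exact ⟨by omega, hu.2⟩
    · intro u hu
      simp only [Finset.mem_filter, Finset.mem_range, descend, ← ha] at hu ⊢
      rw [if_neg (by omega), Nat.add_sub_cancel]
      exact ⟨by omega, hu.2⟩
    · intro u hu
      simp only [Finset.mem_filter, Finset.mem_range, descend, ← ha] at hu
      by_cases hua : u < a
      · rw [if_pos hua] at hu
        rw [← hu.2, hbit] at hx
        exact absurd rfl hx
      · omega
    · intro u _; simp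

/-- A node of the binary tree of prefixes has the marginal `f₀ + f₁` and has received the mass `M`,
which it splits between its children. The potential `|mass - marginal| - |marginal|`, summed over
the children, is at most that of the node, so cut-off errors do not pile up with the depth. -/
theorem abs_split_le (M : ℕ) (f₀ f₁ : ℤ) :
    |((min f₀.toNat M : ℕ) : ℤ) - f₀| + |((M - min f₀.toNat M : ℕ) : ℤ) - f₁| - |f₀| - |f₁| ≤
      |(M : ℤ) - (f₀ + f₁)| - |f₀ + f₁| := by
  have h := min_le_right f₀.toNat M
  push_cast [h]
  rw [Int.toNat_eq_max]
  rcases abs_cases f₀ with h1 | h1 <;> rcases abs_cases f₁ with h2 | h2 <;>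
    rcases abs_cases (f₀ + f₁) with h3 | h3 <;>
    rcases abs_cases ((M : ℤ) - (f₀ + f₁)) with h4 | h4 <;>
    rw [h1.1, h2.1, h3.1, h4.1] <;>
    rcases abs_cases (min (max f₀ 0) (M : ℤ) - f₀) with h5 | h5 <;>
    rcases abs_cases ((M : ℤ) - min (max f₀ 0) (M : ℤ) - f₁) with h6 | h6 <;>
    rw [h5.1, h6.1] <;> omega

/-- Sums the potential of `abs_split_le` over the tree; at a leaf the count is the mass that arrived
there. At the root, with `M` the total of `F`, the `l₁` error is at most `∑ |F| - ∑ F`, twice the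
negative part of `F`. -/
theorem marginal_abs_descendCount_sub_le (F : Bits n → ℤ) (j : ℕ) : ∀ (k : ℕ) (y : Bits n) (M : ℕ),
    k + j = n → marginal (fun x => |(descendCount F j k y M x : ℤ) - F x|) k y + |marginal F k y| ≤
      |(M : ℤ) - marginal F k y| + marginal (fun x => |F x|) k y := by
  induction j with
  | zero =>
      intro k y M hk
      obtain rfl : k = n := by simpa using hk
      simp [marginal_full, descendCount, descend]
  | succ j ih =>
      intro k y M hkj
      have hk : k < n := by omega
      have h0 := ih (k + 1) (setBit y k 0) (massZero F k y M) (by omega)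
      have h1 := ih (k + 1) (setBit y k 1) (M - massZero F k y M) (by omega)
      have e0 : marginal (fun x => |(descendCount F (j + 1) k y M x : ℤ) - F x|) (k + 1)
          (setBit y k 0) = marginal (fun x => |(descendCount F j (k + 1) (setBit y k 0)
            (massZero F k y M) x : ℤ) - F x|) (k + 1) (setBit y k 0) :=
        marginal_congr fun x hx => by
          rw [descendCount_succ F j hk, if_pos ((prefixEq_succ_iff hk).1 hx).2]
      have e1 : marginal (fun x => |(descendCount F (j + 1) k y M x : ℤ) - F x|) (k + 1)
          (setBit y k 1) = marginal (fun x => |(descendCount F j (k + 1) (setBit y k 1)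
            (M - massZero F k y M) x : ℤ) - F x|) (k + 1) (setBit y k 1) :=
        marginal_congr fun x hx => by
          rw [descendCount_succ F j hk, if_neg]
          rw [((prefixEq_succ_iff hk).1 hx).2]; decide
      have hs := abs_split_le M (marginal F (k + 1) (setBit y k 0))
        (marginal F (k + 1) (setBit y k 1))
      rw [marginal_step _ hk, e0, e1, marginal_step F hk, marginal_step (fun x => |F x|) hk]
      change |((massZero F k y M : ℕ) : ℤ) - _| + |((M - massZero F k y M : ℕ) : ℤ) - _| - _ - _ ≤ _
        at hs
      linarith

/-- The sampled distribution is close to every distribution that is close to `F / M`. -/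
theorem sum_abs_descendCount_le (F : Bits n → ℤ) (M : ℕ) (hM : ∑ x, F x = M) (hM0 : 0 < M)
    {p : Bits n → ℝ} (hp : ∀ x, 0 ≤ p x) :
    ∑ x, |p x - (descendCount F n 0 0 M x : ℝ) / M| ≤ 3 * ∑ x, |p x - (F x : ℝ) / M| := by
  have h := marginal_abs_descendCount_sub_le F n 0 0 M (zero_add n)
  simp only [marginal_zero, hM, sub_self, abs_zero, zero_add, Nat.abs_cast] at h
  have h' : ∑ x, |(descendCount F n 0 0 M x : ℝ) - F x| + M ≤ ∑ x, |(F x : ℝ)| := by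
    exact_mod_cast h
  have hM' : (M : ℝ) = ∑ x, (F x : ℝ) := by exact_mod_cast hM.symm
  have hMp : (0 : ℝ) < M := by exact_mod_cast hM0
  have h1 : ∑ x, |(F x : ℝ) / M - (descendCount F n 0 0 M x : ℝ) / M| ≤
      ∑ x, (|(F x : ℝ) / M| - (F x : ℝ) / M) := by
    simp only [← sub_div, abs_div, abs_of_pos hMp, ← Finset.sum_div, Finset.sum_sub_distrib,
      abs_sub_comm (F _ : ℝ)]
    gcongr
    linarith
  -- As `p x ≥ 0`, the distance from `p x` to `F x / M` is at least the negative part of the latter.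
  -- This accounts for the `2` in `3 = 1 + 2`.
  have h2 : ∀ x, |(F x : ℝ) / M| - (F x : ℝ) / M ≤ 2 * |p x - (F x : ℝ) / M| := fun x => by
    have := hp x
    rcases abs_cases ((F x : ℝ) / M) with h | h <;>
      rcases abs_cases (p x - (F x : ℝ) / M) with h' | h' <;> linarith
  calc ∑ x, |p x - (descendCount F n 0 0 M x : ℝ) / M|
      ≤ ∑ x, (|p x - (F x : ℝ) / M| + |(F x : ℝ) / M - (descendCount F n 0 0 M x : ℝ) / M|) :=
        Finset.sum_le_sum fun x _ => abs_sub_le _ _ _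
    _ ≤ ∑ x, |p x - (F x : ℝ) / M| + ∑ x, 2 * |p x - (F x : ℝ) / M| := by
        rw [Finset.sum_add_distrib]
        refine add_le_add le_rfl ?_
        exact h1.trans (Finset.sum_le_sum fun x _ => h2 x)
    _ = 3 * ∑ x, |p x - (F x : ℝ) / M| := by rw [← Finset.mul_sum]; ring

end Descend

/-! ### Strings of small weight -/

section Weight

variable {n : ℕ}

/-- The number of ones. -/
def weight (s : Bits n) : ℕ := ∑ j, (s j : ℕ)

/-- The product of the numbers `w j` over the positions `j` of the ones. -/
def bitWeight {R : Type*} [CommMonoid R] (w : Fin n → R) (s : Bits n) : R :=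
  ∏ j, if s j = 1 then w j else 1

theorem setBit_zero_eq {s : Bits n} {k : ℕ} (h : ∀ j : Fin n, (j : ℕ) = k → s j = 0) :
    setBit s k 0 = s := by
  ext j
  unfold setBit
  split
  · rename_i hj; rw [h j hj]
  · rfl

theorem prod_setBit {R : Type*} [CommMonoid R] (f : Fin n → Fin 2 → R) {s : Bits n} (j : Fin n)
    (h1 : f j (s j) = 1) (b : Fin 2) :
    ∏ i, f i (setBit s j b i) = f j b * ∏ i, f i (s i) := by
  rw [← Finset.mul_prod_erase _ _ (Finset.mem_univ j),
    ← Finset.mul_prod_erase (s := Finset.univ) (fun i => f i (s i)) (Finset.mem_univ j), h1, one_mul]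
  congr 1
  · simp [setBit]
  · refine Finset.prod_congr rfl fun i hi => ?_
    rw [setBit, if_neg fun h => (Finset.mem_erase.1 hi).1 (Fin.ext h)]

theorem bitWeight_setBit {R : Type*} [CommMonoid R] (w : Fin n → R) {s : Bits n} (j : Fin n)
    (hj : s j = 0) : bitWeight w (setBit s j 1) = w j * bitWeight w s := by
  unfold bitWeight
  rw [prod_setBit (fun i b => if b = 1 then w i else 1) j (by simp [hj]) 1, if_pos rfl]

theorem weight_setBit {s : Bits n} (j : Fin n) (hj : s j = 0) :
    weight (setBit s j 1) = weight s + 1 := by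
  unfold weight
  rw [← Finset.add_sum_erase _ _ (Finset.mem_univ j),
    ← Finset.add_sum_erase (s := Finset.univ) (fun i => ((s i : Fin 2) : ℕ)) (Finset.mem_univ j), hj]
  have : ∑ x ∈ Finset.univ.erase j, ((setBit s j 1 x : Fin 2) : ℕ) =
      ∑ x ∈ Finset.univ.erase j, ((s x : Fin 2) : ℕ) :=
    Finset.sum_congr rfl fun i hi => by
      rw [setBit, if_neg fun h => (Finset.mem_erase.1 hi).1 (Fin.ext h)]
  rw [this]
  simp [setBit]; ring

theorem bitsSign_eq_bitWeight (y s : Bits n) :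
    bitsSign y s = bitWeight (fun j => 1 - 2 * ((y j : ℕ) : ℤ)) s := by
  have : ∀ a b : Fin 2, bitSign a b = if b = 1 then 1 - 2 * ((a : ℕ) : ℤ) else 1 := by decide
  exact Finset.prod_congr rfl fun j _ => this _ _

/-- The sum of `g` over the strings that arise from `s` by putting at most `d` ones into the
positions from `a` to `k - 1`. -/
def enumSum (g : Bits n → ℤ) (k : ℕ) : ℕ → ℕ → Bits n → ℤ
  | 0, _, s => g s
  | d + 1, a, s =>
      g s + ∑ j ∈ Finset.range k, if a ≤ j then enumSum g k d (j + 1) (setBit s j 1) else 0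

theorem enumSum_of_le (g : Bits n → ℤ) {k a : ℕ} (h : k ≤ a) (d : ℕ) (s : Bits n) :
    enumSum g k d a s = g s := by
  cases d with
  | zero => rfl
  | succ d =>
      rw [enumSum, Finset.sum_eq_zero, add_zero]
      intro j hj
      rw [Finset.mem_range] at hj
      rw [if_neg (by omega)]

/-- Either position `a` stays zero, or it is the first to receive a one. This turns the sum over the
first chosen position into a two-way recursion that matches `marginal_step`. -/
theorem enumSum_succ_of_lt (g : Bits n → ℤ) {k a : ℕ} (h : a < k) (d : ℕ) (s : Bits n) :
    enumSum g k (d + 1) a s =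
      enumSum g k (d + 1) (a + 1) s + enumSum g k d (a + 1) (setBit s a 1) := by
  have h1 : ∀ j ∈ Finset.range k, (if a ≤ j then enumSum g k d (j + 1) (setBit s j 1) else 0) =
      (if a + 1 ≤ j then enumSum g k d (j + 1) (setBit s j 1) else 0) +
        if j = a then enumSum g k d (a + 1) (setBit s a 1) else 0 := by
    intro j _
    rcases lt_trichotomy j a with hj | rfl | hj
    · simp [show ¬ a ≤ j by omega, show ¬ a + 1 ≤ j by omega, hj.ne]
    · simp
    · simp [hj.le, show a + 1 ≤ j from hj, hj.ne']
  rw [enumSum, enumSum, Finset.sum_congr rfl h1, Finset.sum_add_distrib, Finset.sum_ite_eq',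
    if_pos (Finset.mem_range.2 h), add_assoc]

theorem weight_le_of_prefixEq {s t : Bits n} {a : ℕ} (hs : ∀ j : Fin n, a ≤ j → s j = 0)
    (h : PrefixEq a t s) : weight s ≤ weight t := by
  refine Finset.sum_le_sum fun j _ => ?_
  by_cases hj : (j : ℕ) < a
  · rw [h j hj]
  · rw [hs j (by omega)]; exact Nat.zero_le _

/-- Ones are placed at increasing positions, so every string of small weight arises exactly once.
The induction moves `a` up to `k`; the prefix condition in `marginal` says that the positions below
`a` are settled. -/
theorem enumSum_eq_marginal (g : Bits n → ℤ) {k : ℕ} (hk : k ≤ n) (m : ℕ) : ∀ (a : ℕ), a + m = k →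
    ∀ (d : ℕ) (s : Bits n), (∀ j : Fin n, a ≤ j → s j = 0) → enumSum g k d a s =
      marginal (fun t => if (∀ j : Fin n, k ≤ j → t j = 0) ∧ weight t ≤ weight s + d
        then g t else 0) a s := by
  induction m with
  | zero =>
      rintro a rfl d s hs
      rw [enumSum_of_le g (by omega), marginal, Finset.sum_eq_single s]
      · have hself : PrefixEq a s s := fun _ _ => rfl
        rw [if_pos hself]
        exact (if_pos ⟨hs, Nat.le_add_right _ _⟩).symm
      · intro t _ hts
        by_cases h1 : PrefixEq a t s
        · rw [if_pos h1, if_neg]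
          rintro ⟨h2, -⟩
          refine hts (funext fun j => ?_)
          by_cases hj : (j : ℕ) < a
          · exact h1 j hj
          · rw [h2 j (by omega), hs j (by omega)]
        · rw [if_neg h1]
      · simp
  | succ m ih =>
      intro a ha d s hs
      have han : a < n := by omega
      have hs0 : s ⟨a, han⟩ = 0 := hs _ le_rfl
      have hset : setBit s a 0 = s := setBit_zero_eq fun j hj => hs j hj.ge
      have hs1 : ∀ j : Fin n, a + 1 ≤ j → setBit s a 1 j = 0 := fun j hj => by
        rw [setBit, if_neg (by omega)]; exact hs j (by omega)
      have hw : weight (setBit s a 1) = weight s + 1 := weight_setBit ⟨a, han⟩ hs0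
      rw [marginal_step _ han, hset]
      cases d with
      | zero =>
          have h0 := ih (a + 1) (by omega) 0 s fun j hj => hs j (by omega)
          rw [show enumSum g k 0 a s = enumSum g k 0 (a + 1) s from rfl, h0, left_eq_add]
          refine Finset.sum_eq_zero fun t _ => ?_
          split
          · rename_i h
            have := weight_le_of_prefixEq hs1 h
            refine if_neg ?_
            rintro ⟨-, h'⟩; omega
          · rfl
      | succ d =>
          rw [enumSum_succ_of_lt g (by omega), ih (a + 1) (by omega) (d + 1) s
            fun j hj => hs j (by omega), ih (a + 1) (by omega) d _ hs1, hw]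
          simp only [add_assoc, add_comm 1 d]

theorem enumSum_eq (g : Bits n → ℤ) {k : ℕ} (hk : k ≤ n) (d : ℕ) : enumSum g k d 0 0 =
    ∑ s : Bits n, if (∀ j : Fin n, k ≤ j → s j = 0) ∧ weight s ≤ d then g s else 0 := by
  rw [enumSum_eq_marginal g hk k 0 (zero_add k) d 0 (fun _ _ => rfl), marginal_zero]
  have h0 : weight (0 : Bits n) = 0 := by simp [weight]
  simp only [h0, zero_add]

theorem enumSum_one_le (k d : ℕ) : ∀ (a : ℕ) (s : Bits n),
    enumSum (fun _ => 1) k d a s ≤ ((k : ℤ) + 1) ^ d := by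
  induction d with
  | zero => intro a s; simp [enumSum]
  | succ d ih =>
      intro a s
      have h1 : ∑ j ∈ Finset.range k,
          (if a ≤ j then enumSum (fun _ => 1) k d (j + 1) (setBit s j 1) else 0) ≤
          ∑ _j ∈ Finset.range k, ((k : ℤ) + 1) ^ d :=
        Finset.sum_le_sum fun j _ => by split; exacts [ih _ _, by positivity]
      have h2 : (1 : ℤ) ≤ ((k : ℤ) + 1) ^ d := one_le_pow₀ (by omega)
      rw [Finset.sum_const, Finset.card_range, nsmul_eq_mul] at h1
      rw [enumSum, pow_succ]
      linarith

/-- `enumSum` of the constant `1` counts these strings; at each of its `d` levels there are at most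
`n` choices and the option to stop. -/
theorem card_weight_le (n d : ℕ) :
    (Finset.univ.filter fun s : Bits n => weight s ≤ d).card ≤ (n + 1) ^ d := by
  have h := enumSum_one_le n d 0 (0 : Bits n)
  rw [enumSum_eq _ le_rfl] at h
  have h0 : ∀ s : Bits n, (∀ j : Fin n, n ≤ j → s j = 0) := fun s j hj => absurd j.2 (by omega)
  rw [Finset.sum_boole, Finset.filter_congr fun s _ => and_iff_right (h0 s)] at h
  exact_mod_cast h

/-! ### Marginals of truncated Fourier sums -/

/-- A function on bit strings with given Fourier coefficients at the strings of weight at most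
`d`. -/
def fourierSum (c : Bits n → ℤ) (d : ℕ) (x : Bits n) : ℤ :=
  ∑ s, if weight s ≤ d then c s * bitsSign x s else 0

/-- A free bit `j` contributes a factor `2` if `s j = 0` and `0` otherwise, so only the characters
supported on the first `k` positions survive. -/
theorem marginal_bitsSign {k : ℕ} (hk : k ≤ n) (y s : Bits n) :
    marginal (fun x => bitsSign x s) k y =
      if ∀ j : Fin n, k ≤ j → s j = 0 then 2 ^ (n - k) * bitsSign y s else 0 := by
  let f : Fin n → Fin 2 → ℤ := fun j b =>
    if (j : ℕ) < k then (if b = y j then bitSign b (s j) else 0) else bitSign b (s j)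
  have h1 : marginal (fun x => bitsSign x s) k y = ∏ j, ∑ b, f j b := by
    rw [prod_sum_bits]
    refine Finset.sum_congr rfl fun x _ => ?_
    split
    · rename_i h
      refine Finset.prod_congr rfl fun j _ => ?_
      by_cases hj : (j : ℕ) < k
      · simp [f, hj, h j hj]
      · simp [f, hj]
    · rename_i h
      unfold PrefixEq at h
      push Not at h
      obtain ⟨j, hj, hne⟩ := h
      rw [Finset.prod_eq_zero (Finset.mem_univ j)]
      simp [f, hj, hne]
  have h2 : ∀ j, ∑ b, f j b = (if (j : ℕ) < k then bitSign (y j) (s j) else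
      if s j = 0 then 2 * bitSign (y j) (s j) else 0) := by
    intro j
    by_cases hj : (j : ℕ) < k
    · simp [f, hj]
    · have : ∀ a b : Fin 2, ∑ c, bitSign c b = if b = 0 then 2 * bitSign a b else 0 := by decide
      simp [f, hj, this (y j)]
  rw [h1]
  simp only [h2]
  split
  · rename_i h
    have h3 : ∀ j : Fin n, (if (j : ℕ) < k then bitSign (y j) (s j) else
        if s j = 0 then 2 * bitSign (y j) (s j) else 0) =
        (if (j : ℕ) < k then 1 else 2) * bitSign (y j) (s j) := by
      intro j
      by_cases hj : (j : ℕ) < k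
      · simp [hj]
      · simp [hj, h j (by omega)]
    simp only [h3, Finset.prod_mul_distrib, bitsSign]
    congr 1
    rw [Finset.prod_ite, Finset.prod_const_one, one_mul, Finset.prod_const]
    congr 1
    have h4 : (Finset.univ.filter fun j : Fin n => ¬ (j : ℕ) < k).card =
        n - (Finset.univ.filter fun j : Fin n => (j : ℕ) < k).card := by
      rw [Finset.filter_not, Finset.card_sdiff_of_subset (Finset.subset_univ _)]; simp
    rw [h4]
    congr 1
    rw [Fin.card_filter_val_lt]
    omega
  · rename_i h
    push Not at h
    obtain ⟨j, hj, hne⟩ := h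
    exact Finset.prod_eq_zero (Finset.mem_univ j) (by simp [show ¬ (j : ℕ) < k by omega, hne])

/-- For fixed `d` this replaces a sum over exponentially many strings by one with polynomially many
terms, which is what makes the sampling efficient. -/
theorem marginal_fourierSum (c : Bits n → ℤ) (d : ℕ) {k : ℕ} (hk : k ≤ n) (y : Bits n) :
    marginal (fourierSum c d) k y =
      2 ^ (n - k) * enumSum (fun s => c s * bitsSign y s) k d 0 0 := by
  rw [enumSum_eq _ hk, Finset.mul_sum]
  have h : marginal (fourierSum c d) k y =
      ∑ s, if weight s ≤ d then c s * marginal (fun x => bitsSign x s) k y else 0 := by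
    simp only [marginal, fourierSum, ← Finset.sum_filter, Finset.mul_sum]
    exact Finset.sum_comm
  rw [h]
  refine Finset.sum_congr rfl fun s _ => ?_
  rw [marginal_bitsSign hk]
  by_cases h1 : weight s ≤ d <;> by_cases h2 : ∀ j : Fin n, k ≤ j → s j = 0
  · rw [if_pos h1, if_pos h2, if_pos ⟨h2, h1⟩]; ring
  · rw [if_pos h1, if_neg h2, if_neg fun h => h2 h.1]; ring
  · rw [if_neg h1, if_neg fun h => h1 h.2]; ring
  · rw [if_neg h1, if_neg fun h => h1 h.2]; ring

/-- Only the trivial character has a nonzero total. The total mass is thus free of estimation errors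
once `c 0` is known exactly. -/
theorem sum_fourierSum (c : Bits n → ℤ) (d : ℕ) : ∑ x, fourierSum c d x = 2 ^ n * c 0 := by
  rw [← marginal_zero _ 0, marginal_fourierSum c d (Nat.zero_le n), enumSum_of_le _ le_rfl,
    bitsSign_comm, bitsSign_zero_left, Nat.sub_zero, mul_one]

end Weight

/-! ### Approximation of the noisy distribution -/

namespace IQPCircuit

variable {n : ℕ}

/-- The error of a coefficient has a part relative to the true coefficient (`η₁`: truncation and
inexact rates) and an absolute part at low weights (`η₂`: sampling and rounding). The squares of the
first sum to at most `η₁ ^ 2 * α` by Parseval, those of the second to `η₂ ^ 2` times the number of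
strings of low weight. With `(a + b) ^ 2 ≤ 2 * a ^ 2 + 2 * b ^ 2` the total is at most `4 * (δ / 6)
^ 2 = (δ / 3) ^ 2`. -/
theorem sum_abs_noisyDist_sub_le (C : IQPCircuit n) (ε : Fin n → ℝ) (c : Bits n → ℤ) (d V : ℕ)
    {α δ η₁ η₂ : ℝ} (hα : ∑ x, C.outputDist x ^ 2 ≤ α / 2 ^ n) (hδ : 0 ≤ δ)
    (h : ∀ s, |bitWeight (fun j => 1 - ε j) s * C.coeff s - if weight s ≤ d then (c s : ℝ) / V else 0|
      ≤ η₁ * |C.coeff s| + if weight s ≤ d then η₂ else 0)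
    (h₁ : η₁ ^ 2 * α ≤ (δ / 6) ^ 2) (h₂ : η₂ ^ 2 * (n + 1) ^ d ≤ (δ / 6) ^ 2) :
    ∑ x, |C.noisyDist ε x - (fourierSum c d x : ℝ) / (2 ^ n * V)| ≤ δ / 3 := by
  set e : Bits n → ℝ := fun s =>
    bitWeight (fun j => 1 - ε j) s * C.coeff s - if weight s ≤ d then (c s : ℝ) / V else 0 with he
  have hx : ∀ x, C.noisyDist ε x - (fourierSum c d x : ℝ) / (2 ^ n * V) =
      (2 ^ n)⁻¹ * ∑ s, e s * bitsSign x s := by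
    intro x
    have : (fourierSum c d x : ℝ) / (2 ^ n * V) =
        (2 ^ n)⁻¹ * ∑ s, (if weight s ≤ d then (c s : ℝ) / V else 0) * bitsSign x s := by
      unfold fourierSum
      push_cast
      rw [div_eq_inv_mul, mul_inv, mul_assoc, Finset.mul_sum (a := (V : ℝ)⁻¹)]
      congr 1
      refine Finset.sum_congr rfl fun s _ => ?_
      split
      · ring
      · ring
    rw [this, noisyDist_eq, ← mul_sub, ← Finset.sum_sub_distrib]
    simp only [he, sub_mul]
    rfl
  simp only [hx]
  refine sum_abs_fourier_le e (by positivity) ?_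
  have hb : ∑ s, C.coeff s ^ 2 ≤ α := by
    rw [sum_sq_coeff]
    calc 2 ^ n * ∑ x, C.outputDist x ^ 2 ≤ 2 ^ n * (α / 2 ^ n) := by gcongr
      _ = α := by field_simp
  have hcard : ((Finset.univ.filter fun s : Bits n => weight s ≤ d).card : ℝ) ≤ (n + 1) ^ d := by
    exact_mod_cast card_weight_le n d
  calc ∑ s, e s ^ 2
      ≤ ∑ s, (2 * (η₁ ^ 2 * C.coeff s ^ 2) + 2 * if weight s ≤ d then η₂ ^ 2 else 0) := by
        refine Finset.sum_le_sum fun s _ => ?_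
        have h3 : e s ^ 2 ≤ (η₁ * |C.coeff s| + if weight s ≤ d then η₂ else 0) ^ 2 := by
          rw [← sq_abs (e s)]
          exact pow_le_pow_left₀ (abs_nonneg _) (h s) 2
        refine h3.trans (add_sq_le.trans (le_of_eq ?_))
        rw [mul_pow, sq_abs, mul_add]
        congr 2
        split <;> ring
    _ = 2 * (η₁ ^ 2 * ∑ s, C.coeff s ^ 2) +
        2 * (η₂ ^ 2 * (Finset.univ.filter fun s : Bits n => weight s ≤ d).card) := by
        rw [Finset.sum_add_distrib, ← Finset.mul_sum, ← Finset.mul_sum, ← Finset.mul_sum]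
        congr 2
        rw [← Finset.sum_filter, Finset.sum_const, nsmul_eq_mul, mul_comm]
    _ ≤ 2 * (η₁ ^ 2 * α) + 2 * (η₂ ^ 2 * (n + 1) ^ d) := by gcongr
    _ ≤ (δ / 3) ^ 2 := by nlinarith

end IQPCircuit

/-- One more factor turns an accumulated error `E` into at most `(1 - μ) * E + Δ`, which has the
fixed point `Δ / μ`. The errors form a geometric series, so the bound depends neither on the number
of qubits nor on the weight of `s`; constant relative accuracy of the rates is enough. -/
theorem bitWeight_sub_le {n : ℕ} {a b : Fin n → ℝ} {Δ μ : ℝ} (hμ : 0 < μ) (hΔ : 0 ≤ Δ)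
    (ha : ∀ j, 0 ≤ a j) (hab : ∀ j, a j ≤ b j) (hb : ∀ j, b j ≤ 1 - μ)
    (hd : ∀ j, b j - a j ≤ Δ) (s : Bits n) :
    0 ≤ bitWeight b s - bitWeight a s ∧ bitWeight b s - bitWeight a s ≤ Δ / μ := by
  have key : ∀ t : Finset (Fin n),
      0 ≤ ∏ j ∈ t, a j ∧ ∏ j ∈ t, a j ≤ 1 ∧ 0 ≤ ∏ j ∈ t, b j - ∏ j ∈ t, a j ∧
        ∏ j ∈ t, b j - ∏ j ∈ t, a j ≤ Δ / μ := by
    intro t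
    induction t using Finset.induction_on with
    | empty => simp; positivity
    | insert j t hj ih =>
        obtain ⟨h1, h2, h3, h4⟩ := ih
        simp only [Finset.prod_insert hj]
        have e1 := ha j
        have e2 := hab j
        have e3 := hb j
        have e4 := hd j
        set A := ∏ j ∈ t, a j
        set B := ∏ j ∈ t, b j
        have e5 : b j * B - a j * A = b j * (B - A) + (b j - a j) * A := by ring
        refine ⟨mul_nonneg e1 h1, ?_, ?_, ?_⟩
        · exact mul_le_one₀ (by linarith) h1 h2
        · rw [e5]
          exact add_nonneg (mul_nonneg (e1.trans e2) h3) (mul_nonneg (sub_nonneg.2 e2) h1)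
        · rw [e5]
          calc b j * (B - A) + (b j - a j) * A ≤ (1 - μ) * (Δ / μ) + Δ * 1 := by
                refine add_le_add (mul_le_mul e3 h4 h3 (by linarith)) (mul_le_mul e4 h2 h1 hΔ)
            _ = Δ / μ := by field_simp; ring
  have h := key (Finset.univ.filter fun j => s j = 1)
  simpa only [bitWeight, ← Finset.prod_filter] using h.2.2

theorem abs_bitWeight_le_pow {n : ℕ} {a : Fin n → ℝ} {r : ℝ} (ha : ∀ j, 0 ≤ a j)
    (hr : ∀ j, a j ≤ r) (s : Bits n) : 0 ≤ bitWeight a s ∧ bitWeight a s ≤ r ^ weight s := by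
  have hw : weight s = (Finset.univ.filter fun j => s j = 1).card := by
    have : ∀ b : Fin 2, (b : ℕ) = if b = 1 then 1 else 0 := by decide
    rw [Finset.card_filter]
    exact Finset.sum_congr rfl fun j _ => this _
  rw [bitWeight, ← Finset.prod_filter, hw]
  exact ⟨Finset.prod_nonneg fun j _ => ha j,
    (Finset.prod_le_prod (fun j _ => ha j) fun j _ => hr j).trans_eq (Finset.prod_const r)⟩

/-! ### Estimates of the Fourier coefficients -/

/-- The parameters of the simulation: only Fourier coefficients of degree at most `deg` are used;
they are rounded to about `bits + deg * n` bits, the number of random samples for their estimation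
is `reps * (n + 1) ^ (2 * deg + 1)`, and `num / den` replaces `1 - ε` for the qubits with the
smallest rate. -/
structure SimParams : Type where
  deg : ℕ
  bits : ℕ
  reps : ℕ
  num : ℤ
  den : ℤ

namespace SimParams

variable (P : SimParams)

def samples (n : ℕ) : ℕ := P.reps * (n + 1) ^ (2 * P.deg + 1)

def scale (n : ℕ) : ℕ := 2 ^ P.bits * (2 ^ n) ^ P.deg

/-- The number of coins for drawing a string. -/
def coins (n : ℕ) : ℕ := n * (P.deg + 1) + P.bits

/-- The number of coin outcomes is exactly the total mass of the integer function to be sampled, so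
no rejection step is needed. -/
theorem two_pow_coins (n : ℕ) : 2 ^ P.coins n = 2 ^ n * P.scale n := by
  rw [coins, scale, ← pow_mul, pow_add, mul_add, mul_one, pow_add]; ring

/-- Numerator of the substitute for `1 - ε_j`, with `rateDen` as denominator: `none` marks a qubit
with the smallest rate, and `1 - q = (den - num) / den`. -/
def rateNum : Option ℚ → ℤ
  | none => P.num
  | some q => q.den - q.num

def rateDen : Option ℚ → ℤ
  | none => P.den
  | some q => q.den

end SimParams

/-- The sum of the signs `(-1)^(f(z) + f(z + s))` over the sampled strings `z`. -/
def IQPCircuit.tally {n N : ℕ} (C : IQPCircuit n) (z : Fin N → Bits n) (s : Bits n) : ℤ :=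
  ∑ i, C.diagSign (z i) * C.diagSign (z i + s)

/-- The rounded estimate of a Fourier coefficient of the noisy distribution. -/
def SimParams.coefInt {n N : ℕ} (P : SimParams) (C : IQPCircuit n) (κ : Fin n → Option ℚ)
    (z : Fin N → Bits n) (s : Bits n) : ℤ :=
  (C.tally z s * bitWeight (fun j => P.rateNum (κ j)) s * P.scale n) /
    (N * bitWeight (fun j => P.rateDen (κ j)) s)

/-! ### Expressions for the estimates -/

namespace Expr

instance : Add Expr := ⟨.bin .add⟩
instance : Sub Expr := ⟨.bin .sub⟩
instance : Mul Expr := ⟨.bin .mul⟩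
instance : Div Expr := ⟨.bin .div⟩

theorem eval_add (μ : Mem) (e f : Expr) : (e + f).eval μ = e.eval μ + f.eval μ := rfl
theorem eval_sub (μ : Mem) (e f : Expr) : (e - f).eval μ = e.eval μ - f.eval μ := rfl
theorem eval_mul (μ : Mem) (e f : Expr) : (e * f).eval μ = e.eval μ * f.eval μ := rfl
theorem eval_div (μ : Mem) (e f : Expr) : (e / f).eval μ = e.eval μ / f.eval μ := rfl

theorem eval_lt (μ : Mem) (e f : Expr) :
    (Expr.bin .lt e f).eval μ = if e.eval μ < f.eval μ then 1 else 0 := rfl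

theorem eval_eq (μ : Mem) (e f : Expr) :
    (Expr.bin .eq e f).eval μ = if e.eval μ = f.eval μ then 1 else 0 := rfl

theorem scoped_add {d : ℕ} {e f : Expr} : (e + f).Scoped d ↔ e.Scoped d ∧ f.Scoped d := Iff.rfl
theorem scoped_sub {d : ℕ} {e f : Expr} : (e - f).Scoped d ↔ e.Scoped d ∧ f.Scoped d := Iff.rfl
theorem scoped_mul {d : ℕ} {e f : Expr} : (e * f).Scoped d ↔ e.Scoped d ∧ f.Scoped d := Iff.rfl

theorem Scoped.mono {d d' : ℕ} (hd : d ≤ d') : ∀ {e : Expr}, e.Scoped d → e.Scoped d'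
  | .lit _, _ => trivial
  | .read _ _, h => ⟨h.1.mono hd, h.2.1, fun ha => by
      obtain ⟨k, hk, hi⟩ := h.2.2 ha
      exact ⟨k, hk.trans_le hd, hi⟩⟩
  | .bin _ _ _, h => ⟨h.1.mono hd, h.2.mono hd⟩

/-- The number of qubits, gates, samples, and active bits; the scaling factor. -/
def qubits : Expr := .read 4 (.lit 0)
def gateCount : Expr := .read 4 (.lit 1)
def sampleCount : Expr := .read 4 (.lit 2)
def scaleVar : Expr := .read 5 (.lit 2)

/-- A summation variable. -/
def var (r : ℕ) : Expr := .read 2 (.lit r)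

theorem eval_var (μ : Mem) (r : ℕ) : (var r).eval μ = μ 2 r := rfl

theorem scoped_var {r d : ℕ} : (var r).Scoped d ↔ r < d := by
  constructor
  · rintro ⟨-, -, h⟩
    obtain ⟨k, hk, h⟩ := h rfl
    rw [Expr.lit.injEq] at h
    have : r = k := by exact_mod_cast h
    omega
  · exact fun h => ⟨trivial, by decide, fun _ => ⟨r, h, rfl⟩⟩

theorem scoped_read {a d : ℕ} {i : Expr} (h2 : a ≠ 2) (h3 : a ≠ 3) :
    (Expr.read a i).Scoped d ↔ i.Scoped d :=
  ⟨fun h => h.1, fun h => ⟨h, h3, fun h => absurd h h2⟩⟩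

theorem scoped_lit {d : ℕ} {k : ℤ} : (Expr.lit k).Scoped d := trivial

theorem scoped_bin {d : ℕ} {o : BinOp} {e f : Expr} :
    (Expr.bin o e f).Scoped d ↔ e.Scoped d ∧ f.Scoped d := Iff.rfl

/-- Bit `q` of the sample that is selected by the summation variable `p`. -/
def sampleBit (p : ℕ) (q : Expr) : Expr :=
  .read 0 (.lit 3 + .lit 4 * gateCount + .lit 3 * qubits + var p * qubits + q)

/-- Bit `q` of the string with ones at the values of the first `p` summation variables. -/
def maskBit : ℕ → Expr → Expr
  | 0, _ => .lit 0
  | p + 1, q => maskBit p q + .bin .eq (var p) q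

/-- `a + b - 2 * a * b` is addition modulo two of bits. -/
def shiftedBit (p : ℕ) (q : Expr) : Expr :=
  sampleBit p q + maskBit p q - .lit 2 * (sampleBit p q * maskBit p q)

/-- The entry `r` of the gate that is selected by the summation variable `g`. -/
def gateEntry (g : ℕ) (r : ℤ) : Expr := .read 0 (.lit 3 + .lit 4 * var g + .lit r)

/-- `1` if all qubits of the selected gate are `1`, and `0` otherwise. -/
def gateBit (g : ℕ) (bit : Expr → Expr) : Expr :=
  bit (gateEntry g 1) *
    (.lit 1 - .bin .lt (.lit 1) (gateEntry g 0) * (.lit 1 - bit (gateEntry g 2))) *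
    (.lit 1 - .bin .lt (.lit 2) (gateEntry g 0) * (.lit 1 - bit (gateEntry g 3)))

/-- The entry `r` of the description of the rate of qubit `j`. -/
def rateEntry (j : Expr) (r : ℤ) : Expr :=
  .read 0 (.lit 3 + .lit 4 * gateCount + .lit 3 * j + .lit r)

/-- Entry `0` is a presence flag; the case distinction is made arithmetically, as expressions have
no branching. -/
def rateNumber (P : SimParams) (j : Expr) : Expr :=
  rateEntry j 0 * (rateEntry j 2 - rateEntry j 1) + (.lit 1 - rateEntry j 0) * .lit P.num

def rateDenominator (P : SimParams) (j : Expr) : Expr :=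
  rateEntry j 0 * rateEntry j 2 + (.lit 1 - rateEntry j 0) * .lit P.den

/-- The product of the values of an expression at the first `p` summation variables. -/
def prodVars (f : Expr → Expr) : ℕ → Expr
  | 0 => .lit 1
  | p + 1 => f (var p) * prodVars f p

def outSign (j : Expr) : Expr := .lit 1 - .lit 2 * .read 1 j

theorem scoped_prodVars {f : Expr → Expr} (hf : ∀ {d j}, j.Scoped d → (f j).Scoped d) (p : ℕ) :
    (prodVars f p).Scoped p := by
  induction p with
  | zero => trivial
  | succ p ih => exact ⟨hf (scoped_var.2 p.lt_succ_self), ih.mono p.le_succ⟩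

theorem scoped_maskBit {d p : ℕ} (hp : p ≤ d) {q : Expr} (hq : q.Scoped d) :
    (maskBit p q).Scoped d := by
  induction p with
  | zero => trivial
  | succ p ih => exact ⟨ih (by omega), scoped_var.2 hp, hq⟩

theorem eval_maskBit (μ : Mem) (p : ℕ) (q : Expr) : (maskBit p q).eval μ =
    ∑ r ∈ Finset.range p, if μ 2 (r : ℕ) = q.eval μ then 1 else 0 := by
  induction p with
  | zero => rfl
  | succ p ih => rw [maskBit, eval_add, ih, Finset.sum_range_succ, eval_eq, eval_var]

end Expr

namespace SumExpr

open Expr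

/-- The exponent of `-1` for the selected sample. -/
def phaseSum (p : ℕ) : SumExpr :=
  .sum 1 (.ex (gateBit (p + 1) (sampleBit p) + gateBit (p + 1) (shiftedBit p)))

def parity (e : SumExpr) : SumExpr :=
  .bin .sub e (.bin .mul (.ex (.lit 2)) (.bin .div e (.ex (.lit 2))))

def sign (e : SumExpr) : SumExpr := .bin .sub (.ex (.lit 1)) (.bin .mul (.ex (.lit 2)) (parity e))

def tally (p : ℕ) : SumExpr := .sum 2 (sign (phaseSum p))

def term (P : SimParams) (p : ℕ) : SumExpr :=
  .bin .mul (.bin .div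
      (.bin .mul (.bin .mul (tally p) (.ex (prodVars (rateNumber P) p))) (.ex scaleVar))
      (.ex (sampleCount * prodVars (rateDenominator P) p)))
    (.ex (prodVars outSign p))

/-- `1` if the summation variable `p` is larger than the previous one. -/
def increasing : ℕ → Expr
  | 0 => .lit 1
  | p + 1 => .bin .lt (var p) (var (p + 1))

/-- The expression for `enumSum`. Sums always run over the full range, so the condition `a ≤ j`
becomes the factor `increasing`. The nesting depth is the constant `P.deg`, hence one fixed
expression serves all `n`. -/
def enum (P : SimParams) : ℕ → ℕ → SumExpr
  | 0, p => term P p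
  | d + 1, p => .bin .add (term P p) (.sum 3 (.bin .mul (.ex (increasing p)) (enum P d (p + 1))))

theorem _root_.SimParams.scoped_factors (P : SimParams) (p : ℕ) :
    (prodVars (rateNumber P) p).Scoped p ∧ (prodVars (rateDenominator P) p).Scoped p ∧
      (prodVars outSign p).Scoped p := by
  have h2 : (prodVars (rateNumber P) p).Scoped p := scoped_prodVars (fun {d j} h => by
    simp [rateNumber, rateEntry, scoped_add, scoped_mul, scoped_sub, scoped_lit, scoped_read,
      gateCount, h]) p
  have h3 : (prodVars (rateDenominator P) p).Scoped p := scoped_prodVars (fun {d j} h => by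
    simp [rateDenominator, rateEntry, scoped_add, scoped_mul, scoped_sub, scoped_lit, scoped_read,
      gateCount, h]) p
  have h4 : (prodVars outSign p).Scoped p := scoped_prodVars (fun {d j} h => by
    simp [outSign, scoped_mul, scoped_sub, scoped_lit, scoped_read, h]) p
  exact ⟨h2, h3, h4⟩

theorem scoped_term (P : SimParams) (p : ℕ) : (term P p).Scoped p := by
  have h1 : (phaseSum p).Scoped (p + 1) := by
    simp [phaseSum, Scoped, gateBit, shiftedBit, sampleBit, gateEntry, scoped_add, scoped_mul,
      scoped_sub, scoped_bin, scoped_lit, scoped_var, scoped_read, gateCount, qubits,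
      scoped_maskBit (show p ≤ p + 1 + 1 by omega)]
  obtain ⟨h2, h3, h4⟩ := P.scoped_factors p
  simp [term, tally, sign, parity, Scoped, h1, h2, h3, h4, scoped_lit, scoped_mul, scoped_read,
    scaleVar, sampleCount]

theorem scoped_enum (P : SimParams) (d : ℕ) : ∀ p, (enum P d p).Scoped p := by
  induction d with
  | zero => exact fun p => scoped_term P p
  | succ d ih =>
      refine fun p => ⟨scoped_term P p, ?_, ih (p + 1)⟩
      cases p with
      | zero => trivial
      | succ p => exact ⟨scoped_var.2 (by omega), scoped_var.2 (by omega)⟩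

theorem eval_sign (d : ℕ) (μ : Mem) (e : SumExpr) (t : ℕ) (h : e.eval d μ = t) :
    (sign e).eval d μ = (-1) ^ t := by
  simp only [sign, parity, eval, BinOp.eval, h, Expr.eval]
  rcases Nat.even_or_odd t with ht | ht
  · rw [ht.neg_one_pow]; obtain ⟨a, rfl⟩ := ht; push_cast; omega
  · rw [ht.neg_one_pow]; obtain ⟨a, rfl⟩ := ht; push_cast; omega

end SumExpr

/-! ### Memory contents -/

variable {n N : ℕ}

/-- Array `0` describes a circuit, rates and sampled strings. -/
structure Loaded (μ : Mem) (C : IQPCircuit n) (κ : Fin n → Option ℚ) (z : Fin N → Bits n) :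
    Prop where
  qubits : μ 0 1 = n
  size : μ 0 2 = C.size
  gate : ∀ (g : ℕ) (hg : g < C.gates.length) (r : ℕ), r < 4 →
    μ 0 (3 + 4 * g + r) = (C.gates[g].code).getD r 0
  rate : ∀ (j : Fin n) (r : ℕ), r < 3 →
    μ 0 (3 + 4 * C.size + 3 * (j : ℕ) + r) = (rateCode (κ j)).getD r 0
  sample : ∀ (i : Fin N) (q : Fin n),
    μ 0 (3 + 4 * C.size + 3 * n + (i : ℕ) * n + (q : ℕ)) = (z i q : ℕ)

/-- The memory contains all that is needed for computing a marginal. -/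
structure Ready (P : SimParams) (μ : Mem) (C : IQPCircuit n) (κ : Fin n → Option ℚ)
    (z : Fin N → Bits n) (k : ℕ) (y : Bits n) : Prop where
  loaded : Loaded μ C κ z
  qubits : μ 4 0 = n
  size : μ 4 1 = C.size
  samples : μ 4 2 = N
  active : μ 4 3 = k
  scale : μ 5 2 = P.scale n
  bit : ∀ j : Fin n, μ 1 (j : ℕ) = (y j : ℕ)

theorem Ready.set_two {P : SimParams} {μ : Mem} {C : IQPCircuit n} {κ : Fin n → Option ℚ}
    {z : Fin N → Bits n} {k : ℕ} {y : Bits n} (h : Ready P μ C κ z k y) (i v : ℤ) :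
    Ready P (μ.set 2 i v) C κ z k y := by
  have e : ∀ a : ℕ, a ≠ 2 → (μ.set 2 i v) a = μ a := fun a ha => by
    ext j; simp [Mem.set_apply, ha]
  have e0 := e 0 (by decide)
  refine ⟨⟨?_, ?_, ?_, ?_, ?_⟩, ?_, ?_, ?_, ?_, ?_, ?_⟩
  · rw [e0]; exact h.loaded.qubits
  · rw [e0]; exact h.loaded.size
  · rw [e0]; exact h.loaded.gate
  · rw [e0]; exact h.loaded.rate
  · rw [e0]; exact h.loaded.sample
  · rw [e 4 (by decide)]; exact h.qubits
  · rw [e 4 (by decide)]; exact h.size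
  · rw [e 4 (by decide)]; exact h.samples
  · rw [e 4 (by decide)]; exact h.active
  · rw [e 5 (by decide)]; exact h.scale
  · rw [e 1 (by decide)]; exact h.bit

/-- The first `p` summation variables are the positions of the ones of `s`, all less than `a`. -/
structure VarsMatch (P : SimParams) (μ : Mem) (κ : Fin n → Option ℚ) (y : Bits n) (p a : ℕ)
    (s : Bits n) : Prop where
  mask : ∀ q : Fin n, (∑ r ∈ Finset.range p, if μ 2 (r : ℕ) = (q : ℕ) then 1 else 0) =
    ((s q : ℕ) : ℤ)
  num : (Expr.prodVars (Expr.rateNumber P) p).eval μ = bitWeight (fun j => P.rateNum (κ j)) s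
  den : (Expr.prodVars (Expr.rateDenominator P) p).eval μ = bitWeight (fun j => P.rateDen (κ j)) s
  sgn : (Expr.prodVars Expr.outSign p).eval μ = bitsSign y s
  zero : ∀ j : Fin n, a ≤ j → s j = 0
  last : (p = 0 ∧ a = 0) ∨ ∃ p', p = p' + 1 ∧ μ 2 (p' : ℕ) + 1 = a

/-! ### Values of the expressions -/

section Values

variable {n N : ℕ} {P : SimParams} {μ : Mem} {C : IQPCircuit n} {κ : Fin n → Option ℚ}
  {z : Fin N → Bits n} {k : ℕ} {y : Bits n}

theorem Mem.agree_set_two (d : ℕ) (μ : Mem) (v : ℤ) : (μ.set 2 (d : ℕ) v).Agree d μ :=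
  ⟨fun a i h2 _ => by simp [Mem.set_apply, h2],
    fun k hk => by rw [Mem.set_apply, if_neg]; omega⟩

theorem Ready.eval_sampleBit (h : Ready P μ C κ z k y) {p : ℕ} {i : Fin N}
    (hi : μ 2 (p : ℕ) = (i : ℕ)) {e : Expr} {q : Fin n} (he : e.eval μ = (q : ℕ)) :
    (Expr.sampleBit p e).eval μ = ((z i q : ℕ) : ℤ) := by
  rw [← h.loaded.sample i q]
  simp only [Expr.sampleBit, Expr.eval, BinOp.eval, Expr.eval_var,
    Expr.gateCount, Expr.qubits, h.qubits, h.size, hi, he]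

theorem Ready.eval_shiftedBit (h : Ready P μ C κ z k y) {p : ℕ} {i : Fin N}
    (hi : μ 2 (p : ℕ) = (i : ℕ)) {s : Bits n}
    (hs : ∀ q : Fin n, (∑ r ∈ Finset.range p, if μ 2 (r : ℕ) = (q : ℕ) then 1 else 0) =
      ((s q : ℕ) : ℤ)) {e : Expr} {q : Fin n} (he : e.eval μ = (q : ℕ)) :
    (Expr.shiftedBit p e).eval μ = (((z i + s) q : ℕ) : ℤ) := by
  have hadd : ∀ a b : Fin 2, ((a + b : Fin 2) : ℤ) = a + b - 2 * (a * b) := by decide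
  simp only [Expr.shiftedBit, Expr.eval_sub, h.eval_sampleBit hi he,
    Expr.eval_maskBit, he, hs, Expr.eval, BinOp.eval, Pi.add_apply]
  exact (hadd _ _).symm

theorem Loaded.eval_gateEntry (h : Loaded μ C κ z) {v g : ℕ} (hg : g < C.gates.length)
    (hv : μ 2 (v : ℕ) = g) {r : ℕ} (hr : r < 4) :
    (Expr.gateEntry v r).eval μ = (C.gates[g].code).getD r 0 := by
  rw [← h.gate g hg r hr]
  simp only [Expr.gateEntry, Expr.eval, BinOp.eval, Expr.eval_var, hv]

/-- The missing qubits of a `Z` or `CZ` gate are padded by `0`, which would read a genuine bit; the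
comparisons with the number of qubits of the gate turn these factors into `1`. -/
theorem Loaded.eval_gateBit (h : Loaded μ C κ z) {v g : ℕ} (hg : g < C.gates.length)
    (hv : μ 2 (v : ℕ) = g) {bit : Expr → Expr} {x : Bits n}
    (hbit : ∀ (e : Expr) (q : Fin n), e.eval μ = (q : ℕ) → (bit e).eval μ = (x q : ℕ)) :
    (Expr.gateBit v bit).eval μ = (C.gates[g].bit x : ℕ) := by
  have h0 := h.eval_gateEntry hg hv (r := 0) (by decide)
  have h1 := h.eval_gateEntry hg hv (r := 1) (by decide)
  have h2 := h.eval_gateEntry hg hv (r := 2) (by decide)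
  have h3 := h.eval_gateEntry hg hv (r := 3) (by decide)
  simp only [Expr.gateBit, Expr.eval_mul, Expr.eval_sub, Expr.eval, BinOp.eval]
  push_cast at h0 h1 h2 h3
  rw [h0]
  cases hc : C.gates[g] with
  | z i =>
      rw [hc] at h1
      simp [DiagGate.code, DiagGate.bit, hbit _ i h1]
  | cz i j hij =>
      rw [hc] at h1 h2
      simp [DiagGate.code, DiagGate.bit, hbit _ i h1, hbit _ j h2]
  | ccz i j l hij hil hjl =>
      rw [hc] at h1 h2 h3
      simp [DiagGate.code, DiagGate.bit, hbit _ i h1, hbit _ j h2, hbit _ l h3]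

theorem Ready.eval_phaseSum (h : Ready P μ C κ z k y) {p : ℕ} {i : Fin N}
    (hi : μ 2 (p : ℕ) = (i : ℕ)) {s : Bits n}
    (hs : ∀ q : Fin n, (∑ r ∈ Finset.range p, if μ 2 (r : ℕ) = (q : ℕ) then 1 else 0) =
      ((s q : ℕ) : ℤ)) :
    (SumExpr.phaseSum p).eval (p + 1) μ = (C.phase (z i) + C.phase (z i + s) : ℕ) := by
  have hsize : (μ 4 1).toNat = C.gates.length := by rw [h.size]; simp [IQPCircuit.size]
  rw [SumExpr.phaseSum, SumExpr.eval, Nat.cast_one, hsize, Finset.sum_range]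
  simp only [IQPCircuit.phase, ← Fin.sum_univ_fun_getElem]
  rw [← Finset.sum_add_distrib]
  push_cast
  refine Finset.sum_congr rfl fun g _ => ?_
  set ν := μ.set 2 ((p + 1 : ℕ) : ℤ) (g : ℕ) with hν
  have hR : Ready P ν C κ z k y := h.set_two _ _
  have hA : ν.Agree (p + 1) μ := Mem.agree_set_two _ _ _
  have hg : ν 2 ((p + 1 : ℕ) : ℤ) = (g : ℕ) := Mem.set_self _ _ _ _
  have hi' : ν 2 (p : ℕ) = (i : ℕ) := (hA.2 p (by omega)).trans hi
  have hs' : ∀ q : Fin n, (∑ r ∈ Finset.range p, if ν 2 (r : ℕ) = (q : ℕ) then 1 else 0) =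
      ((s q : ℕ) : ℤ) := fun q => by
    rw [← hs q]
    refine Finset.sum_congr rfl fun r hr => ?_
    rw [hA.2 r (by have := Finset.mem_range.1 hr; omega)]
  push_cast at hν
  rw [SumExpr.eval, ← hν, Expr.eval_add,
    hR.loaded.eval_gateBit g.2 hg fun e q he => hR.eval_sampleBit hi' he,
    hR.loaded.eval_gateBit g.2 hg fun e q he => hR.eval_shiftedBit hi' hs' he]

theorem Ready.eval_tally (h : Ready P μ C κ z k y) {p : ℕ} {s : Bits n}
    (hs : ∀ q : Fin n, (∑ r ∈ Finset.range p, if μ 2 (r : ℕ) = (q : ℕ) then 1 else 0) =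
      ((s q : ℕ) : ℤ)) :
    (SumExpr.tally p).eval p μ = C.tally z s := by
  have hN : (μ 4 2).toNat = N := by rw [h.samples]; simp
  rw [SumExpr.tally, SumExpr.eval, Nat.cast_ofNat, hN, Finset.sum_range, IQPCircuit.tally]
  refine Finset.sum_congr rfl fun i _ => ?_
  have hR : Ready P (μ.set 2 (p : ℕ) (i : ℕ)) C κ z k y := h.set_two _ _
  have hA : (μ.set 2 (p : ℕ) (i : ℕ)).Agree p μ := Mem.agree_set_two _ _ _
  rw [SumExpr.eval_sign _ _ _ _ (hR.eval_phaseSum (Mem.set_self _ _ _ _) (s := s) fun q => ?_)]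
  · rw [pow_add]; rfl
  · rw [← hs q]
    refine Finset.sum_congr rfl fun r hr => ?_
    rw [hA.2 r (Finset.mem_range.1 hr)]

theorem Ready.eval_term (h : Ready P μ C κ z k y) {p a : ℕ} {s : Bits n}
    (hs : VarsMatch P μ κ y p a s) :
    (SumExpr.term P p).eval p μ = P.coefInt C κ z s * bitsSign y s := by
  simp only [SumExpr.term, SumExpr.eval, BinOp.eval, h.eval_tally hs.mask, hs.num, hs.sgn,
    hs.den, Expr.sampleCount, Expr.scaleVar, Expr.eval, h.samples, h.scale,
    SimParams.coefInt]

theorem Ready.eval_rates (h : Ready P μ C κ z k y) {e : Expr} {j : Fin n}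
    (he : e.eval μ = (j : ℕ)) :
    (Expr.rateNumber P e).eval μ = P.rateNum (κ j) ∧
      (Expr.rateDenominator P e).eval μ = P.rateDen (κ j) := by
  have hr : ∀ r < 3, (Expr.rateEntry e (r : ℕ)).eval μ = (rateCode (κ j)).getD r 0 := by
    intro r hr
    rw [← h.loaded.rate j r hr]
    simp only [Expr.rateEntry, Expr.eval, BinOp.eval, Expr.gateCount, h.size, he]
  have h0 := hr 0 (by decide)
  have h1 := hr 1 (by decide)
  have h2 := hr 2 (by decide)
  push_cast at h0 h1 h2
  simp only [Expr.rateNumber, Expr.rateDenominator, Expr.eval_add, Expr.eval_sub, BinOp.eval,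
    Expr.eval, h0, h1, h2]
  cases κ j <;> simp [rateCode, SimParams.rateNum, SimParams.rateDen]

/-- Since `j ≥ a`, the bit at `j` is still zero, so the mask gains one term and each product one
factor. The new bound `j + 1` forces the next position to be larger. -/
theorem Ready.varsMatch_step (h : Ready P μ C κ z k y) {p a : ℕ} {s : Bits n}
    (hs : VarsMatch P μ κ y p a s) (j : Fin n) (hj : a ≤ j) :
    VarsMatch P (μ.set 2 (p : ℕ) (j : ℕ)) κ y (p + 1) (j + 1) (setBit s j 1) := by
  have hR : Ready P (μ.set 2 (p : ℕ) (j : ℕ)) C κ z k y := h.set_two _ _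
  have hA : (μ.set 2 (p : ℕ) (j : ℕ)).Agree p μ := Mem.agree_set_two _ _ _
  have hs0 := hs.zero j hj
  have hv : (Expr.var p).eval (μ.set 2 (p : ℕ) (j : ℕ)) = (j : ℕ) := Mem.set_self _ _ _ _
  have hp : ∀ f : Expr → Expr, (Expr.prodVars f p).Scoped p →
      (Expr.prodVars f (p + 1)).eval (μ.set 2 (p : ℕ) (j : ℕ)) =
        (f (.var p)).eval (μ.set 2 (p : ℕ) (j : ℕ)) * (Expr.prodVars f p).eval μ := fun f hf => by
    rw [Expr.prodVars, Expr.eval_mul, Expr.eval_congr hA hf]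
  obtain ⟨h2, h3, h4⟩ := P.scoped_factors p
  refine ⟨fun q => ?_, ?_, ?_, ?_, fun i hi => ?_, Or.inr ⟨p, rfl, ?_⟩⟩
  · rw [Finset.sum_range_succ, Mem.set_self, Finset.sum_congr rfl fun r hr => by
      rw [hA.2 r (Finset.mem_range.1 hr)], hs.mask q]
    by_cases hq : (q : ℕ) = j
    · have : q = j := Fin.ext hq
      simp [setBit, this, hs0]
    · have : ((j : ℕ) : ℤ) ≠ (q : ℕ) := by exact_mod_cast Ne.symm hq
      simp [setBit, hq, this]
  · rw [hp _ h2, hs.num, (hR.eval_rates hv).1, bitWeight_setBit _ j hs0]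
  · rw [hp _ h3, hs.den, (hR.eval_rates hv).2, bitWeight_setBit _ j hs0]
  · rw [hp _ h4, hs.sgn, bitsSign_eq_bitWeight, bitsSign_eq_bitWeight, bitWeight_setBit _ j hs0]
    simp only [Expr.outSign, Expr.eval_sub, BinOp.eval, Expr.eval, hv, hR.bit]
  · rw [setBit, if_neg (by omega)]; exact hs.zero i (by omega)
  · rw [Mem.set_self]; push_cast; rfl

theorem eval_enum (d : ℕ) : ∀ {μ : Mem} {p a : ℕ} {s : Bits n}, k ≤ n → Ready P μ C κ z k y →
    VarsMatch P μ κ y p a s → (SumExpr.enum P d p).eval p μ =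
      enumSum (fun s => P.coefInt C κ z s * bitsSign y s) k d a s := by
  induction d with
  | zero => exact fun _ h hs => h.eval_term hs
  | succ d ih =>
      intro μ p a s hk h hs
      have hk' : (μ 4 3).toNat = k := by rw [h.active]; simp
      simp only [SumExpr.enum, SumExpr.eval, BinOp.eval, h.eval_term hs, enumSum, Nat.cast_ofNat,
        hk']
      congr 1
      refine Finset.sum_congr rfl fun j hj => ?_
      rw [Finset.mem_range] at hj
      have hinc : (SumExpr.increasing p).eval (μ.set 2 (p : ℕ) (j : ℕ)) =
          if a ≤ j then 1 else 0 := by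
        rcases hs.last with ⟨rfl, rfl⟩ | ⟨p, rfl, hp⟩
        · simp [SumExpr.increasing, Expr.eval]
        · have e : (μ.set 2 ((p + 1 : ℕ) : ℤ) (j : ℕ)) 2 (p : ℕ) = μ 2 (p : ℕ) :=
            (Mem.agree_set_two _ _ _).2 p p.lt_succ_self
          simp only [SumExpr.increasing, Expr.eval_lt, Expr.eval_var, Mem.set_self, e]
          congr 1
          rw [eq_iff_iff]; omega
      rw [hinc]
      split
      · rename_i haj
        rw [ih hk (h.set_two _ _) (h.varsMatch_step hs ⟨j, by omega⟩ haj), one_mul]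
      · rw [zero_mul]

/-- The link between program and distribution: one expression, times a power of two, is a marginal
of the signed function. The prefix `y` enters only through the signs. -/
theorem Ready.eval_enum_zero (h : Ready P μ C κ z k y) (hk : k ≤ n) (d : ℕ) :
    2 ^ (n - k) * (SumExpr.enum P d 0).eval 0 μ =
      marginal (fourierSum (P.coefInt C κ z) d) k y := by
  rw [marginal_fourierSum _ _ hk, eval_enum d hk h (a := 0) (s := 0)]
  refine ⟨fun q => ?_, ?_, ?_, ?_, fun _ _ => rfl, Or.inl ⟨rfl, rfl⟩⟩
  · simp
  · simp [Expr.prodVars, Expr.eval, bitWeight]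
  · simp [Expr.prodVars, Expr.eval, bitWeight]
  · rw [bitsSign_comm, bitsSign_zero_left]; rfl

end Values

/-! ### Time bounds for programs -/

/-- A bound for the running time when all numbers have at most `X` bits and all loops at most `X`
iterations. -/
def Prog.time : Prog → ℕ → ℕ
  | .skip, _ => 1
  | .write _ i e, X => (i.wt + e.wt) * X + 1
  | .flip _ i, X => i.wt * X + 1
  | .emit e, X => e.wt * X + 1
  | .seq c d, X => c.time X + d.time X
  | .ite b c d, X => b.wt * X + (c.time X + d.time X) + 1
  | .loop b c, X => X * (b.wt * X + c.time X + 1) + (b.wt * X + 1)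

theorem Prog.polyBounded_time (c : Prog) : PolyBounded c.time := by
  have h : ∀ k : ℕ, PolyBounded fun X => k * X := fun k => (PolyBounded.const k).mul .id
  induction c with
  | skip => exact .const 1
  | write a i e => exact (h _).add (.const 1)
  | flip a i => exact (h _).add (.const 1)
  | emit e => exact (h _).add (.const 1)
  | seq c d hc hd => exact hc.add hd
  | ite b c d hc hd => exact ((h _).add (hc.add hd)).add (.const 1)
  | loop b c hc =>
      exact (PolyBounded.id.mul (((h _).add hc).add (.const 1))).add ((h _).add (.const 1))

namespace Runs

variable {ω : ℕ → Bool} {c d : Prog} {s : Config} {T X : ℕ} {Q : Config → Prop}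

theorem write_le {a : ℕ} {i e : Expr} (hμ : s.mem.BitsLE X) (hi : i.Scoped 0) (he : e.Scoped 0)
    {u v : ℤ} (hu : i.eval s.mem = u) (hv : e.eval s.mem = v)
    (h : Q { s with mem := s.mem.set a u v }) :
    Runs ω (.write a i e) s ((Prog.write a i e).time X) Q := by
  refine Runs.write ?_ (hu ▸ hv ▸ h)
  have := i.cost_le hμ hi
  have := e.cost_le hμ he
  rw [Prog.time, add_mul]; omega

theorem flip_le {a : ℕ} {i : Expr} (hμ : s.mem.BitsLE X) (hi : i.Scoped 0)
    {u : ℤ} (hu : i.eval s.mem = u)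
    (h : Q { s with mem := s.mem.set a u (if ω s.pos then 1 else 0), pos := s.pos + 1 }) :
    Runs ω (.flip a i) s ((Prog.flip a i).time X) Q :=
  Runs.flip (Nat.add_le_add_right (i.cost_le hμ hi) 1) (hu ▸ h)

theorem emit_le {e : Expr} (hμ : s.mem.BitsLE X) (he : e.Scoped 0)
    {v : ℤ} (hv : e.eval s.mem = v) (h : Q { s with out := s.out ++ [v] }) :
    Runs ω (.emit e) s ((Prog.emit e).time X) Q :=
  Runs.emit (Nat.add_le_add_right (e.cost_le hμ he) 1) (hv ▸ h)

theorem ite_le {b : Expr} (hμ : s.mem.BitsLE X) (hb : b.Scoped 0)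
    (h1 : b.eval s.mem ≠ 0 → Runs ω c s (c.time X) Q)
    (h2 : b.eval s.mem = 0 → Runs ω d s (d.time X) Q) :
    Runs ω (.ite b c d) s ((Prog.ite b c d).time X) Q :=
  Runs.ite (b.cost_le hμ hb) (fun h => (h1 h).mono (Nat.le_add_right _ _) fun _ => _root_.id)
    fun h => (h2 h).mono (Nat.le_add_left _ _) fun _ => _root_.id

/-- A loop that counts up to `N`. -/
theorem loop_le {b : Expr} (Inv : ℕ → Config → Prop) {N : ℕ} (hN : N ≤ X) (hb : b.Scoped 0)
    (hB : ∀ i ≤ N, ∀ s, Inv i s → s.mem.BitsLE X ∧ b.eval s.mem = if i < N then 1 else 0)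
    (hstep : ∀ i < N, ∀ s, Inv i s → Runs ω c s T (Inv (i + 1)))
    (h0 : Inv 0 s) :
    Runs ω (.loop b c) s (X * (b.wt * X + T + 1) + (b.wt * X + 1)) (Inv N) := by
  refine (Runs.loop Inv (fun i hi s hs => b.cost_le (hB i hi s hs).1 hb)
    (fun i hi s hs => ⟨?_, hstep i hi s hs⟩) (fun s hs => ?_) h0).mono
    (Nat.add_le_add_right (Nat.mul_le_mul_right _ hN) _) fun _ => _root_.id
  · rw [(hB i hi.le s hs).2, if_pos hi]; exact one_ne_zero
  · rw [(hB N le_rfl s hs).2, if_neg (lt_irrefl N)]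

end Runs

/-! ### The sampler -/

namespace Expr

theorem eval_lit (μ : Mem) (k : ℤ) : (Expr.lit k).eval μ = k := rfl

theorem eval_read (μ : Mem) (a : ℕ) (i : Expr) : (Expr.read a i).eval μ = μ a (i.eval μ) := rfl

def pow (e : Expr) : ℕ → Expr
  | 0 => .lit 1
  | k + 1 => e * e.pow k

theorem eval_pow (μ : Mem) (e : Expr) (k : ℕ) : (e.pow k).eval μ = e.eval μ ^ k := by
  induction k with
  | zero => rw [pow_zero]; rfl
  | succ k ih => rw [pow, eval_mul, ih, pow_succ']

theorem scoped_pow {d : ℕ} {e : Expr} (h : e.Scoped d) (k : ℕ) : (e.pow k).Scoped d := by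
  induction k with
  | zero => trivial
  | succ k ih => exact ⟨h, ih⟩

end Expr

namespace SimParams

open Expr

variable (P : SimParams)

/-- The cell `i` of the array `5` of auxiliary variables: `0` the random number, `1` the number of
its possible values, `3` the power of two for the inactive bits, `4` a coin or a part of the
possible values, `5` and `6` counters. -/
def aux (i : ℤ) : Expr := .read 5 (.lit i)

/-- Reads the sizes. -/
def readSizes : Prog :=
  .seq (.write 4 (.lit 0) (.read 0 (.lit 1))) (.seq (.write 4 (.lit 1) (.read 0 (.lit 2)))
  (.seq (.write 4 (.lit 2) (.lit P.reps * (qubits + .lit 1).pow (2 * P.deg + 1)))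
  (.seq (.write 4 (.lit 4) (qubits * .lit (P.deg + 1 : ℕ) + .lit P.bits))
  (.seq (.write 5 (.lit 1) (.lit 1)) (.write 5 (.lit 3) (.lit 1))))))

/-- Cell `1` is the current power of two and cell `5` counts the coins, which become binary digits,
the least significant first. In the end cell `1` is the number of possible values. -/
def drawStep : Prog :=
  .seq (.flip 5 (.lit 4)) (.seq (.write 5 (.lit 0) (aux 0 + aux 1 * aux 4))
    (.seq (.write 5 (.lit 1) (aux 1 * .lit 2)) (.write 5 (.lit 5) (aux 5 + .lit 1))))

/-- Draws a random number. -/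
def draw : Prog := .loop (.bin .lt (aux 5) (.read 4 (.lit 4))) drawStep

def powerStep : Prog :=
  .seq (.write 5 (.lit 3) (aux 3 * .lit 2)) (.write 5 (.lit 6) (aux 6 + .lit 1))

/-- Computes powers of two. -/
def powers : Prog :=
  .seq (.loop (.bin .lt (aux 6) qubits) powerStep)
    (.write 5 (.lit 2) (.lit (2 ^ P.bits) * (aux 3).pow P.deg))

def nextBit : Prog :=
  .seq (.write 4 (.lit 3) (.read 4 (.lit 3) + .lit 1)) (.write 5 (.lit 3) (aux 3 / .lit 2))

/-- The subtraction undoes the increment that `nextBit` has already made. -/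
def bitIndex : Expr := .read 4 (.lit 3) - .lit 1

/-- Decides about a bit. -/
def branch : Prog :=
  .seq (.ite (.bin .lt (aux 4) (.lit 0)) (.write 5 (.lit 4) (.lit 0)) .skip)
  (.seq (.ite (.bin .lt (aux 1) (aux 4)) (.write 5 (.lit 4) (aux 1)) .skip)
  (.seq (.ite (.bin .lt (aux 0) (aux 4)) (.write 5 (.lit 1) (aux 4))
    (.seq (.write 1 bitIndex (.lit 1)) (.seq (.write 5 (.lit 0) (aux 0 - aux 4))
      (.write 5 (.lit 1) (aux 1 - aux 4)))))
  (.emit (.read 1 bitIndex))))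

/-- The marginal is computed while the current bit is still `0`, so it is the one of the branch with
bit `0`. -/
def sampleStep : Prog :=
  .seq nextBit (.seq ((SumExpr.enum P P.deg 0).compile 0 0)
    (.seq (.write 5 (.lit 4) (aux 3 * .read 3 (.lit 0))) branch))

def sampleCond : Expr := .bin .lt (.read 4 (.lit 3)) qubits

def sampler : Prog :=
  .seq P.readSizes (.seq draw (.seq P.powers (.loop sampleCond P.sampleStep)))

/-- A bound for the bit lengths of all numbers, including marginals. -/
def wideBound (X : ℕ) : ℕ := 2 * X + (SumExpr.enum P P.deg 0).lenBound X

/-- The signed marginal may have more than `X` bits until it is cut off, so `branch` is charged with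
the wider bound. The `20` more than covers addresses and constants in the assignment before it. -/
def sampleStepTime (X : ℕ) : ℕ :=
  nextBit.time X + ((SumExpr.enum P P.deg 0).timeBound 0 0 X +
    (((2 * P.wideBound X + 20) + branch.time (P.wideBound X))))

def samplerTime (X : ℕ) : ℕ :=
  P.readSizes.time X + (draw.time X + (P.powers.time X +
    (X * (sampleCond.wt * X + P.sampleStepTime X + 1) + (sampleCond.wt * X + 1))))

theorem polyBounded_wideBound : PolyBounded P.wideBound :=
  ((PolyBounded.const 2).mul .id).add (SumExpr.polyBounded_lenBound _)

theorem polyBounded_samplerTime : PolyBounded P.samplerTime := by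
  have h : ∀ k : ℕ, PolyBounded fun X => k * X := fun k => (PolyBounded.const k).mul .id
  have hstep : PolyBounded P.sampleStepTime :=
    nextBit.polyBounded_time.add ((SumExpr.polyBounded_timeBound _ 0 0).add
      ((((PolyBounded.const 2).mul P.polyBounded_wideBound).add (.const 20)).add
        (branch.polyBounded_time.comp P.polyBounded_wideBound)))
  exact P.readSizes.polyBounded_time.add (draw.polyBounded_time.add
    (P.powers.polyBounded_time.add ((PolyBounded.id.mul (((h _).add hstep).add (.const 1))).add
      ((h _).add (.const 1)))))

end SimParams

/-- The number with the given coins as binary digits. -/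
def coinNumber (ω : ℕ → Bool) (R : ℕ) : ℕ := ∑ i ∈ Finset.range R, if ω i then 2 ^ i else 0

theorem coinNumber_lt (ω : ℕ → Bool) (R : ℕ) : coinNumber ω R < 2 ^ R := by
  induction R with
  | zero => simp [coinNumber]
  | succ R ih =>
      rw [coinNumber, Finset.sum_range_succ, pow_succ]
      rw [coinNumber] at ih
      split <;> omega

theorem bitLen_le_of_le_two_pow {a R : ℕ} (h : a ≤ 2 ^ R) : bitLen (a : ℤ) ≤ R + 2 := by
  rw [bitLen_le_iff, Int.natAbs_natCast, pow_succ]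
  have : 0 < 2 ^ R := by positivity
  omega

section Sampler

open Expr SimParams

variable {n : ℕ} {P : SimParams} {C : IQPCircuit n} {κ : Fin n → Option ℚ}
  {z : Fin (P.samples n) → Bits n} {X : ℕ} {ω : ℕ → Bool}

/-- What all steps of the sampler preserve. -/
structure SamplerBase (P : SimParams) (C : IQPCircuit n) (κ : Fin n → Option ℚ)
    (z : Fin (P.samples n) → Bits n) (X : ℕ) (μ : Mem) : Prop where
  loaded : Loaded μ C κ z
  qubits : μ 4 0 = n
  size : μ 4 1 = C.size
  samples : μ 4 2 = P.samples n
  coins : μ 4 4 = P.coins n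
  bits : μ.BitsLE X
  sizes : μ.SizesLT X

/-- `X` is large enough for all numbers in the sampler. -/
structure LargeFor (P : SimParams) (C : IQPCircuit n) (X : ℕ) : Prop where
  coins : P.coins n + 3 ≤ X
  qubits : n < X
  size : C.size < X
  samples : P.samples n < X

theorem Loaded.of_eq {N : ℕ} {z : Fin N → Bits n} {μ ν : Mem} (h : Loaded μ C κ z)
    (e : ν 0 = μ 0) : Loaded ν C κ z :=
  ⟨e ▸ h.qubits, e ▸ h.size, e ▸ h.gate, e ▸ h.rate, e ▸ h.sample⟩

theorem Mem.set_ne {a b : ℕ} (μ : Mem) (i v : ℤ) (h : b ≠ a) : (μ.set a i v) b = μ b := by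
  ext j; simp [Mem.set_apply, h]

theorem SamplerBase.set_five {μ : Mem} (h : SamplerBase P C κ z X μ) {i v : ℤ}
    (hv : bitLen v ≤ X) : SamplerBase P C κ z X (μ.set 5 i v) := by
  have e4 : (μ.set 5 i v) 4 = μ 4 := μ.set_ne i v (by decide)
  exact ⟨h.loaded.of_eq (μ.set_ne i v (by decide)), e4 ▸ h.qubits, e4 ▸ h.size, e4 ▸ h.samples,
    e4 ▸ h.coins, h.bits.set fun _ => hv, h.sizes.set (by decide)⟩

theorem runs_readSizes {s : Config} (hL : Loaded s.mem C κ z) (hX : LargeFor P C X)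
    (hB : s.mem.BitsLE X) (h0 : ∀ a, a ≠ 0 → ∀ i, s.mem a i = 0) :
    Runs ω P.readSizes s (P.readSizes.time X) fun s' =>
      SamplerBase P C κ z X s'.mem ∧ s'.pos = s.pos ∧ s'.out = s.out ∧ s'.mem 5 1 = 1 ∧
        s'.mem 5 3 = 1 ∧ s'.mem 5 0 = 0 ∧ s'.mem 5 5 = 0 ∧ s'.mem 5 6 = 0 ∧ s'.mem 4 3 = 0 ∧
        s'.mem 1 = fun _ => 0 := by
  obtain ⟨x1, x2, x3, x4⟩ := hX
  have hone : bitLen 1 ≤ X := by have : bitLen 1 = 2 := rfl; omega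
  have eN : (P.reps : ℤ) * ((n : ℤ) + 1) ^ (2 * P.deg + 1) = (P.samples n : ℕ) := by
    simp [SimParams.samples]
  have eR : (n : ℤ) * (P.deg + 1 : ℕ) + P.bits = (P.coins n : ℕ) := by simp [SimParams.coins]
  have bn : bitLen (n : ℤ) ≤ X := SumExpr.bitLen_natCast_le x2
  have bm : bitLen (C.size : ℤ) ≤ X := SumExpr.bitLen_natCast_le x3
  have bN : bitLen (P.samples n : ℤ) ≤ X := SumExpr.bitLen_natCast_le x4
  have bR : bitLen (P.coins n : ℤ) ≤ X := SumExpr.bitLen_natCast_le (by omega)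
  have sq : qubits.Scoped 0 := (scoped_read (by decide) (by decide)).2 trivial
  have q1 : (qubits + .lit 1).Scoped 0 := ⟨sq, trivial⟩
  have hq := hL.qubits
  have hm := hL.size
  refine .seq (.write_le hB trivial ((scoped_read (by decide) (by decide)).2 trivial)
    (eval_lit _ _) hq ?_)
  refine .seq (.write_le (X := X) (v := C.size) (hB.set fun _ => bn) trivial
    ((scoped_read (by decide) (by decide)).2 trivial) (eval_lit _ _)
    (by simp [Expr.eval, Mem.set_apply, hm]) ?_)
  refine .seq (.write_le (X := X) (v := P.samples n) ((hB.set fun _ => bn).set fun _ => bm) trivial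
    ⟨trivial, scoped_pow q1 _⟩ (eval_lit _ _)
    (by simp [eval_pow, ← eN, Expr.eval, BinOp.eval, Expr.qubits, Mem.set_apply]) ?_)
  refine .seq (.write_le (X := X) (v := P.coins n)
    (((hB.set fun _ => bn).set fun _ => bm).set fun _ => bN) trivial
    ⟨⟨sq, trivial⟩, trivial⟩ (eval_lit _ _)
    (by simp [← eR, Expr.eval, BinOp.eval, Expr.qubits, Mem.set_apply]) ?_)
  refine .seq (.write_le (X := X) ((((hB.set fun _ => bn).set fun _ => bm).set fun _ => bN).set
    fun _ => bR) trivial trivial (eval_lit _ _) (eval_lit _ _) ?_)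
  refine .write_le (X := X) (((((hB.set fun _ => bn).set fun _ => bm).set fun _ => bN).set
    fun _ => bR).set fun _ => hone) trivial trivial (eval_lit _ _) (eval_lit _ _) ?_
  refine ⟨⟨hL.of_eq ?_, ?_, ?_, ?_, ?_, ?_, fun r => ?_⟩, rfl, rfl, ?_, ?_, ?_, ?_, ?_, ?_, ?_⟩
  · simp [Mem.set_ne]
  · simp [Mem.set_apply]
  · simp [Mem.set_apply]
  · simp [Mem.set_apply]
  · simp [Mem.set_apply]
  · exact (((((hB.set fun _ => bn).set fun _ => bm).set fun _ => bN).set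
      fun _ => bR).set fun _ => hone).set fun _ => hone
  · simp only [Mem.set_apply, show ¬ (4 : ℕ) = 5 by decide, false_and, if_false, true_and]
    have hz := h0 4 (by decide) r
    split
    · simp; omega
    split
    · simpa using x4
    split
    · simpa using x3
    split
    · simpa using x2
    · rw [hz]; simp; omega
  all_goals simp [Mem.set_apply, Mem.set_ne, h0]
  ext i; simp [h0]

theorem runs_draw {s : Config} (hS : SamplerBase P C κ z X s.mem) (hX : LargeFor P C X)
    (hpos : s.pos = 0) (h1 : s.mem 5 1 = 1) (h0 : s.mem 5 0 = 0) (h5 : s.mem 5 5 = 0) :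
    Runs ω draw s (draw.time X) fun s' =>
      SamplerBase P C κ z X s'.mem ∧ s'.out = s.out ∧
        s'.mem 5 0 = coinNumber ω (P.coins n) ∧ s'.mem 5 1 = (2 ^ P.coins n : ℕ) ∧
        s'.mem 5 3 = s.mem 5 3 ∧ s'.mem 5 6 = s.mem 5 6 ∧ s'.mem 4 3 = s.mem 4 3 ∧
        s'.mem 1 = s.mem 1 := by
  obtain ⟨x1, x2, x3, x4⟩ := hX
  set R := P.coins n with hR
  let Inv : ℕ → Config → Prop := fun i s' => SamplerBase P C κ z X s'.mem ∧ s'.out = s.out ∧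
    s'.pos = i ∧ s'.mem 5 0 = coinNumber ω i ∧ s'.mem 5 1 = (2 ^ i : ℕ) ∧ s'.mem 5 5 = i ∧
    s'.mem 5 3 = s.mem 5 3 ∧ s'.mem 5 6 = s.mem 5 6 ∧ s'.mem 4 3 = s.mem 4 3 ∧
        s'.mem 1 = s.mem 1
  have saux : ∀ i, (aux i).Scoped 0 := fun i => (scoped_read (by decide) (by decide)).2 trivial
  have sR : (Expr.read 4 (.lit 4)).Scoped 0 := (scoped_read (by decide) (by decide)).2 trivial
  refine (Runs.loop_le Inv (N := R) (by omega) (b := .bin .lt (aux 5) (.read 4 (.lit 4)))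
    ⟨saux 5, sR⟩ ?_ ?_ ?_).mono le_rfl ?_
  · rintro i hi s' ⟨hS', -, -, -, -, e5, -⟩
    refine ⟨hS'.bits, ?_⟩
    simp only [aux, Expr.eval, BinOp.eval, e5, hS'.coins, Nat.cast_lt, hR]
  · rintro i hi s' ⟨hS', hout, hp, e0, e1, e5, e3, e6, e4, ea⟩
    have hpow : 2 ^ (i + 1) ≤ 2 ^ R := Nat.pow_le_pow_right (by decide) hi
    have b1 : bitLen (if ω i = true then 1 else 0) ≤ X := by
      have h1 : bitLen 1 = 2 := rfl
      have h0 : bitLen 0 = 1 := rfl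
      split <;> omega
    have hnum : (coinNumber ω i : ℤ) + (2 ^ i : ℕ) * (if ω i = true then 1 else 0) =
        coinNumber ω (i + 1) := by
      rw [coinNumber, coinNumber, Finset.sum_range_succ]
      split <;> simp
    have b2 : bitLen (coinNumber ω (i + 1) : ℤ) ≤ X :=
      (bitLen_le_of_le_two_pow ((coinNumber_lt ω (i + 1)).le.trans hpow)).trans (by omega)
    have b3 : bitLen ((2 ^ (i + 1) : ℕ) : ℤ) ≤ X := (bitLen_le_of_le_two_pow hpow).trans (by omega)
    have b4 : bitLen ((i + 1 : ℕ) : ℤ) ≤ X := SumExpr.bitLen_natCast_le (by omega)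
    refine .seq (.flip_le hS'.bits trivial (eval_lit _ _) ?_)
    rw [hp]
    have S1 := hS'.set_five (i := 4) b1
    refine .seq (.write_le (v := coinNumber ω (i + 1)) S1.bits trivial ⟨saux 0, saux 1, saux 4⟩
      (eval_lit _ _) (by
        rw [← hnum]; simp [aux, Expr.eval, BinOp.eval, Mem.set_apply, e0, e1]) ?_)
    have S2 := S1.set_five (i := 0) b2
    refine .seq (.write_le (v := (2 ^ (i + 1) : ℕ)) S2.bits trivial ⟨saux 1, trivial⟩
      (eval_lit _ _) (by simp [aux, Expr.eval, BinOp.eval, Mem.set_apply, e1, pow_succ]) ?_)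
    have S3 := S2.set_five (i := 1) b3
    refine .write_le (v := (i + 1 : ℕ)) S3.bits trivial ⟨saux 5, trivial⟩
      (eval_lit _ _) (by simp [aux, Expr.eval, BinOp.eval, Mem.set_apply, e5]) ?_
    refine ⟨S3.set_five b4, hout, rfl, ?_, ?_, ?_, ?_, ?_, ?_, ?_⟩
    all_goals simp [Mem.set_apply, Mem.set_ne, e3, e4, e6, ea]
  · exact ⟨hS, rfl, hpos, by simp [h0, coinNumber], by simp [h1], by simp [h5], rfl, rfl, rfl, rfl⟩
  · rintro s' ⟨hS', hout, hp, e0, e1, e5, e3, e6, e4, ea⟩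
    exact ⟨hS', hout, e0, e1, e3, e6, e4, ea⟩

theorem runs_powers {s : Config} (hS : SamplerBase P C κ z X s.mem) (hX : LargeFor P C X)
    (h3 : s.mem 5 3 = 1) (h6 : s.mem 5 6 = 0) :
    Runs ω P.powers s (P.powers.time X) fun s' =>
      SamplerBase P C κ z X s'.mem ∧ s'.out = s.out ∧
        s'.mem 5 0 = s.mem 5 0 ∧ s'.mem 5 1 = s.mem 5 1 ∧ s'.mem 5 3 = (2 ^ n : ℕ) ∧
        s'.mem 5 2 = P.scale n ∧ s'.mem 4 3 = s.mem 4 3 ∧ s'.mem 1 = s.mem 1 := by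
  obtain ⟨x1, x2, x3, x4⟩ := hX
  have hnR : n ≤ P.coins n := by rw [SimParams.coins]; nlinarith
  let Inv : ℕ → Config → Prop := fun i s' => SamplerBase P C κ z X s'.mem ∧ s'.out = s.out ∧
    s'.mem 5 0 = s.mem 5 0 ∧ s'.mem 5 1 = s.mem 5 1 ∧ s'.mem 5 3 = (2 ^ i : ℕ) ∧
    s'.mem 5 6 = i ∧ s'.mem 4 3 = s.mem 4 3 ∧ s'.mem 1 = s.mem 1
  have saux : ∀ i, (aux i).Scoped 0 := fun i => (scoped_read (by decide) (by decide)).2 trivial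
  have sq : qubits.Scoped 0 := (scoped_read (by decide) (by decide)).2 trivial
  refine .seq ((Runs.loop_le Inv (N := n) x2.le (b := .bin .lt (aux 6) qubits)
    ⟨saux 6, sq⟩ ?_ ?_ ?_).mono le_rfl ?_)
  · rintro i hi s' ⟨hS', -, -, -, -, e6, -⟩
    refine ⟨hS'.bits, ?_⟩
    simp only [aux, Expr.eval, BinOp.eval, e6, Expr.qubits, hS'.qubits, Nat.cast_lt]
  · rintro i hi s' ⟨hS', hout, e0, e1, e3, e6, e4, ea⟩
    have b1 : bitLen ((2 ^ (i + 1) : ℕ) : ℤ) ≤ X :=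
      (bitLen_le_of_le_two_pow (Nat.pow_le_pow_right (by decide)
        (show i + 1 ≤ P.coins n by omega))).trans (by omega)
    have b2 : bitLen ((i + 1 : ℕ) : ℤ) ≤ X := SumExpr.bitLen_natCast_le (by omega)
    refine .seq (.write_le (v := (2 ^ (i + 1) : ℕ)) hS'.bits trivial ⟨saux 3, trivial⟩
      (eval_lit _ _) (by simp [aux, Expr.eval, BinOp.eval, e3, pow_succ]) ?_)
    have S1 := hS'.set_five (i := 3) b1
    refine .write_le (v := (i + 1 : ℕ)) S1.bits trivial ⟨saux 6, trivial⟩ (eval_lit _ _)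
      (by simp [aux, Expr.eval, BinOp.eval, Mem.set_apply, e6]) ?_
    refine ⟨S1.set_five b2, hout, ?_, ?_, ?_, ?_, ?_, ?_⟩
    all_goals simp [Mem.set_apply, Mem.set_ne, e0, e1, e4, ea]
  · exact ⟨hS, rfl, rfl, rfl, by simp [h3], by simp [h6], rfl, rfl⟩
  · rintro s' ⟨hS', hout, e0, e1, e3, e6, e4, ea⟩
    have v1 : (.lit (2 ^ P.bits) * (aux 3).pow P.deg : Expr).eval s'.mem = P.scale n := by
      simp [eval_mul, eval_pow, eval_lit, aux, e3, SimParams.scale, eval_read]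
    have b1 : bitLen (P.scale n : ℤ) ≤ X := by
      refine (bitLen_le_of_le_two_pow (R := P.coins n) ?_).trans (by omega)
      rw [P.two_pow_coins]
      exact Nat.le_mul_of_pos_left _ (by positivity)
    refine .write_le hS'.bits trivial ⟨trivial, scoped_pow (saux 3) _⟩ (eval_lit _ _) v1 ?_
    refine ⟨hS'.set_five b1, hout, ?_, ?_, ?_, ?_, ?_, ?_⟩
    all_goals simp [Mem.set_apply, Mem.set_ne, e0, e1, e3, e4, ea]

end Sampler

theorem take_bitList_setBit {n : ℕ} (y : Bits n) {k : ℕ} (hk : k < n) (b : Fin 2) :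
    (bitList (setBit y k b)).take (k + 1) = (bitList y).take k ++ [((b : ℕ) : ℤ)] := by
  have hl : ∀ x : Bits n, (bitList x).length = n := fun x => by simp [bitList]
  rw [List.take_succ_eq_append_getElem (by rw [hl]; exact hk)]
  congr 1
  · refine List.ext_getElem (by simp [hl]) fun i h1 h2 => ?_
    have hi : i < k := by simpa [hl, hk.le] using h1
    simp [bitList, setBit, hi.ne]
  · simp [bitList, setBit]

theorem Mem.BitsLE.mono {μ : Mem} {X Y : ℕ} (h : μ.BitsLE X) (hXY : X ≤ Y) : μ.BitsLE Y :=
  fun a i ha => (h a i ha).trans hXY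

/-! ### One round of the sampler, and its complete run -/

section Sampler

open Expr SimParams

variable {n : ℕ} {P : SimParams} {C : IQPCircuit n} {κ : Fin n → Option ℚ}
  {z : Fin (P.samples n) → Bits n} {X : ℕ} {ω : ℕ → Bool}

theorem SamplerBase.set_one {μ : Mem} (h : SamplerBase P C κ z X μ) {i v : ℤ}
    (hv : bitLen v ≤ X) : SamplerBase P C κ z X (μ.set 1 i v) := by
  have e4 : (μ.set 1 i v) 4 = μ 4 := μ.set_ne i v (by decide)
  exact ⟨h.loaded.of_eq (μ.set_ne i v (by decide)), e4 ▸ h.qubits, e4 ▸ h.size, e4 ▸ h.samples,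
    e4 ▸ h.coins, h.bits.set fun _ => hv, h.sizes.set (by decide)⟩

theorem SamplerBase.set_active {μ : Mem} (h : SamplerBase P C κ z X μ) {v : ℕ} (hv : v < X) :
    SamplerBase P C κ z X (μ.set 4 3 v) := by
  refine ⟨h.loaded.of_eq (μ.set_ne 3 v (by decide)), ?_, ?_, ?_, ?_,
    h.bits.set fun _ => SumExpr.bitLen_natCast_le hv, fun r => ?_⟩
  · simp [Mem.set_apply, h.qubits]
  · simp [Mem.set_apply, h.size]
  · simp [Mem.set_apply, h.samples]
  · simp [Mem.set_apply, h.coins]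
  · rw [Mem.set_apply]
    split
    · simpa using hv
    · exact h.sizes r

theorem SamplerBase.of_agree {μ ν : Mem} (h : SamplerBase P C κ z X μ)
    (e : ∀ a i, a = 0 ∨ a = 4 → ν a i = μ a i) (hν : ν.BitsLE X) :
    SamplerBase P C κ z X ν := by
  have e4 : ν 4 = μ 4 := funext fun i => e 4 i (Or.inr rfl)
  exact ⟨h.loaded.of_eq (funext fun i => e 0 i (Or.inl rfl)), e4 ▸ h.qubits, e4 ▸ h.size,
    e4 ▸ h.samples, e4 ▸ h.coins, hν, fun r => by rw [e4]; exact h.sizes r⟩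

/-- The state of the sampler before it decides about bit `k`. -/
structure SamplerState (P : SimParams) (C : IQPCircuit n) (κ : Fin n → Option ℚ)
    (z : Fin (P.samples n) → Bits n) (X k : ℕ) (y : Bits n) (M u : ℕ) (μ : Mem) : Prop where
  base : SamplerBase P C κ z X μ
  number : μ 5 0 = u
  mass : μ 5 1 = M
  scale : μ 5 2 = P.scale n
  power : μ 5 3 = (2 ^ (n - k) : ℕ)
  active : μ 4 3 = k
  bit : ∀ j : Fin n, μ 1 (j : ℕ) = (y j : ℕ)
  zero : ∀ j : Fin n, k ≤ j → y j = 0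
  lt : u < M
  le : M ≤ 2 ^ P.coins n

/-- The two conditionals form `max T 0` and then the minimum with `M`, as in `massZero`. The rest
`c` of the program is a parameter because sequences are nested to the right. -/
theorem runs_clamp {s : Config} {W : ℕ} (hW : s.mem.BitsLE W) {T : ℤ} {M : ℕ}
    (h4 : s.mem 5 4 = T) (h1 : s.mem 5 1 = M) {c : Prog} {Q : Config → Prop}
    (h : ∀ s' : Config, s'.mem.BitsLE W → s'.pos = s.pos → s'.out = s.out →
      s'.mem 5 4 = (min T.toNat M : ℕ) →
      (∀ a i, ¬ (a = 5 ∧ i = 4) → s'.mem a i = s.mem a i) → Runs ω c s' (c.time W) Q) :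
    Runs ω (.seq (.ite (.bin .lt (aux 4) (.lit 0)) (.write 5 (.lit 4) (.lit 0)) .skip)
      (.seq (.ite (.bin .lt (aux 1) (aux 4)) (.write 5 (.lit 4) (aux 1)) .skip) c)) s
      ((Prog.seq (.ite (.bin .lt (aux 4) (.lit 0)) (.write 5 (.lit 4) (.lit 0)) .skip)
      (.seq (.ite (.bin .lt (aux 1) (aux 4)) (.write 5 (.lit 4) (aux 1)) .skip) c)).time W) Q := by
  have saux : ∀ i, (aux i).Scoped 0 := fun i => (scoped_read (by decide) (by decide)).2 trivial
  have step2 : ∀ s' : Config, s'.mem.BitsLE W → s'.pos = s.pos → s'.out = s.out →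
      s'.mem 5 4 = max T 0 → (∀ a i, ¬ (a = 5 ∧ i = 4) → s'.mem a i = s.mem a i) →
      Runs ω (.seq (.ite (.bin .lt (aux 1) (aux 4)) (.write 5 (.lit 4) (aux 1)) .skip) c) s'
        ((Prog.seq (.ite (.bin .lt (aux 1) (aux 4)) (.write 5 (.lit 4) (aux 1)) .skip) c).time W)
        Q := by
    intro s' hB hp ho e4 e
    have e1 : s'.mem 5 1 = M := (e 5 1 (by decide)).trans h1
    have hv : (aux 1).eval s'.mem = M := e1
    refine .seq (.ite_le hB ⟨saux 1, saux 4⟩ (fun hb => ?_) fun hb => ?_)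
    · have hlt : (M : ℤ) < max T 0 := by
        by_contra hc
        exact hb (by simp only [aux, Expr.eval, BinOp.eval, e4, e1, if_neg hc])
      refine .write_le hB trivial (saux 1) (eval_lit _ _) hv (h _ ?_ hp ho ?_ ?_)
      · exact hB.set fun _ => e1 ▸ hB 5 1 (by decide)
      · dsimp only; rw [Mem.set_self]; omega
      · intro a i ha; dsimp only; rw [Mem.set_apply, if_neg ha, e a i ha]
    · have hlt : ¬ (M : ℤ) < max T 0 := by
        intro hc
        simp only [aux, Expr.eval, BinOp.eval, e4, e1, if_pos hc] at hb
        exact one_ne_zero hb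
      exact .skip (h _ hB hp ho (by rw [e4]; omega) e)
  refine .seq (.ite_le hW ⟨saux 4, trivial⟩ (fun hb => ?_) fun hb => ?_)
  · have hlt : T < 0 := by
      by_contra hc
      exact hb (by simp only [aux, Expr.eval, BinOp.eval, h4, if_neg hc])
    refine .write_le hW trivial trivial (eval_lit _ _) (eval_lit _ _) (step2 _ ?_ rfl rfl ?_ ?_)
    · exact hW.set fun _ => (bitLen_pos 0).trans (hW.pos)
    · dsimp only; rw [Mem.set_self]; omega
    · intro a i ha; dsimp only; rw [Mem.set_apply, if_neg ha]
  · have hlt : ¬ T < 0 := by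
      intro hc
      simp only [aux, Expr.eval, BinOp.eval, h4, if_pos hc] at hb
      exact one_ne_zero hb
    exact .skip (step2 _ hW rfl rfl (by rw [h4]; omega) fun _ _ _ => rfl)

/-- One round is one unfolding of `descend`. The bounds `u < M ≤ 2 ^ P.coins n` keep all numbers
outside of array `3` within `X` bits between rounds. -/
theorem runs_sampleStep {s : Config} {k : ℕ} (hk : k < n) {y : Bits n} {M u : ℕ}
    (hS : SamplerState P C κ z X k y M u s.mem) (hX : LargeFor P C X) :
    let F := fourierSum (P.coefInt C κ z) P.deg
    Runs ω P.sampleStep s (P.sampleStepTime X) fun s' => ∃ b : Fin 2, ∃ M' u',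
      SamplerState P C κ z X (k + 1) (setBit y k b) M' u' s'.mem ∧
      s'.out = s.out ++ [((b : ℕ) : ℤ)] ∧
      descend F (n - k) k y M u = descend F (n - (k + 1)) (k + 1) (setBit y k b) M' u' := by
  intro F
  obtain ⟨x1, x2, x3, x4⟩ := hX
  have hnR : n ≤ P.coins n := by rw [SimParams.coins]; nlinarith
  have saux : ∀ i, (aux i).Scoped 0 := fun i => (scoped_read (by decide) (by decide)).2 trivial
  have s43 : (Expr.read 4 (.lit 3)).Scoped 0 := (scoped_read (by decide) (by decide)).2 trivial
  have hbitLen : ∀ a : ℕ, a ≤ 2 ^ P.coins n → bitLen (a : ℤ) ≤ X := fun a ha =>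
    (bitLen_le_of_le_two_pow ha).trans (by omega)
  set W := P.wideBound X with hW
  have hXW : X ≤ W := by rw [hW, SimParams.wideBound]; omega
  have hpow : (2 : ℕ) ^ (n - k) = 2 ^ (n - (k + 1)) * 2 := by
    rw [← pow_succ]; congr 1; omega
  have hpowle : (2 : ℕ) ^ (n - (k + 1)) ≤ 2 ^ P.coins n :=
    Nat.pow_le_pow_right (by decide) (by omega)
  have S1 := hS.base.set_active (v := k + 1) (by omega)
  refine .seq (.seq (.write_le (v := (k + 1 : ℕ)) hS.base.bits trivial ⟨s43, trivial⟩
    (eval_lit _ _) (by simp [Expr.eval, BinOp.eval, hS.active]) ?_))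
  refine .write_le (X := X) (v := (2 ^ (n - (k + 1)) : ℕ)) S1.bits trivial ⟨saux 3, trivial⟩
    (eval_lit _ _) ?_ ?_
  · have e : (s.mem.set 4 3 (k + 1 : ℕ)) 5 3 = (2 ^ (n - (k + 1)) * 2 : ℕ) := by
      rw [Mem.set_ne _ _ _ (by decide), hS.power, hpow]
    simp only [eval_div, aux, eval_read, eval_lit, e]
    push_cast
    exact Int.mul_ediv_cancel _ (by decide)
  have S2 := S1.set_five (i := 3) (hbitLen _ hpowle)
  set s1 : Config := { s with mem := (s.mem.set 4 3 (k + 1 : ℕ)).set 5 3 (2 ^ (n - (k + 1)) : ℕ) }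
    with hs1
  change SamplerBase P C κ z X s1.mem at S2
  -- The undecided bits of `y` are zero, so `y` itself stands for the branch with bit `0`.
  have hy0 : setBit y k 0 = y := setBit_zero_eq fun j hj => hS.zero j hj.ge
  have hR : Ready P s1.mem C κ z (k + 1) y := by
    refine ⟨S2.loaded, S2.qubits, S2.size, S2.samples, ?_, ?_, ?_⟩
    · simp [hs1, Mem.set_apply]
    · simp [hs1, Mem.set_apply, hS.scale]
    · intro j; simp [hs1, Mem.set_apply, hS.bit]
  have hT := hR.eval_enum_zero (show k + 1 ≤ n by omega) P.deg
  set T := marginal F (k + 1) y with hTdef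
  have hsc := SumExpr.scoped_enum P P.deg 0
  have hlen := SumExpr.bitLen_eval_le (X := X) _ hsc S2.bits S2.sizes
  refine .seq ((SumExpr.runs_compile _ hsc S2.bits S2.sizes).mono le_rfl ?_)
  rintro s2 ⟨hF2, hB2, hv2⟩
  rw [Nat.cast_zero] at hv2
  have a2 : ∀ a i, a ≠ 2 → a ≠ 3 → s2.mem a i = s1.mem a i := hF2.agree.1
  have p2 : s2.mem 5 3 = (2 ^ (n - (k + 1)) : ℕ) := by
    rw [a2 5 3 (by decide) (by decide)]; simp [hs1, Mem.set_apply]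
  have hTv : (aux 3 * .read 3 (.lit 0) : Expr).eval s2.mem = T := by
    rw [← hT]
    simp only [eval_mul, aux, eval_read, eval_lit, p2, hv2]
    push_cast; rfl
  have hTlen : bitLen T ≤ X + (SumExpr.enum P P.deg 0).lenBound X := by
    rw [← hTv, eval_mul]
    refine (bitLen_eval_le .mul _ _).trans (add_le_add ?_ ?_)
    · exact hB2 5 3 (by decide)
    · rw [eval_read, eval_lit, hv2]; exact hlen
  -- Expressions that read array `3` are not `Scoped`, so the cost is counted by hand.
  refine .seq (.write ?_ ?_)
  · have c1 := hB2 5 3 (by decide)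
    have c2 : bitLen ((aux 3 * .read 3 (.lit 0) : Expr).eval s2.mem) ≤ _ := hTv.symm ▸ hTlen
    have c3 : bitLen 3 = 3 := rfl
    have c4 : bitLen 4 = 4 := rfl
    have c5 : bitLen 0 = 1 := rfl
    change bitLen 4 + ((bitLen 3 + bitLen (s2.mem 5 3)) + (bitLen 0 + bitLen (s2.mem 3 0)) +
      bitLen ((aux 3 * .read 3 (.lit 0) : Expr).eval s2.mem)) + 1 ≤ _
    rw [hv2]
    rw [SimParams.wideBound]
    omega
  rw [hTv, eval_lit]
  have hB3 : (s2.mem.set 5 4 T).BitsLE W := (hB2.mono hXW).set fun _ => hTlen.trans (by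
    rw [hW, SimParams.wideBound]; omega)
  have e51 : s2.mem 5 1 = M := by
    rw [a2 5 1 (by decide) (by decide)]; simp [hs1, Mem.set_apply, hS.mass]
  refine runs_clamp hB3 (T := T) (M := M) (s2.mem.set_self 5 4 T) (by simp [Mem.set_apply, e51]) ?_
  intro s4 hB4 hp4 ho4 h44 e4
  set a := min T.toNat M with ha
  have haM : a ≤ M := min_le_right _ _
  have hmass : massZero F k y M = a := by rw [massZero, hy0]
  have e4' : ∀ b i, b ≠ 2 → b ≠ 3 → ¬ (b = 5 ∧ i = 4) → s4.mem b i = s1.mem b i :=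
    fun b i h2 h3 h => by
      rw [e4 b i h]; dsimp only; rw [Mem.set_apply, if_neg h, a2 b i h2 h3]
  -- After the cut-off, cell `4` is at most `M`, and the narrow bound holds again.
  have hB4' : s4.mem.BitsLE X := by
    intro b i hb
    by_cases h : b = 5 ∧ i = 4
    · obtain ⟨rfl, rfl⟩ := h
      rw [h44]; exact hbitLen _ (haM.trans hS.le)
    · rw [e4 b i h]; dsimp only; rw [Mem.set_apply, if_neg h]; exact hB2 b i hb
  have S4 : SamplerBase P C κ z X s4.mem :=
    S2.of_agree (fun b i hb => e4' b i (by omega) (by omega) (by omega)) hB4'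
  have f0 : s4.mem 5 0 = u := by
    rw [e4' 5 0 (by decide) (by decide) (by decide)]; simp [hs1, Mem.set_apply, hS.number]
  have f1 : s4.mem 5 1 = M := by
    rw [e4' 5 1 (by decide) (by decide) (by decide)]; simp [hs1, Mem.set_apply, hS.mass]
  have f2 : s4.mem 5 2 = P.scale n := by
    rw [e4' 5 2 (by decide) (by decide) (by decide)]; simp [hs1, Mem.set_apply, hS.scale]
  have f3 : s4.mem 5 3 = (2 ^ (n - (k + 1)) : ℕ) := by
    rw [e4' 5 3 (by decide) (by decide) (by decide)]; simp [hs1, Mem.set_apply]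
  have f43 : s4.mem 4 3 = (k + 1 : ℕ) := by
    rw [e4' 4 3 (by decide) (by decide) (by decide)]; simp [hs1, Mem.set_apply]
  have fb : ∀ j : Fin n, s4.mem 1 (j : ℕ) = (y j : ℕ) := fun j => by
    rw [e4' 1 _ (by decide) (by decide) (by omega)]; simp [hs1, Mem.set_apply, hS.bit]
  have sidx : bitIndex.Scoped 0 := ⟨s43, trivial⟩
  have vidx : ∀ μ : Mem, μ 4 3 = (k + 1 : ℕ) → bitIndex.eval μ = k := fun μ h => by
    simp [bitIndex, eval_sub, eval_read, eval_lit, h]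
  have hout : s4.out = s.out := ho4.trans hF2.out
  have sread : (Expr.read 1 bitIndex).Scoped 0 := (scoped_read (by decide) (by decide)).2 sidx
  have hdesc : ∀ b : Fin 2, descend F (n - k) k y M u = if u < a then
      descend F (n - (k + 1)) (k + 1) (setBit y k 0) a u
      else descend F (n - (k + 1)) (k + 1) (setBit y k 1) (M - a) (u - a) := fun b => by
    rw [show n - k = (n - (k + 1)) + 1 by omega, descend, hmass]
  have hM := hS.le
  have hu := hS.lt
  refine .seq (.ite_le hB4 ⟨saux 0, saux 4⟩ (fun hb => ?_) fun hb => ?_)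
  · have hlt : u < a := by
      by_contra hc
      refine hb ?_
      simp only [aux, Expr.eval, BinOp.eval, f0, h44, Nat.cast_lt, if_neg hc]
    refine .write_le hB4 trivial (saux 4) (eval_lit _ _) (v := a) h44 (.emit_le
      (v := ((0 : Fin 2) : ℕ)) ?_ sread ?_ ⟨0, a, u, ⟨?_, ?_, ?_, ?_, ?_, ?_, ?_, ?_, ?_, ?_⟩, ?_, ?_⟩)
    · exact hB4.set fun _ => (hbitLen _ (haM.trans hM)).trans hXW
    · rw [eval_read, vidx _ (by simp [Mem.set_apply, f43])]
      have := fb ⟨k, hk⟩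
      simp only [hS.zero ⟨k, hk⟩ le_rfl] at this
      simpa [Mem.set_apply] using this
    · exact S4.set_five (hbitLen _ (haM.trans hM))
    · simp [Mem.set_apply, f0]
    · simp [Mem.set_apply]
    · simp [Mem.set_apply, f2]
    · simp [Mem.set_apply, f3]
    · simp [Mem.set_apply, f43]
    · intro j; rw [hy0]; simp [Mem.set_apply, fb]
    · intro j hj; rw [hy0]; exact hS.zero j (by omega)
    · exact hlt
    · exact haM.trans hM
    · simp [hout]
    · rw [hdesc 0, if_pos hlt]
  · have hlt : ¬ u < a := by
      intro hc
      simp only [aux, Expr.eval, BinOp.eval, f0, h44, Nat.cast_lt, if_pos hc] at hb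
      exact one_ne_zero hb
    have hone : bitLen 1 ≤ X := by have : bitLen 1 = 2 := rfl; omega
    have b1 : bitLen ((u - a : ℕ) : ℤ) ≤ X := hbitLen _ (by omega)
    have b2 : bitLen ((M - a : ℕ) : ℤ) ≤ X := hbitLen _ (by omega)
    have T1 := S4.set_one (i := k) hone
    have T2 := T1.set_five (i := 0) b1
    have T3 := T2.set_five (i := 1) b2
    refine .seq (.write_le hB4 sidx trivial (vidx _ f43) (eval_lit _ _) (.seq (.write_le
      (v := (u - a : ℕ)) (T1.bits.mono hXW) trivial ⟨saux 0, saux 4⟩ (eval_lit _ _) ?_ (.write_le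
      (v := (M - a : ℕ)) (T2.bits.mono hXW) trivial ⟨saux 1, saux 4⟩ (eval_lit _ _) ?_ (.emit_le
      (v := ((1 : Fin 2) : ℕ)) (T3.bits.mono hXW) sread ?_
      ⟨1, M - a, u - a, ⟨T3, ?_, ?_, ?_, ?_, ?_, ?_, ?_, ?_, ?_⟩, ?_, ?_⟩)))))
    · simp [aux, eval_sub, eval_read, eval_lit, Mem.set_apply, f0, h44, Nat.cast_sub (not_lt.1 hlt)]
    · simp [aux, eval_sub, eval_read, eval_lit, Mem.set_apply, f1, h44, Nat.cast_sub haM]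
    · rw [eval_read, vidx _ (by simp [Mem.set_apply, f43])]
      simp [Mem.set_apply]
    · simp [Mem.set_apply]
    · simp [Mem.set_apply]
    · simp [Mem.set_apply, f2]
    · simp [Mem.set_apply, f3]
    · simp [Mem.set_apply, f43]
    · intro j
      by_cases hj : (j : ℕ) = k
      · simp [Mem.set_apply, setBit, hj]
      · simp [Mem.set_apply, setBit, hj, fb]
    · intro j hj; rw [setBit, if_neg (by omega)]; exact hS.zero j (by omega)
    · omega
    · omega
    · simp [hout]
    · rw [hdesc 1, if_neg hlt]

/-- The loop invariant says that `descend` from the root agrees with `descend` from the node reached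
so far. After `n` rounds nothing remains to be decided, and the prefix in the output is the whole
string. -/
theorem runs_sampler {s : Config} (hL : Loaded s.mem C κ z) (hX : LargeFor P C X)
    (hB : s.mem.BitsLE X) (h0 : ∀ a, a ≠ 0 → ∀ i, s.mem a i = 0) (hpos : s.pos = 0)
    (hout : s.out = []) :
    Runs ω P.sampler s (P.samplerTime X) fun s' => s'.out = bitList (descend
      (fourierSum (P.coefInt C κ z) P.deg) n 0 0 (2 ^ P.coins n) (coinNumber ω (P.coins n))) := by
  set F := fourierSum (P.coefInt C κ z) P.deg with hF
  have s43 : (Expr.read 4 (.lit 3)).Scoped 0 := (scoped_read (by decide) (by decide)).2 trivial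
  have sq : qubits.Scoped 0 := (scoped_read (by decide) (by decide)).2 trivial
  refine .seq ((runs_readSizes hL hX hB h0).mono le_rfl ?_)
  rintro s1 ⟨S1, p1, o1, a1, a3, a0, a5, a6, a43, ab⟩
  refine .seq ((runs_draw S1 hX (p1.trans hpos) a1 a0 a5).mono le_rfl ?_)
  rintro s2 ⟨S2, o2, b0, b1, b3, b6, b43, bb⟩
  refine .seq ((runs_powers S2 hX (b3.trans a3) (b6.trans a6)).mono le_rfl ?_)
  rintro s3 ⟨S3, o3, c0, c1, c3, c2, c43, cb⟩
  let Inv : ℕ → Config → Prop := fun k s' => ∃ (y : Bits n) (M u : ℕ),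
    SamplerState P C κ z X k y M u s'.mem ∧ s'.out = (bitList y).take k ∧
      descend F n 0 0 (2 ^ P.coins n) (coinNumber ω (P.coins n)) = descend F (n - k) k y M u
  refine (Runs.loop_le Inv hX.qubits.le (b := sampleCond) ⟨s43, sq⟩ ?_ ?_ ?_).mono le_rfl ?_
  · rintro k hk s' ⟨y, M, u, hS, -⟩
    refine ⟨hS.base.bits, ?_⟩
    simp only [sampleCond, Expr.qubits, Expr.eval, BinOp.eval, hS.active, hS.base.qubits,
      Nat.cast_lt]
  · rintro k hk s' ⟨y, M, u, hS, ho, hd⟩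
    refine (runs_sampleStep hk hS hX).mono le_rfl ?_
    rintro s'' ⟨b, M', u', hS', ho', hd'⟩
    exact ⟨_, M', u', hS', by rw [take_bitList_setBit y hk, ho', ho], hd.trans hd'⟩
  · refine ⟨0, 2 ^ P.coins n, coinNumber ω (P.coins n),
      ⟨S3, c0.trans b0, c1.trans b1, c2, by simpa using c3, ?_, ?_, fun _ _ => rfl,
        coinNumber_lt _ _, le_rfl⟩, ?_, rfl⟩
    · rw [c43, b43, a43]; rfl
    · intro j; rw [cb, bb, ab]; rfl
    · rw [o3, o2, o1, hout]; simp
  · rintro s' ⟨y, M, u, -, ho, hd⟩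
    rw [hd, ho, Nat.sub_self, descend, List.take_of_length_le (by simp [bitList])]

end Sampler

/-! ### The generator -/

theorem List.getD_flatMap {α : Type*} {f : α → List ℤ} {k : ℕ} (hf : ∀ a, (f a).length = k)
    (l : List α) {g r : ℕ} (hg : g < l.length) (hr : r < k) (u : List ℤ) :
    (l.flatMap f ++ u).getD (k * g + r) 0 = (f l[g]).getD r 0 := by
  induction l generalizing g with
  | nil => simp at hg
  | cons a l ih =>
      rw [List.flatMap_cons, List.append_assoc]
      cases g with
      | zero => rw [mul_zero, zero_add, List.getD_append _ _ _ _ (by rw [hf]; exact hr)]; rfl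
      | succ g =>
          rw [List.getD_append_right _ _ _ _ (by rw [hf, mul_add]; omega), hf,
            show k * (g + 1) + r - k = k * g + r by rw [mul_add]; omega]
          exact ih (by simpa using hg)

theorem List.length_flatMap_eq {α : Type*} {f : α → List ℤ} {k : ℕ} (hf : ∀ a, (f a).length = k)
    (l : List α) : (l.flatMap f).length = k * l.length := by
  simp [List.length_flatMap, hf, mul_comm]

theorem DiagGate.length_code {n : ℕ} (g : DiagGate n) : g.code.length = 4 := by cases g <;> rfl

theorem length_rateCode (κ : Option ℚ) : (rateCode κ).length = 3 := by cases κ <;> rfl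

namespace IQPCircuit

variable {n : ℕ} (C : IQPCircuit n) (κ : Fin n → Option ℚ)

theorem codeWithRates_eq : C.codeWithRates κ = (n : ℤ) :: (C.size : ℤ) ::
    (C.gates.flatMap DiagGate.code ++ (List.finRange n).flatMap fun j => rateCode (κ j)) := by
  rw [codeWithRates, code, List.flatMap_def (l := List.finRange n), List.ofFn_eq_map]; rfl

theorem length_codeWithRates : (C.codeWithRates κ).length = 2 + 4 * C.size + 3 * n := by
  rw [codeWithRates_eq, List.length_cons, List.length_cons, List.length_append,
    List.length_flatMap_eq DiagGate.length_code,
    List.length_flatMap_eq (fun j => length_rateCode (κ j)), List.length_finRange, size]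
  ring

theorem length_code_le : C.code.length ≤ 2 + 4 * C.size + 3 * n := by
  rw [code, List.length_cons, List.length_cons, List.length_flatMap_eq DiagGate.length_code, size]
  omega

/-- Absent entries are read as `0`, and `rateCode none` consists of zeros. A plain circuit code
therefore looks like one in which every rate is the minimum, and the same programs serve both kinds
of input. -/
theorem code_getD (i : ℕ) :
    C.code.getD i 0 = (C.codeWithRates fun _ => none).getD i 0 := by
  have h : ∀ i, ((List.ofFn fun _ : Fin n => rateCode none).flatten).getD i 0 = 0 := fun i => by
    rw [List.getD_eq_getElem?_getD]
    rcases h : ((List.ofFn fun _ : Fin n => rateCode none).flatten)[i]? with - | v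
    · rfl
    · have hv := List.mem_of_getElem? h
      simp [rateCode] at hv
      simp [hv.2]
  rw [codeWithRates]
  rcases lt_or_ge i C.code.length with hi | hi
  · rw [List.getD_append _ _ _ _ hi]
  · rw [List.getD_append_right _ _ _ _ hi, h, List.getD_eq_default _ _ hi]

theorem bitLen_le_of_mem {v : ℤ} {X : ℕ} (hv : v ∈ C.codeWithRates κ)
    (hX : n + C.size + ∑ j, rateBits (κ j) + 4 ≤ X) : bitLen v ≤ X := by
  have hnat : ∀ a : ℕ, a < X → bitLen (a : ℤ) ≤ X := fun a ha => SumExpr.bitLen_natCast_le ha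
  rw [codeWithRates_eq] at hv
  simp only [List.mem_cons, List.mem_append, List.mem_flatMap, List.mem_finRange, true_and] at hv
  rcases hv with rfl | rfl | ⟨g, -, hg⟩ | ⟨j, hj⟩
  · exact hnat _ (by omega)
  · exact hnat _ (by omega)
  · have hq : ∀ i : Fin n, bitLen ((i : ℕ) : ℤ) ≤ X := fun i => hnat _ (by omega)
    have h0 : bitLen 0 ≤ X := hnat 0 (by omega)
    have h1 : bitLen 1 ≤ X := hnat 1 (by omega)
    have h2 : bitLen 2 ≤ X := hnat 2 (by omega)
    have h3 : bitLen 3 ≤ X := hnat 3 (by omega)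
    cases g <;> simp only [DiagGate.code, List.mem_cons, List.not_mem_nil, or_false] at hg <;>
      rcases hg with rfl | rfl | rfl | rfl <;> first | assumption | exact hq _
  · have hb := Finset.single_le_sum (fun i _ => Nat.zero_le (rateBits (κ i))) (Finset.mem_univ j)
    have h0 : bitLen 0 ≤ X := hnat 0 (by omega)
    have h1 : bitLen 1 ≤ X := hnat 1 (by omega)
    rcases hκ : κ j with - | q
    · rw [hκ] at hj
      simp only [rateCode, List.mem_cons, List.not_mem_nil, or_false, or_self] at hj
      rw [hj]; exact h0
    · rw [hκ] at hj
      have hb' : rateBits (some q) ≤ _ := hκ ▸ hb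
      rw [rateBits] at hb'
      simp only [rateCode, List.mem_cons, List.not_mem_nil, or_false] at hj
      rcases hj with rfl | rfl | rfl
      · exact h1
      · omega
      · omega

theorem mem_code {v : ℤ} (hv : v ∈ C.code) : v ∈ C.codeWithRates κ :=
  List.mem_append_left _ hv

end IQPCircuit

theorem startConfig_mem_zero (x : List ℤ) (i : ℕ) :
    (startConfig x).mem 0 (i + 1 : ℕ) = x.getD i 0 := by
  have h1 : ((i + 1 : ℕ) : ℤ) ≠ 0 := by omega
  have h2 : 0 < ((i + 1 : ℕ) : ℤ) := by omega
  simp only [startConfig, if_true, if_neg h1, if_pos h2, Int.toNat_natCast, Nat.add_sub_cancel]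

theorem bitsLE_startConfig {x : List ℤ} {X : ℕ} (hX : x.length < X)
    (h : ∀ v ∈ x, bitLen v ≤ X) : (startConfig x).mem.BitsLE X := by
  have h0 : bitLen 0 ≤ X := SumExpr.bitLen_natCast_le (i := 0) (by omega)
  intro a i _
  simp only [startConfig]
  split_ifs
  · exact SumExpr.bitLen_natCast_le hX
  · rw [List.getD_eq_getElem?_getD]
    rcases hv : x[i.toNat - 1]? with - | v
    · exact h0
    · exact h v (List.mem_of_getElem? hv)
  · exact h0
  · exact h0

def coinInt (ω : ℕ → Bool) (i : ℕ) : ℤ := if ω i then 1 else 0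

/-- The bit strings with the given coins as bits. -/
def coinBits (ω : ℕ → Bool) (n N : ℕ) (i : Fin N) : Bits n :=
  fun q => if ω (i * n + q) then 1 else 0

/-- The output of the generator: the circuit, the rates, and coins. -/
def description {n : ℕ} (C : IQPCircuit n) (κ : Fin n → Option ℚ) (ω : ℕ → Bool) (N : ℕ) :
    List ℤ :=
  C.codeWithRates κ ++ (List.range (N * n)).map (coinInt ω)

/-- Entry `i` of the input sits in cell `i + 1`, and two header entries precede the gates; hence the
offset `3` in all addresses. -/
theorem loaded_description {n : ℕ} (C : IQPCircuit n) (κ : Fin n → Option ℚ) (ω : ℕ → Bool)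
    (N : ℕ) : Loaded (startConfig (description C κ ω N)).mem C κ (coinBits ω n N) := by
  have e := startConfig_mem_zero (description C κ ω N)
  have hd : description C κ ω N = (n : ℤ) :: (C.size : ℤ) ::
    (C.gates.flatMap DiagGate.code ++ ((List.finRange n).flatMap (fun j => rateCode (κ j)) ++
      (List.range (N * n)).map (coinInt ω))) := by
    rw [description, C.codeWithRates_eq]; simp
  have hg := List.length_flatMap_eq (DiagGate.length_code (n := n)) C.gates
  refine ⟨?_, ?_, fun g hg' r hr => ?_, fun j r hr => ?_, fun i q => ?_⟩
  · have := e 0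
    rw [hd] at this
    rw [hd]; exact this
  · have := e 1
    rw [hd] at this
    rw [hd]; exact this
  · have := e (4 * g + r + 1 + 1)
    rw [show (3 + 4 * (g : ℤ) + (r : ℤ)) = (4 * g + r + 1 + 1 + 1 : ℕ) by push_cast; ring, this, hd,
      List.getD_cons_succ, List.getD_cons_succ, List.getD_flatMap DiagGate.length_code _ hg' hr]
  · have := e (4 * C.size + (3 * j + r) + 1 + 1)
    rw [show (3 + 4 * (C.size : ℤ) + 3 * ((j : ℕ) : ℤ) + (r : ℤ)) =
        (4 * C.size + (3 * j + r) + 1 + 1 + 1 : ℕ) by push_cast; ring, this, hd,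
      List.getD_cons_succ, List.getD_cons_succ,
      List.getD_append_right _ _ _ _ (by rw [hg, IQPCircuit.size]; omega), hg, IQPCircuit.size,
      Nat.add_sub_cancel_left,
      List.getD_flatMap (fun j => length_rateCode (κ j)) _ (by simp) hr]
    simp
  · have hlt : (i : ℕ) * n + q < N * n := by
      have := i.2; have := q.2
      calc (i : ℕ) * n + q < i * n + n := by omega
        _ = (i + 1) * n := by ring
        _ ≤ N * n := Nat.mul_le_mul_right _ i.2
    have := e ((C.codeWithRates κ).length + (i * n + q))
    rw [show (3 + 4 * (C.size : ℤ) + 3 * (n : ℤ) + ((i : ℕ) : ℤ) * n + ((q : ℕ) : ℤ)) =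
        ((C.codeWithRates κ).length + (i * n + q) + 1 : ℕ) by
          rw [C.length_codeWithRates]; push_cast; ring, this, description,
      List.getD_append_right _ _ _ _ (Nat.le_add_right _ _), Nat.add_sub_cancel_left,
      List.getD_eq_getElem _ _ (by simpa using hlt)]
    simp only [List.getElem_map, List.getElem_range, coinInt, coinBits]
    split <;> rfl

namespace SimParams

open Expr

variable (P : SimParams)

def generatorSizes : Prog :=
  .seq (.write 4 (.lit 0) (.read 0 (.lit 1))) (.seq (.write 4 (.lit 1) (.read 0 (.lit 2)))
  (.seq (.write 4 (.lit 2) (.lit 2 + .lit 4 * gateCount + .lit 3 * qubits))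
  (.write 4 (.lit 4) (.lit P.reps * (qubits + .lit 1).pow (2 * P.deg + 1) * qubits))))

def copyStep : Prog :=
  .seq (.write 4 (.lit 3) (.read 4 (.lit 3) + .lit 1)) (.emit (.read 0 (.read 4 (.lit 3))))

def coinStep : Prog :=
  .seq (.flip 5 (.lit 0)) (.seq (.emit (.read 5 (.lit 0)))
    (.write 4 (.lit 5) (.read 4 (.lit 5) + .lit 1)))

/-- Copies the input and appends coins. -/
def generator : Prog :=
  .seq P.generatorSizes (.seq (.loop (.bin .lt (.read 4 (.lit 3)) (.read 4 (.lit 2))) copyStep)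
    (.loop (.bin .lt (.read 4 (.lit 5)) (.read 4 (.lit 4))) coinStep))

/-- About `x` only its entries with default `0` are assumed, so copying a fixed number of cells
completes a plain code by zero rates. No estimation takes place here: the appended coins are the
sampled strings themselves. -/
theorem runs_generator {n : ℕ} {C : IQPCircuit n} {κ : Fin n → Option ℚ} {ω : ℕ → Bool} {X : ℕ}
    {x : List ℤ} (hx : ∀ i, x.getD i 0 = (C.codeWithRates κ).getD i 0)
    (hB : (startConfig x).mem.BitsLE X)
    (hX : 2 + 4 * C.size + 3 * n + P.samples n * n + 3 ≤ X) :
    Runs ω P.generator (startConfig x) (P.generator.time X) fun s' =>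
      s'.out = description C κ ω (P.samples n) := by
  have hX2 : bitLen 1 ≤ X ∧ bitLen 0 ≤ X := by
    have h1 : bitLen 1 = 2 := rfl
    have h0 : bitLen 0 = 1 := rfl
    omega
  set N := P.samples n with hN
  set L := 2 + 4 * C.size + 3 * n with hL
  have hnat : ∀ a : ℕ, a < X → bitLen (a : ℤ) ≤ X := fun a ha => SumExpr.bitLen_natCast_le ha
  have s4 : ∀ i, (Expr.read 4 (.lit i)).Scoped 0 := fun i =>
    (scoped_read (by decide) (by decide)).2 trivial
  have s0 : ∀ i, (Expr.read 0 (.lit i)).Scoped 0 := fun i =>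
    (scoped_read (by decide) (by decide)).2 trivial
  have sq : qubits.Scoped 0 := s4 0
  have sg : gateCount.Scoped 0 := s4 1
  have q1 : (qubits + .lit 1).Scoped 0 := ⟨sq, trivial⟩
  have c1 : (startConfig x).mem 0 1 = n := by
    have := startConfig_mem_zero x 0
    rw [hx, C.codeWithRates_eq] at this
    exact this
  have c2 : (startConfig x).mem 0 2 = C.size := by
    have := startConfig_mem_zero x 1
    rw [hx, C.codeWithRates_eq] at this
    exact this
  have z4 : ∀ i, (startConfig x).mem 4 i = 0 := fun i => rfl
  have cell : ∀ i : ℕ, i < L → (startConfig x).mem 0 (i + 1 : ℕ) = (C.codeWithRates κ).getD i 0 :=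
    fun i _ => by rw [startConfig_mem_zero, hx]
  set s := startConfig x with hs
  have hpos : s.pos = 0 := rfl
  have hout : s.out = [] := rfl
  clear_value s
  have eN : (P.reps : ℤ) * ((n : ℤ) + 1) ^ (2 * P.deg + 1) = (N : ℕ) := by
    simp [hN, SimParams.samples]
  have bn : bitLen (n : ℤ) ≤ X := hnat _ (by omega)
  have bm : bitLen (C.size : ℤ) ≤ X := hnat _ (by omega)
  have bL : bitLen (L : ℤ) ≤ X := hnat _ (by omega)
  have bN : bitLen ((N * n : ℕ) : ℤ) ≤ X := hnat _ (by omega)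
  refine .seq ?_
  refine .seq (.write_le hB trivial (s0 1) (eval_lit _ _) c1 ?_)
  refine .seq (.write_le (X := X) (v := C.size) (hB.set fun _ => bn) trivial (s0 2) (eval_lit _ _)
    (by simp [Expr.eval, Mem.set_apply, c2]) ?_)
  refine .seq (.write_le (X := X) (v := L) ((hB.set fun _ => bn).set fun _ => bm) trivial
    ⟨⟨trivial, trivial, sg⟩, trivial, sq⟩ (eval_lit _ _) (by
      simp [eval_add, eval_mul, eval_read, eval_lit, gateCount, qubits, Mem.set_apply, hL]) ?_)
  refine .write_le (X := X) (v := (N * n : ℕ))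
    (((hB.set fun _ => bn).set fun _ => bm).set fun _ => bL) trivial
    ⟨⟨trivial, scoped_pow q1 _⟩, sq⟩ (eval_lit _ _) (by
      rw [Nat.cast_mul, ← eN]
      simp [eval_pow, eval_add, eval_mul, eval_read, eval_lit, qubits, Mem.set_apply]) ?_
  have hB1 := (((hB.set (a := 4) (i := 0) fun _ => bn).set (a := 4) (i := 1) fun _ => bm).set
    (a := 4) (i := 2) fun _ => bL).set (a := 4) (i := 4) fun _ => bN
  let Inv1 : ℕ → Config → Prop := fun i s' => s'.mem.BitsLE X ∧ s'.mem 0 = s.mem 0 ∧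
    s'.mem 4 2 = L ∧ s'.mem 4 3 = i ∧ s'.mem 4 4 = (N * n : ℕ) ∧ s'.mem 4 5 = 0 ∧ s'.pos = 0 ∧
    s'.out = (C.codeWithRates κ).take i
  refine .seq ((Runs.loop_le Inv1 (N := L) (by omega)
    (b := .bin .lt (.read 4 (.lit 3)) (.read 4 (.lit 2))) ⟨s4 3, s4 2⟩ ?_ ?_ ?_).mono
    le_rfl ?_)
  · rintro i hi s' ⟨hB', -, e2, e3, -⟩
    exact ⟨hB', by simp only [Expr.eval, BinOp.eval, e2, e3, Nat.cast_lt]⟩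
  · rintro i hi s' ⟨hB', e0, e2, e3, e4, e5, ep, eo⟩
    have hB2 := hB'.set (a := 4) (i := 3) fun _ => hnat (i + 1) (by omega)
    refine .seq (.write_le (v := (i + 1 : ℕ)) hB' trivial ⟨s4 3, trivial⟩ (eval_lit _ _)
      (by simp [eval_add, eval_read, eval_lit, e3]) ?_)
    refine .emit_le (v := (C.codeWithRates κ).getD i 0) hB2
      ((scoped_read (by decide) (by decide)).2 (s4 3)) ?_ ?_
    · rw [← cell i hi, ← e0]
      simp [eval_read, eval_lit, Mem.set_apply]
    · refine ⟨hB2, ?_, ?_, ?_, ?_, ?_, ep, ?_⟩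
      · simp [Mem.set_ne, e0]
      · simp [Mem.set_apply, e2]
      · simp [Mem.set_apply]
      · simp [Mem.set_apply, e4]
      · simp [Mem.set_apply, e5]
      · have hlen : i < (C.codeWithRates κ).length := by rw [C.length_codeWithRates]; exact hi
        rw [List.take_succ_eq_append_getElem hlen, ← eo, List.getD_eq_getElem _ _ hlen]
  · refine ⟨hB1, ?_, ?_, ?_, ?_, ?_, hpos, by simp [hout]⟩
    · simp [Mem.set_ne]
    all_goals simp [Mem.set_apply, z4]
  rintro s1 ⟨hB', -, -, -, e4, e5, ep, eo⟩
  let Inv2 : ℕ → Config → Prop := fun i s' => s'.mem.BitsLE X ∧ s'.mem 4 4 = (N * n : ℕ) ∧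
    s'.mem 4 5 = i ∧ s'.pos = i ∧
    s'.out = C.codeWithRates κ ++ (List.range i).map (coinInt ω)
  refine (Runs.loop_le Inv2 (N := N * n) (by omega)
    (b := .bin .lt (.read 4 (.lit 5)) (.read 4 (.lit 4))) ⟨s4 5, s4 4⟩ ?_ ?_ ?_).mono le_rfl ?_
  · rintro i hi s' ⟨hB', e4, e5, -⟩
    exact ⟨hB', by simp only [Expr.eval, BinOp.eval, e4, e5, Nat.cast_lt]⟩
  · rintro i hi s' ⟨hB', e4, e5, ep, eo⟩
    have b1 : bitLen (if ω i = true then 1 else 0) ≤ X := by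
      split
      · exact hX2.1
      · exact hX2.2
    have hB2 := hB'.set (a := 5) (i := 0) fun _ => b1
    refine .seq (.flip_le hB' trivial (eval_lit _ _) ?_)
    rw [ep]
    refine .seq (.emit_le (v := coinInt ω i) hB2 ((scoped_read (by decide) (by decide)).2 trivial)
      (by simp [eval_read, eval_lit, Mem.set_apply, coinInt]) ?_)
    refine .write_le (v := (i + 1 : ℕ)) hB2 trivial ⟨s4 5, trivial⟩ (eval_lit _ _)
      (by simp [eval_add, eval_read, eval_lit, Mem.set_apply, e5]) ?_
    refine ⟨hB2.set fun _ => hnat _ (by omega), ?_, ?_, rfl, ?_⟩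
    · simp [Mem.set_apply, e4]
    · simp [Mem.set_apply]
    · simp [eo, List.range_succ]
  · refine ⟨hB', e4, e5, ep, ?_⟩
    rw [eo, List.take_of_length_le (by rw [C.length_codeWithRates])]; simp
  · rintro s' ⟨-, -, -, -, h⟩
    exact h

end SimParams

/-! ### Probabilities of coin events -/

/-- A finite sequence of coins, extended by `false`. -/
def coinSeq {T : ℕ} (r : Fin T → Bool) : ℕ → Bool :=
  fun i => if h : i < T then r ⟨i, h⟩ else false

/-- An event that depends only on the first coins. -/
theorem coinProb_eq {R T : ℕ} (h : R ≤ T) {E : (ℕ → Bool) → Prop}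
    (hE : ∀ ω ω' : ℕ → Bool, (∀ i < R, ω i = ω' i) → (E ω ↔ E ω')) :
    coinProb T (fun r => E (coinSeq r)) =
      (Set.ncard {r : Fin R → Bool | E (coinSeq r)} : ℝ) / 2 ^ R := by
  obtain ⟨e, rfl⟩ := Nat.exists_eq_add_of_le h
  have himg : {r : Fin (R + e) → Bool | E (coinSeq r)} =
      Fin.appendEquiv R e '' ({r : Fin R → Bool | E (coinSeq r)} ×ˢ Set.univ) := by
    rw [Equiv.image_eq_preimage_symm]
    ext r
    obtain ⟨⟨a, b⟩, rfl⟩ := (Fin.appendEquiv (α := Bool) R e).surjective r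
    simp only [Set.mem_ofPred_eq, Set.mem_preimage, Equiv.symm_apply_apply, Set.mem_prod,
      Set.mem_univ, and_true]
    refine hE _ _ fun i hi => ?_
    rw [coinSeq, dif_pos (show i < R + e by omega), coinSeq, dif_pos hi]
    exact Fin.append_left a b ⟨i, hi⟩
  rw [coinProb, himg, Set.ncard_image_of_injective _ (Equiv.injective _), Set.ncard_prod,
    Set.ncard_univ, Nat.card_eq_fintype_card, pow_add]
  simp only [Fintype.card_fun, Fintype.card_bool, Fintype.card_fin]
  push_cast
  exact mul_div_mul_right _ _ (by positivity)

theorem coinProb_mono {T : ℕ} {E F : (Fin T → Bool) → Prop} (h : ∀ r, E r → F r) :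
    coinProb T E ≤ coinProb T F := by
  refine div_le_div_of_nonneg_right ?_ (by positivity)
  exact_mod_cast Set.ncard_le_ncard (fun r hr => h r hr) (Set.toFinite _)

theorem coinProb_not (T : ℕ) (E : (Fin T → Bool) → Prop) :
    coinProb T (fun r => ¬ E r) = 1 - coinProb T E := by
  have h := Set.ncard_add_ncard_compl {r | E r}
  rw [Nat.card_eq_fintype_card] at h
  simp only [Fintype.card_fun, Fintype.card_bool, Fintype.card_fin] at h
  rw [coinProb, coinProb, eq_sub_iff_add_eq, ← add_div, div_eq_one_iff_eq (by positivity), add_comm]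
  exact_mod_cast h

theorem coinNumber_coinSeq {R : ℕ} (r : Fin R → Bool) : coinNumber (coinSeq r) R =
    (finFunctionFinEquiv (fun i => finTwoEquiv.symm (r i)) : ℕ) := by
  rw [finFunctionFinEquiv_apply, coinNumber, Finset.sum_range]
  refine Finset.sum_congr rfl fun i _ => ?_
  rw [coinSeq, dif_pos i.2]
  cases r i <;> simp [finTwoEquiv]

theorem coinNumber_congr {R : ℕ} {ω ω' : ℕ → Bool} (h : ∀ i < R, ω i = ω' i) :
    coinNumber ω R = coinNumber ω' R :=
  Finset.sum_congr rfl fun i hi => by rw [h i (Finset.mem_range.1 hi)]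

/-- The number with the coins as digits is uniformly distributed. -/
theorem ncard_coinNumber {R : ℕ} (E : ℕ → Prop) [DecidablePred E] :
    Set.ncard {r : Fin R → Bool | E (coinNumber (coinSeq r) R)} =
      ((Finset.range (2 ^ R)).filter E).card := by
  let e : (Fin R → Bool) ≃ Fin (2 ^ R) :=
    (Equiv.piCongrRight fun _ => finTwoEquiv.symm).trans finFunctionFinEquiv
  have he : ∀ r, (e r : ℕ) = coinNumber (coinSeq r) R := fun r => (coinNumber_coinSeq r).symm
  rw [← Set.ncard_coe_finset]
  refine Set.ncard_congr (fun r _ => (e r : ℕ)) (fun r hr => ?_) (fun r r' _ _ h => ?_)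
    fun u hu => ?_
  · simp only [Finset.coe_filter, Finset.mem_range, Set.mem_ofPred_eq]
    exact ⟨(e r).2, by rw [he]; exact hr⟩
  · exact e.injective (Fin.ext h)
  · simp only [Finset.coe_filter, Finset.mem_range, Set.mem_ofPred_eq] at hu
    refine ⟨e.symm ⟨u, hu.1⟩, ?_, by simp⟩
    simp only [Set.mem_ofPred_eq]
    rw [← he]; simpa using hu.2

theorem coinBits_congr {n N : ℕ} {ω ω' : ℕ → Bool} (h : ∀ i < N * n, ω i = ω' i) :
    coinBits ω n N = coinBits ω' n N := by
  ext i q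
  have : (i : ℕ) * n + q < N * n := by
    have := q.2
    calc (i : ℕ) * n + q < (i + 1) * n := by rw [add_mul]; omega
      _ ≤ N * n := Nat.mul_le_mul_right _ i.2
  rw [coinBits, coinBits, h _ this]

/-- The strings with the coins as bits are independent and uniformly distributed. -/
theorem ncard_coinBits {n N : ℕ} (E : (Fin N → Bits n) → Prop) :
    Set.ncard {r : Fin (N * n) → Bool | E (coinBits (coinSeq r) n N)} =
      Set.ncard {z : Fin N → Bits n | E z} := by
  let e : (Fin (N * n) → Bool) ≃ (Fin N → Bits n) :=
    ((Equiv.arrowCongr finProdFinEquiv.symm finTwoEquiv.symm)).trans (Equiv.curry _ _ _)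
  have he : ∀ r, e r = coinBits (coinSeq r) n N := fun r => by
    ext i q
    have h : (i : ℕ) * n + q = (finProdFinEquiv (i, q) : ℕ) := by
      simp [finProdFinEquiv]; ring
    rw [coinBits, coinSeq, h, dif_pos (Fin.is_lt _)]
    simp only [e, Equiv.trans_apply, Equiv.curry_apply, Function.curry, Equiv.arrowCongr_apply,
      Function.comp, Equiv.symm_symm]
    cases r (finProdFinEquiv (i, q)) <;> simp [finTwoEquiv]
  refine Set.ncard_congr (fun r _ => e r) (fun r hr => ?_) (fun r r' _ _ h => e.injective h)
    fun z hz => ⟨e.symm z, ?_, by simp⟩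
  · simp only [Set.mem_ofPred_eq, he]; exact hr
  · simp only [Set.mem_ofPred_eq, ← he]; simpa using hz

theorem bitList_injective {n : ℕ} : Function.Injective (bitList (n := n)) := fun x y h => by
  have := List.ofFn_injective h
  ext j
  exact_mod_cast congr_fun this j

/-! ### The distribution of the samples -/

namespace SimParams

variable (P : SimParams) {n : ℕ} (C : IQPCircuit n) (κ : Fin n → Option ℚ)

/-- The distribution from which the sampler draws. -/
noncomputable def drawDist (z : Fin (P.samples n) → Bits n) (x : Bits n) : ℝ :=
  descendCount (fourierSum (P.coefInt C κ z) P.deg) n 0 0 (2 ^ P.coins n) x / 2 ^ P.coins n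

/-- A bound for all numbers that occur on inputs with `L` bits. -/
def bound (L : ℕ) : ℕ := P.coins L + P.samples L * (L + 1) + 7 * L + 20

theorem polyBounded_bound : PolyBounded P.bound := by
  have h1 : PolyBounded fun L => P.coins L :=
    (PolyBounded.id.mul (.const _)).add (.const _)
  have h2 : PolyBounded fun L => P.samples L :=
    (PolyBounded.const _).mul ((PolyBounded.id.add (.const 1)).pow _)
  exact ((h1.add (h2.mul (PolyBounded.id.add (.const 1)))).add
    ((PolyBounded.const 7).mul .id)).add (.const 20)

theorem samples_mono {n L : ℕ} (h : n ≤ L) : P.samples n ≤ P.samples L :=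
  Nat.mul_le_mul_left _ (Nat.pow_le_pow_left (by omega) _)

theorem coins_mono {n L : ℕ} (h : n ≤ L) : P.coins n ≤ P.coins L :=
  Nat.add_le_add_right (Nat.mul_le_mul_right _ h) _

variable {C κ}

/-- By determinism each coin sequence yields exactly one string. The probability of `x` is then the
fraction of integers below `2 ^ P.coins n` that `descend` sends to `x`, without rounding; further
coins play no role. -/
theorem samplesWithin {ω : ℕ → Bool} {X T : ℕ} (hX : LargeFor P C X)
    (hB : (startConfig (description C κ ω (P.samples n))).mem.BitsLE X)
    (hT : P.samplerTime X ≤ T) (hR : P.coins n ≤ T) :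
    SamplesWithin P.sampler (description C κ ω (P.samples n)) T
      (P.drawDist C κ (coinBits ω n (P.samples n))) := by
  set z := coinBits ω n (P.samples n)
  set F := fourierSum (P.coefInt C κ z) P.deg with hF
  set w := description C κ ω (P.samples n)
  have hrun : ∀ r : Fin T → Bool, HaltsWith P.sampler w T r (bitList
      (descend F n 0 0 (2 ^ P.coins n) (coinNumber (coinSeq r) (P.coins n)))) := fun r => by
    obtain ⟨t, s, ht, he, hs⟩ := runs_sampler (ω := coinSeq r)
      (loaded_description C κ ω (P.samples n)) hX hB (fun a ha i => if_neg ha) rfl rfl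
    exact ⟨t, s, ht.trans hT, he, hs⟩
  have hiff : ∀ (r : Fin T → Bool) x, HaltsWith P.sampler w T r (bitList x) ↔
      descend F n 0 0 (2 ^ P.coins n) (coinNumber (coinSeq r) (P.coins n)) = x := fun r x => by
    refine ⟨?_, fun h => h ▸ hrun r⟩
    rintro ⟨t, s, -, he, hs⟩
    obtain ⟨t', s', -, he', hs'⟩ := hrun r
    rw [(he.deterministic he').2, hs'] at hs
    exact bitList_injective hs
  refine ⟨fun x => by rw [drawDist]; positivity, ?_, fun r => ⟨_, hrun r⟩, fun x => ?_⟩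
  · simp only [drawDist]
    rw [← Finset.sum_div, div_eq_one_iff_eq (by positivity)]
    have := Finset.card_eq_sum_card_fiberwise (s := Finset.range (2 ^ P.coins n))
      (f := fun u => descend F n 0 0 (2 ^ P.coins n) u) (t := Finset.univ) (fun _ _ => by simp)
    rw [Finset.card_range] at this
    exact_mod_cast this.symm
  · have hE := coinProb_eq hR (E := fun ω => descend F n 0 0 (2 ^ P.coins n)
      (coinNumber ω (P.coins n)) = x) fun ω ω' h => by rw [coinNumber_congr h]
    rw [show (fun r => HaltsWith P.sampler w T r (bitList x)) = fun r : Fin T → Bool =>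
      descend F n 0 0 (2 ^ P.coins n) (coinNumber (coinSeq r) (P.coins n)) = x from
      funext fun r => propext (hiff r x), hE, drawDist,
      ncard_coinNumber (fun u => descend F n 0 0 (2 ^ P.coins n) u = x)]
    rfl

/-- The list `x` describes `C` and `κ`. -/
structure Describes (x : List ℤ) (C : IQPCircuit n) (κ : Fin n → Option ℚ) : Prop where
  entry : ∀ i, x.getD i 0 = (C.codeWithRates κ).getD i 0
  length : x.length ≤ 2 + 4 * C.size + 3 * n
  mem : ∀ v ∈ x, v ∈ C.codeWithRates κ

theorem describes_code (C : IQPCircuit n) : Describes C.code C fun _ => none :=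
  ⟨C.code_getD, C.length_code_le, fun _ => C.mem_code _⟩

theorem describes_codeWithRates (C : IQPCircuit n) (κ : Fin n → Option ℚ) :
    Describes (C.codeWithRates κ) C κ :=
  ⟨fun _ => rfl, (C.length_codeWithRates κ).le, fun _ => id⟩

/-- Sizes and loop lengths are controlled by `P.bound L`, in which the running times are polynomial.
The polynomial dominates the sum of `P.bound` and both times, so it also provides enough coins for
either program. -/
theorem exists_polynomial : ∃ Q : Polynomial ℕ, ∀ {n : ℕ} {C : IQPCircuit n}
    {κ : Fin n → Option ℚ} {x : List ℤ}, Describes x C κ →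
    ∀ L, n + C.size + ∑ j, rateBits (κ j) = L → P.samples n * n ≤ Q.eval L ∧
      ∀ r : Fin (Q.eval L) → Bool, ∃ w, HaltsWith P.generator x (Q.eval L) r w ∧
        SamplesWithin P.sampler w (Q.eval L)
          (P.drawDist C κ (coinBits (coinSeq r) n (P.samples n))) := by
  obtain ⟨Q, hQ⟩ := P.polyBounded_bound.add ((P.generator.polyBounded_time.add
    P.polyBounded_samplerTime).comp P.polyBounded_bound)
  refine ⟨Q, fun {n C κ x} hx L hL => ?_⟩
  have hQL : P.bound L + (P.generator.time (P.bound L) + P.samplerTime (P.bound L)) ≤ Q.eval L :=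
    hQ L
  set X := P.bound L with hXdef
  have hS := P.samples_mono (show n ≤ L by omega)
  have hc := P.coins_mono (show n ≤ L by omega)
  have hSn : P.samples n * n + P.samples n ≤ P.samples L * (L + 1) := by
    calc P.samples n * n + P.samples n = P.samples n * (n + 1) := by ring
      _ ≤ _ := Nat.mul_le_mul hS (by omega)
  have hX : P.coins n + P.samples n * n + P.samples n + 7 * L + 20 ≤ X := by
    rw [hXdef, bound]; omega
  refine ⟨by omega, fun r => ?_⟩
  have hbits : ∀ v ∈ C.codeWithRates κ, bitLen v ≤ X := fun v hv =>
    C.bitLen_le_of_mem κ hv (by omega)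
  have hlen := hx.length
  have hBx : (startConfig x).mem.BitsLE X :=
    bitsLE_startConfig (by omega) fun v hv => hbits v (hx.mem v hv)
  obtain ⟨t, s, ht, he, hs⟩ := runs_generator P (ω := coinSeq r) hx.entry hBx (by omega)
  refine ⟨_, ⟨t, s, by omega, he, hs⟩, P.samplesWithin (X := X)
    ⟨by omega, by omega, by omega, by omega⟩ (bitsLE_startConfig ?_ ?_) (by omega) (by omega)⟩
  · rw [description, List.length_append, C.length_codeWithRates, List.length_map,
      List.length_range]
    omega
  · intro v hv
    rw [description, List.mem_append, List.mem_map] at hv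
    rcases hv with hv | ⟨i, -, rfl⟩
    · exact hbits v hv
    · have h1 : bitLen 1 = 2 := rfl
      have h0 : bitLen 0 = 1 := rfl
      rw [coinInt]; split <;> omega

/-- Reduces the probability of closeness to counting tuples of strings. -/
theorem le_closeProb {x : List ℤ} {T : ℕ} (hN : P.samples n * n ≤ T)
    (h : ∀ r : Fin T → Bool, ∃ w, HaltsWith P.generator x T r w ∧
      SamplesWithin P.sampler w T (P.drawDist C κ (coinBits (coinSeq r) n (P.samples n))))
    (p : Bits n → ℝ) (η : ℝ) :
    1 - (Set.ncard {z | ¬ l1Dist p (P.drawDist C κ z) ≤ η} : ℝ) / (2 ^ n) ^ P.samples n ≤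
      closeProb P.generator P.sampler x T p η := by
  have h1 := coinProb_eq hN
    (E := fun ω => ¬ l1Dist p (P.drawDist C κ (coinBits ω n (P.samples n))) ≤ η)
    fun ω ω' h => by rw [coinBits_congr h]
  rw [coinProb_not, ncard_coinBits fun z => ¬ l1Dist p (P.drawDist C κ z) ≤ η] at h1
  rw [← pow_mul, mul_comm n, ← h1, sub_sub_cancel]
  refine coinProb_mono fun r hr => ?_
  obtain ⟨w, hw, hs⟩ := h r
  exact ⟨w, _, hw, hs, hr⟩

end SimParams

/-! ### The error of the simulation -/

theorem bitWeight_div {n : ℕ} (a b : Fin n → ℝ) (s : Bits n) :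
    bitWeight (fun j => a j / b j) s = bitWeight a s / bitWeight b s := by
  rw [bitWeight, bitWeight, bitWeight, ← Finset.prod_div_distrib]
  refine Finset.prod_congr rfl fun j _ => ?_
  split <;> simp

theorem intCast_bitWeight {n : ℕ} (a : Fin n → ℤ) (s : Bits n) :
    ((bitWeight a s : ℤ) : ℝ) = bitWeight (fun j => (a j : ℝ)) s := by
  rw [bitWeight, bitWeight, Int.cast_prod]
  refine Finset.prod_congr rfl fun j _ => ?_
  split <;> simp

theorem bitWeight_pos {n : ℕ} {a : Fin n → ℤ} (h : ∀ j, 0 < a j) (s : Bits n) :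
    0 < bitWeight a s :=
  Finset.prod_pos fun j _ => by split <;> simp [h]

theorem abs_div_sub_floor_le {A B : ℤ} (hB : 0 < B) : |(A : ℝ) / B - (A / B : ℤ)| ≤ 1 := by
  have hB' : (0 : ℝ) < B := by exact_mod_cast hB
  have h1 : ((A / B : ℤ) : ℝ) ≤ A / B := by
    rw [le_div_iff₀ hB']; exact_mod_cast Int.ediv_mul_le A hB.ne'
  have h2 : (A : ℝ) / B ≤ (A / B : ℤ) + 1 := by
    rw [div_le_iff₀ hB']; exact_mod_cast (Int.lt_ediv_add_one_mul_self A hB).le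
  rw [abs_le]; constructor <;> linarith

/-- The binary logarithm of `10 √α / δ ≥ 10 > 8` is at least `3`. Nothing else about the value of
`precision` is used. -/
theorem three_mul_le_precision {α δ : ℝ} (hα : 1 ≤ α) (hδ : 0 < δ) (hδ1 : δ < 1) :
    10 ≤ 10 * √α / δ ∧ 3 * (10 * √α / δ) ≤ precision α δ := by
  have hs : 1 ≤ √α := by rw [Real.one_le_sqrt]; exact hα
  have hx : 10 ≤ 10 * √α / δ := by rw [le_div_iff₀ hδ]; nlinarith
  refine ⟨hx, ?_⟩
  rw [precision, mul_comm]
  refine mul_le_mul_of_nonneg_left ?_ (by linarith)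
  rw [Real.le_logb_iff_rpow_le (by norm_num) (by linarith)]
  norm_num; linarith

namespace IQPCircuit

variable {n N : ℕ} (C : IQPCircuit n)

theorem tally_zero (z : Fin N → Bits n) : C.tally z 0 = N := by
  simp [tally, diagSign_mul_self]

/-- The estimates of the Fourier coefficients are good with high probability. -/
theorem ncard_bad_tally_le (d : ℕ) {η : ℝ} (hη : 0 ≤ η) (hη1 : η ≤ 1) (N : ℕ) :
    (Set.ncard {z : Fin N → Bits n | ¬ ∀ s, weight s ≤ d → |(C.tally z s : ℝ) - N * C.coeff s| ≤
      N * η} : ℝ) ≤ (n + 1) ^ d * (2 * Real.exp (-(N * η ^ 2 / 4))) * (2 ^ n) ^ N := by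
  set S := Finset.univ.filter fun s : Bits n => weight s ≤ d with hS
  let B : Bits n → Set (Fin N → Bits n) := fun s =>
    {z | N * η ≤ |(C.tally z s : ℝ) - N * C.coeff s|}
  have hB : ∀ s, ((B s).ncard : ℝ) ≤ 2 * Real.exp (-(N * η ^ 2 / 4)) * (2 ^ n) ^ N := fun s => by
    have habs : ∀ z, |(C.diagSign z : ℝ) * C.diagSign (z + s)| ≤ 1 := fun z => by
      have h : ∀ w, |(C.diagSign w : ℝ)| = 1 := fun w => by simp [diagSign]
      rw [abs_mul, h, h, one_mul]
    have h := card_abs_sum_sub_ge_le (A := Bits n) hη hη1 habs N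
    simp only [Fintype.card_fun, Fintype.card_fin, Nat.cast_pow, Nat.cast_ofNat, ← coeff_eq] at h
    simp only [B, tally, Int.cast_sum, Int.cast_mul]
    exact h
  have hsub : {z : Fin N → Bits n | ¬ ∀ s, weight s ≤ d →
      |(C.tally z s : ℝ) - N * C.coeff s| ≤ N * η} ⊆ ⋃ s ∈ S, B s := fun z hz => by
    simp only [Set.mem_ofPred_eq, not_forall, not_le] at hz
    obtain ⟨s, hs, h⟩ := hz
    simp only [Set.mem_iUnion]
    exact ⟨s, by simpa [hS] using hs, h.le⟩
  have hcard : (S.card : ℝ) ≤ (n + 1) ^ d := by exact_mod_cast card_weight_le n d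
  calc _ ≤ ((⋃ s ∈ S, B s).ncard : ℝ) := by
        exact_mod_cast Set.ncard_le_ncard hsub (Set.toFinite _)
    _ ≤ ∑ s ∈ S, ((B s).ncard : ℝ) := by exact_mod_cast S.set_ncard_biUnion_le B
    _ ≤ ∑ _s ∈ S, 2 * Real.exp (-(N * η ^ 2 / 4)) * (2 ^ n) ^ N :=
        Finset.sum_le_sum fun s _ => hB s
    _ = S.card * (2 * Real.exp (-(N * η ^ 2 / 4)) * (2 ^ n) ^ N) := by
        rw [Finset.sum_const, nsmul_eq_mul]
    _ ≤ (n + 1) ^ d * (2 * Real.exp (-(N * η ^ 2 / 4)) * (2 ^ n) ^ N) :=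
        mul_le_mul_of_nonneg_right hcard (by positivity)
    _ = _ := by ring

end IQPCircuit

/-! ### Choice of the parameters and the final error bound -/

namespace SimParams

variable (P : SimParams)

/-- The factor that replaces `1 - ε_j`. -/
noncomputable def factor (κ : Option ℚ) : ℝ := P.rateNum κ / P.rateDen κ

theorem factor_some (q : ℚ) : P.factor (some q) = 1 - q := by
  have : (q.den : ℝ) ≠ 0 := by exact_mod_cast q.den_nz
  rw [factor, rateNum, rateDen]
  push_cast
  rw [sub_div, div_self this, ← Rat.cast_def]

/-- The parameters fit the bound `α`, the precision `δ` and the approximate rate `lam`. -/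
structure Fits (α δ lam : ℝ) : Prop where
  reps : 576 * (P.deg + 2) / δ ^ 2 ≤ P.reps
  bits : 12 / δ ≤ 2 ^ P.bits
  den : 0 < P.den
  deg : (1 - lam) ^ (P.deg + 1) ≤ δ / (6 * √α)
  le : P.factor none ≤ 1 - lam * (1 - 1 / precision α δ)
  ge : 1 - lam ≤ P.factor none

/-- The constant `lam` is an arbitrary real, but programs hold integers. So a rational number
between `1 - lam` and `1 - lam * (1 - 1 / K)` is built in, for which the tolerance on the rates
leaves room. -/
theorem exists_fits {α δ lam : ℝ} (hα : 1 ≤ α) (hδ : 0 < δ) (hδ1 : δ < 1) (hlam : 0 < lam)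
    (hlam1 : lam < 1) : ∃ P : SimParams, P.Fits α δ lam := by
  obtain ⟨hx, hK⟩ := three_mul_le_precision hα hδ hδ1
  have hK0 : 0 < precision α δ := by linarith
  have hs : 1 ≤ √α := by rw [Real.one_le_sqrt]; exact hα
  obtain ⟨d, hd⟩ := exists_pow_lt_of_lt_one (show 0 < δ / (6 * √α) by positivity)
    (show 1 - lam < 1 by linarith)
  obtain ⟨b, hb⟩ := pow_unbounded_of_one_lt (12 / δ) (one_lt_two)
  obtain ⟨r, hr⟩ := exists_nat_ge (576 * ((d : ℝ) + 2) / δ ^ 2)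
  have hlt : 1 - lam < 1 - lam * (1 - 1 / precision α δ) := by
    have : 0 < lam * (1 / precision α δ) := by positivity
    linarith
  obtain ⟨q, hq1, hq2⟩ := exists_rat_btwn hlt
  refine ⟨⟨d, b, r, q.num, q.den⟩, hr, hb.le, Int.natCast_pos.2 q.den_pos, ?_, ?_, ?_⟩
  · exact (pow_le_pow_of_le_one (by linarith) (by linarith) (Nat.le_succ d)).trans hd.le
  · simp only [factor, rateNum, rateDen, Int.cast_natCast, ← Rat.cast_def]; exact hq2.le
  · simp only [factor, rateNum, rateDen, Int.cast_natCast, ← Rat.cast_def]; exact hq1.le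

variable {P} {α δ lam : ℝ} {n : ℕ} {C : IQPCircuit n} {κ : Fin n → Option ℚ}

theorem Fits.rateDen_pos (h : P.Fits α δ lam) (κ : Option ℚ) : 0 < P.rateDen κ := by
  cases κ with
  | none => exact h.den
  | some q => rw [rateDen]; exact_mod_cast q.den_pos

theorem Fits.reps_pos (h : P.Fits α δ lam) (hδ : 0 < δ) : 0 < P.reps := by
  have : (0 : ℝ) < P.reps := lt_of_lt_of_le (by positivity) h.reps
  exact_mod_cast this

/-- The accuracy of the estimates of the Fourier coefficients. -/
noncomputable def accuracy (P : SimParams) (δ : ℝ) (n : ℕ) : ℝ := δ / (12 * (n + 1) ^ P.deg)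

theorem scale_pos (n : ℕ) : 0 < P.scale n := by rw [scale]; positivity

theorem samples_pos (h : 0 < P.reps) (n : ℕ) : 0 < P.samples n := by rw [samples]; positivity

/-- Rests on `n + 1 ≤ 2 ^ n`: the accuracy asks for a factor `(n + 1) ^ deg`, and `(2 ^ n) ^ deg` is
used to keep `scale` a power of two. -/
theorem Fits.inv_scale_le (h : P.Fits α δ lam) (hδ : 0 < δ) :
    (P.scale n : ℝ)⁻¹ ≤ P.accuracy δ n := by
  have hb := h.bits
  have hn : ((n : ℝ) + 1) ^ P.deg ≤ (2 ^ n) ^ P.deg := by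
    refine pow_le_pow_left₀ (by positivity) ?_ _
    exact_mod_cast Nat.lt_two_pow_self (n := n)
  rw [accuracy, inv_le_comm₀ (by exact_mod_cast scale_pos n) (by positivity), inv_div, scale]
  push_cast
  calc 12 * ((n : ℝ) + 1) ^ P.deg / δ = 12 / δ * ((n : ℝ) + 1) ^ P.deg := by ring
    _ ≤ _ := mul_le_mul hb hn (by positivity) (by positivity)

theorem Fits.abs_coefInt_sub_le (h : P.Fits α δ lam) (hδ : 0 < δ)
    (z : Fin (P.samples n) → Bits n) (s : Bits n) :
    |(C.tally z s : ℝ) / P.samples n * bitWeight (fun j => P.factor (κ j)) s -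
      (P.coefInt C κ z s : ℝ) / P.scale n| ≤ P.accuracy δ n := by
  refine le_trans ?_ (h.inv_scale_le hδ)
  have hV : (0 : ℝ) < P.scale n := by exact_mod_cast scale_pos n
  have hN : 0 < P.samples n := samples_pos (h.reps_pos hδ) n
  have hD := bitWeight_pos (fun j => h.rateDen_pos (κ j)) s
  have hf := abs_div_sub_floor_le
    (A := C.tally z s * bitWeight (fun j => P.rateNum (κ j)) s * P.scale n)
    (B := P.samples n * bitWeight (fun j => P.rateDen (κ j)) s)
    (mul_pos (by exact_mod_cast hN) hD)
  have hN' : (P.samples n : ℝ) ≠ 0 := by exact_mod_cast hN.ne'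
  have hD' : (bitWeight (fun j => (P.rateDen (κ j) : ℝ)) s) ≠ 0 := by
    rw [← intCast_bitWeight]; exact_mod_cast hD.ne'
  rw [← abs_of_pos (inv_pos.2 hV), ← mul_one |(P.scale n : ℝ)⁻¹|]
  refine le_trans (le_of_eq ?_) (mul_le_mul_of_nonneg_left hf (abs_nonneg _))
  rw [← abs_mul, coefInt]
  congr 1
  simp only [factor]
  rw [bitWeight_div]
  push_cast
  rw [intCast_bitWeight, intCast_bitWeight]
  field_simp

/-- At `s = 0` every sampled term is the square of a sign, so there is neither sampling nor rounding
error. The normalization of the sampled function depends on this. -/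
theorem coefInt_zero (h : 0 < P.reps) (z : Fin (P.samples n) → Bits n) :
    P.coefInt C κ z 0 = P.scale n := by
  have hN : (P.samples n : ℤ) ≠ 0 := by exact_mod_cast (samples_pos h n).ne'
  simp only [coefInt, IQPCircuit.tally_zero, bitWeight, Pi.zero_apply, zero_ne_one, if_false,
    Finset.prod_const_one, mul_one]
  exact Int.mul_ediv_cancel_left _ hN

/-- The known rates are close to the actual rates. -/
structure RatesClose (P : SimParams) (α δ lam : ℝ) (κ : Fin n → Option ℚ) (ε : Fin n → ℝ) :
    Prop where
  pos : ∀ j, 0 < ε j ∧ ε j < 1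
  ge : ∀ j, lam ≤ ε j
  le_factor : ∀ j, 1 - ε j ≤ P.factor (κ j)
  factor_le : ∀ j, P.factor (κ j) ≤ 1 - lam * (1 - 1 / precision α δ)
  sub_le : ∀ j, P.factor (κ j) - (1 - ε j) ≤ 2 * lam / precision α δ

/-- If the estimates of the Fourier coefficients are good, then so is the distribution. -/
theorem Fits.l1Dist_le (h : P.Fits α δ lam) (hα1 : 1 ≤ α) (hδ : 0 < δ) (hδ1 : δ < 1)
    (hlam : 0 < lam) (hlam1 : lam < 1) {ε : Fin n → ℝ} (hε : RatesClose P α δ lam κ ε)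
    (hα : ∑ x, C.outputDist x ^ 2 ≤ α / 2 ^ n) {z : Fin (P.samples n) → Bits n}
    (hz : ∀ s, weight s ≤ P.deg →
      |(C.tally z s : ℝ) - P.samples n * C.coeff s| ≤ P.samples n * P.accuracy δ n) :
    l1Dist (C.noisyDist ε) (P.drawDist C κ z) ≤ δ := by
  obtain ⟨hx, hK⟩ := three_mul_le_precision hα1 hδ hδ1
  have hs : 1 ≤ √α := by rw [Real.one_le_sqrt]; exact hα1
  set K := precision α δ with hKdef
  have hN : (0 : ℝ) < P.samples n := by exact_mod_cast samples_pos (h.reps_pos hδ) n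
  have hV : (0 : ℝ) < P.scale n := by exact_mod_cast scale_pos n
  have hK0 : 0 < K := by linarith
  have hK1 : 1 / K ≤ 1 / 2 := one_div_le_one_div_of_le two_pos (by linarith)
  have hμ : 0 < lam * (1 - 1 / K) := mul_pos hlam (by linarith)
  -- This is `Δ / μ` in `bitWeight_sub_le` and equals `2 / (K - 1)`. With `y = 10 √α / δ` the target
  -- is `10 / (6 * y)`, so `12 * y ≤ 10 * (K - 1)` is needed; it follows from `K ≥ 3 * y` and `y ≥
  -- 10`.
  have herr : 2 * lam / K / (lam * (1 - 1 / K)) ≤ δ / (6 * √α) := by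
    have e1 : 2 * lam / K / (lam * (1 - 1 / K)) = 2 / (K - 1) := by
      have : K - 1 ≠ 0 := by linarith
      field_simp
    have e2 : δ / (6 * √α) = 10 / (6 * (10 * √α / δ)) := by field_simp
    rw [e1, e2, div_le_div_iff₀ (by linarith) (by linarith)]
    linarith
  have hn1 : (1 : ℝ) ≤ (n + 1) ^ P.deg := one_le_pow₀ (by linarith [Nat.cast_nonneg (α := ℝ) n])
  have hF : ∑ x, fourierSum (P.coefInt C κ z) P.deg x = ((2 ^ P.coins n : ℕ) : ℤ) := by
    rw [sum_fourierSum, coefInt_zero (h.reps_pos hδ), P.two_pow_coins]; push_cast; rfl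
  have h3 := sum_abs_descendCount_le _ _ hF (by positivity)
    (fun x => C.noisyDist_nonneg hε.pos x)
  have h4 : ((2 ^ P.coins n : ℕ) : ℝ) = 2 ^ n * P.scale n := by
    rw [P.two_pow_coins]; push_cast; rfl
  rw [l1Dist]
  have h5 : ∀ x, P.drawDist C κ z x = (descendCount (fourierSum (P.coefInt C κ z) P.deg) n 0 0
      (2 ^ P.coins n) x : ℝ) / (2 ^ P.coins n : ℕ) := fun x => by rw [drawDist]; push_cast; rfl
  simp only [h5]
  refine h3.trans ?_
  rw [h4]
  -- `η₂` is twice the accuracy, once for sampling and once for rounding. The resulting `δ / 3` is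
  -- tripled by the bitwise drawing.
  have h6 := C.sum_abs_noisyDist_sub_le ε (P.coefInt C κ z) P.deg (P.scale n) (δ := δ)
    (η₁ := δ / (6 * √α)) (η₂ := 2 * P.accuracy δ n) hα hδ.le ?_ ?_ ?_
  · linarith
  · intro s
    have ha : ∀ j, 0 ≤ 1 - ε j := fun j => by linarith [(hε.pos j).2]
    split
    · rename_i hw
      have hb : ∀ j, 0 ≤ P.factor (κ j) := fun j => (ha j).trans (hε.le_factor j)
      obtain ⟨d1, d2⟩ := bitWeight_sub_le hμ (show 0 ≤ 2 * lam / K by positivity) ha hε.le_factor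
        hε.factor_le hε.sub_le s
      obtain ⟨b1, b2⟩ := abs_bitWeight_le_pow hb (r := 1)
        (fun j => (hε.factor_le j).trans (by linarith)) s
      rw [one_pow] at b2
      set A := bitWeight (fun j => 1 - ε j) s
      set B := bitWeight (fun j => P.factor (κ j)) s
      have t1 : |(A - B) * C.coeff s| ≤ δ / (6 * √α) * |C.coeff s| := by
        rw [abs_mul, abs_sub_comm, abs_of_nonneg d1]
        exact mul_le_mul_of_nonneg_right (d2.trans herr) (abs_nonneg _)
      have t2 : |B * (C.coeff s - C.tally z s / P.samples n)| ≤ P.accuracy δ n := by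
        rw [abs_mul, abs_of_nonneg b1]
        refine (mul_le_of_le_one_left (abs_nonneg _) b2).trans ?_
        have e : C.coeff s - C.tally z s / P.samples n =
            -(((C.tally z s : ℝ) - P.samples n * C.coeff s) / P.samples n) := by
          field_simp; ring
        rw [e, abs_neg, abs_div, abs_of_pos hN, div_le_iff₀ hN, mul_comm (P.accuracy δ n)]
        exact hz s hw
      have t3 := h.abs_coefInt_sub_le (C := C) (κ := κ) hδ z s
      -- Errors from the rates, from sampling and from rounding, in this order.
      have e : A * C.coeff s - (P.coefInt C κ z s : ℝ) / P.scale n = (A - B) * C.coeff s +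
          B * (C.coeff s - C.tally z s / P.samples n) +
          ((C.tally z s : ℝ) / P.samples n * B - (P.coefInt C κ z s : ℝ) / P.scale n) := by ring
      rw [e]
      refine (abs_add_three _ _ _).trans ?_
      linarith
    · rename_i hw
      -- Discarded coefficients have weight at least `deg + 1`, so their damping factor is within
      -- the permitted relative error `δ / (6 √α)`.
      obtain ⟨b1, b2⟩ := abs_bitWeight_le_pow ha (r := 1 - lam)
        (fun j => by linarith [hε.ge j]) s
      rw [sub_zero, add_zero, abs_mul, abs_of_nonneg b1]
      refine mul_le_mul_of_nonneg_right (b2.trans ((pow_le_pow_of_le_one (by linarith)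
        (by linarith) (show P.deg + 1 ≤ weight s by omega)).trans h.deg)) (abs_nonneg _)
  · have : √α ^ 2 = α := Real.sq_sqrt (by linarith)
    have hs0 : √α ≠ 0 := by linarith
    rw [div_pow, mul_pow, this]
    have : α ≠ 0 := by linarith
    refine le_of_eq ?_
    field_simp
  · have e : 2 * P.accuracy δ n = δ / 6 / (n + 1) ^ P.deg := by rw [accuracy]; field_simp; norm_num
    rw [e, div_pow, div_mul_eq_mul_div, div_le_iff₀ (by positivity)]
    refine mul_le_mul_of_nonneg_left ?_ (by positivity)
    rw [sq]; exact le_mul_of_one_le_left (by linarith) hn1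

/-- The samples are numerous enough for an exponent of at least `(deg + 2) * (n + 1)`. Of this, `deg
* n` pays for the union bound over the coefficients and `1` for the factor `2`; the rest is at least
`n`. -/
theorem Fits.tail_le (h : P.Fits α δ lam) (hδ : 0 < δ) (n : ℕ) :
    (n + 1 : ℝ) ^ P.deg * (2 * Real.exp (-(P.samples n * P.accuracy δ n ^ 2 / 4))) ≤
      1 / Real.exp n := by
  have hr := h.reps
  rw [div_le_iff₀ (by positivity)] at hr
  -- `576 = 4 * 12 ^ 2`, from the `4` of the tail bound and the `12` in `accuracy`.
  have e : P.samples n * P.accuracy δ n ^ 2 / 4 = P.reps * δ ^ 2 * (n + 1) / 576 := by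
    rw [samples, accuracy]
    push_cast
    rw [div_pow, mul_pow, ← pow_mul, mul_comm P.deg 2, pow_succ]
    field_simp
    ring
  have h1 : ((P.deg : ℝ) + 2) * (n + 1) ≤ P.samples n * P.accuracy δ n ^ 2 / 4 := by
    rw [e, le_div_iff₀ (by norm_num)]
    have hn : (0 : ℝ) ≤ n + 1 := by positivity
    nlinarith [mul_le_mul_of_nonneg_right hr hn]
  have h2 : (n + 1 : ℝ) ^ P.deg ≤ Real.exp (n * P.deg) := by
    rw [Real.exp_mul, Real.rpow_natCast]
    exact pow_le_pow_left₀ (by positivity) (Real.add_one_le_exp _) _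
  have h3 : (2 : ℝ) ≤ Real.exp 1 := by linarith [Real.add_one_le_exp (1 : ℝ)]
  calc _ ≤ Real.exp (n * P.deg) * (Real.exp 1 * Real.exp (-(((P.deg : ℝ) + 2) * (n + 1)))) := by
        gcongr
    _ = Real.exp (n * P.deg + (1 + -(((P.deg : ℝ) + 2) * (n + 1)))) := by
        rw [← Real.exp_add, ← Real.exp_add]
    _ ≤ Real.exp (-n) := by
        refine Real.exp_le_exp.2 ?_
        have h4 : (0 : ℝ) ≤ P.deg := Nat.cast_nonneg _
        have h5 : (0 : ℝ) ≤ n := Nat.cast_nonneg _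
        linarith
    _ = _ := by rw [Real.exp_neg, one_div]

theorem Fits.ncard_bad_le (h : P.Fits α δ lam) (hα1 : 1 ≤ α) (hδ : 0 < δ) (hδ1 : δ < 1)
    (hlam : 0 < lam) (hlam1 : lam < 1) {ε : Fin n → ℝ} (hε : RatesClose P α δ lam κ ε)
    (hα : ∑ x, C.outputDist x ^ 2 ≤ α / 2 ^ n) {η : ℝ} (hη : δ ≤ η) :
    (Set.ncard {z | ¬ l1Dist (C.noisyDist ε) (P.drawDist C κ z) ≤ η} : ℝ) /
      (2 ^ n) ^ P.samples n ≤ 1 / Real.exp n := by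
  have hn1 : (1 : ℝ) ≤ (n + 1) ^ P.deg := one_le_pow₀ (by linarith [Nat.cast_nonneg (α := ℝ) n])
  have hacc0 : 0 ≤ P.accuracy δ n := by rw [accuracy]; positivity
  have hacc1 : P.accuracy δ n ≤ 1 := by
    rw [accuracy, div_le_one (by positivity)]; linarith
  rw [div_le_iff₀ (by positivity)]
  refine le_trans ?_ ((C.ncard_bad_tally_le P.deg hacc0 hacc1 (P.samples n)).trans
    (mul_le_mul_of_nonneg_right (h.tail_le hδ n) (by positivity)))
  have hsub : {z | ¬ l1Dist (C.noisyDist ε) (P.drawDist C κ z) ≤ η} ⊆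
      {z | ¬ ∀ s, weight s ≤ P.deg →
        |(C.tally z s : ℝ) - P.samples n * C.coeff s| ≤ P.samples n * P.accuracy δ n} :=
    fun z hz hgood => hz ((h.l1Dist_le hα1 hδ hδ1 hlam hlam1 hε hα hgood).trans hη)
  exact_mod_cast Set.ncard_le_ncard hsub (Set.toFinite _)

end SimParams

/-! ### The algorithms -/

namespace SimParams

variable {P : SimParams} {α δ lam : ℝ} {n : ℕ}

/-- In units of `lam / K`: the smallest rate is at most one unit above `lam` and the built-in factor
at most one unit above `1 - lam`, which makes two units in all. A given `λ_j` is at most one unit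
below `ε_j ≥ lam`. Both substitutes err upwards from `1 - ε_j`, as `bitWeight_sub_le` requires. -/
theorem ratesClose_knownRates (h : P.Fits α δ lam) (hα1 : 1 ≤ α) (hδ : 0 < δ) (hδ1 : δ < 1)
    (hlam : 0 < lam) {ε : Fin n → ℝ} {εmin : ℝ} {q : Fin n → ℚ} (hε : ∀ j, 0 < ε j ∧ ε j < 1)
    (hmin : IsLeast (Set.range ε) εmin) (h1 : 1 ≤ εmin / lam)
    (h2 : εmin / lam ≤ 1 + 1 / precision α δ)
    (hq : ∀ j, ε j ≠ εmin →
      0 ≤ ε j - (q j : ℝ) ∧ ε j - (q j : ℝ) ≤ lam / precision α δ) :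
    RatesClose P α δ lam (knownRates ε εmin q) ε := by
  obtain ⟨hx, hK⟩ := three_mul_le_precision hα1 hδ hδ1
  have hle := h.le
  have hge := h.ge
  set K := precision α δ
  have hpos : 0 < lam / K := div_pos hlam (by linarith)
  rw [le_div_iff₀ hlam, one_mul] at h1
  rw [div_le_iff₀ hlam] at h2
  have e1 : (1 + 1 / K) * lam = lam + lam / K := by ring
  have e2 : lam * (1 - 1 / K) = lam - lam / K := by ring
  have e3 : 2 * lam / K = lam / K + lam / K := by ring
  have hm : ∀ j, εmin ≤ ε j := fun j => hmin.2 (Set.mem_range_self j)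
  have key : ∀ j, 1 - ε j ≤ P.factor (knownRates ε εmin q j) ∧
      P.factor (knownRates ε εmin q j) ≤ 1 - lam * (1 - 1 / K) ∧
      P.factor (knownRates ε εmin q j) - (1 - ε j) ≤ 2 * lam / K := fun j => by
    have := hm j
    rw [e1] at h2
    rw [e2] at hle
    rw [knownRates, e2, e3]
    split
    · rename_i hj
      refine ⟨?_, ?_, ?_⟩ <;> linarith
    · rename_i hj
      obtain ⟨hq1, hq2⟩ := hq j hj
      rw [factor_some]
      refine ⟨?_, ?_, ?_⟩ <;> linarith
  exact ⟨hε, fun j => h1.trans (hm j), fun j => (key j).1, fun j => (key j).2.1,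
    fun j => (key j).2.2⟩

/-- The algorithms for noise with individual rates, of which the smallest is about `lam`. -/
theorem exists_algorithms (lam : ℝ) (hα1 : 1 ≤ α) (hδ : 0 < δ) (hδ1 : δ < 1) :
    ∃ (G S : Prog) (Q : Polynomial ℕ), ∀ (n : ℕ) (C : IQPCircuit n) (κ : Fin n → Option ℚ)
      (x : List ℤ), Describes x C κ → ∀ L, n + C.size + ∑ j, rateBits (κ j) = L →
      OutputsDist n G S x (Q.eval L) ∧
      ∀ (ε : Fin n → ℝ) (εmin : ℝ) (q : Fin n → ℚ), κ = knownRates ε εmin q →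
        (∀ j, 0 < ε j ∧ ε j < 1) → IsLeast (Set.range ε) εmin →
        ∑ x, C.outputDist x ^ 2 ≤ α / 2 ^ n →
        1 ≤ εmin / lam → εmin / lam ≤ 1 + 1 / precision α δ →
        (∀ j, ε j ≠ εmin →
          0 ≤ ε j - (q j : ℝ) ∧ ε j - (q j : ℝ) ≤ lam / precision α δ) →
        0 < lam ∧ lam < 1 ∧ ∀ η, δ ≤ η →
          1 - 1 / Real.exp n ≤ closeProb G S x (Q.eval L) (C.inputNoiseDist ε) η := by
  -- For `lam` outside of `(0, 1)` the closeness claim is void, and any parameters give programs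
  -- that halt and sample in time.
  obtain ⟨P, hP⟩ : ∃ P : SimParams, 0 < lam → lam < 1 → P.Fits α δ lam := by
    by_cases h : 0 < lam ∧ lam < 1
    · obtain ⟨P, hP⟩ := exists_fits hα1 hδ hδ1 h.1 h.2
      exact ⟨P, fun _ _ => hP⟩
    · exact ⟨⟨0, 0, 0, 0, 0⟩, fun h1 h2 => absurd ⟨h1, h2⟩ h⟩
  obtain ⟨Q, hQ⟩ := P.exists_polynomial
  refine ⟨P.generator, P.sampler, Q, fun n C κ x hx L hL => ?_⟩
  obtain ⟨hN, hr⟩ := hQ hx L hL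
  refine ⟨fun r => ?_, ?_⟩
  · obtain ⟨w, hw, hs⟩ := hr r
    exact ⟨w, _, hw, hs⟩
  · rintro ε εmin q rfl hε hmin hα h1 h2 hq
    obtain ⟨j, hj⟩ := hmin.1
    have hεj := hε j
    rw [hj] at hεj
    -- A ratio of at least `1` with positive numerator excludes `lam ≤ 0`, including the default
    -- value of division by zero.
    have hlam : 0 < lam := by
      by_contra hc
      linarith [div_nonpos_of_nonneg_of_nonpos hεj.1.le (not_lt.1 hc)]
    have hlam1 : lam < 1 := by
      rw [le_div_iff₀ hlam, one_mul] at h1; linarith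
    refine ⟨hlam, hlam1, fun η hη => ?_⟩
    have hfit := hP hlam hlam1
    rw [C.inputNoiseDist_eq]
    exact (sub_le_sub_left (hfit.ncard_bad_le hα1 hδ hδ1 hlam hlam1
      (ratesClose_knownRates hfit hα1 hδ hδ1 hlam hε hmin h1 h2 hq) hα hη) 1).trans
      (P.le_closeProb hN hr _ η)

end SimParams

theorem mainTheorem6 :
    -- Noise at the start and at the end give the same output distribution (uniform rate).
    (∀ (n : ℕ) (C : IQPCircuit n) (ε : ℝ), 0 < ε → ε < 1 →
      C.inputNoiseDist (fun _ => ε) = C.outputNoiseDist (fun _ => ε)) ∧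
    -- The same for individual rates.
    (∀ (n : ℕ) (C : IQPCircuit n) (ε : Fin n → ℝ), (∀ j, 0 < ε j ∧ ε j < 1) →
      C.inputNoiseDist ε = C.outputNoiseDist ε) ∧
    -- Classical simulation under input noise with a uniform rate.
    (∀ α δ lam : ℝ, 1 ≤ α → 0 < δ → δ < 1 →
      ∃ (G S : Prog) (P : Polynomial ℕ), ∀ (n : ℕ), 1 ≤ n → ∀ C : IQPCircuit n,
        OutputsDist n G S C.code (P.eval (n + C.size)) ∧
        ∀ ε : ℝ, 0 < ε → ε < 1 →
          ∑ x, C.outputDist x ^ 2 ≤ α / 2 ^ n →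
          1 ≤ ε / lam → ε / lam ≤ 1 + 1 / precision α δ →
          1 - 1 / Real.exp n ≤
            closeProb G S C.code (P.eval (n + C.size)) (C.inputNoiseDist fun _ => ε) δ) ∧
    -- Classical simulation under input noise with individual rates.
    (∀ α δ lamMin : ℝ, 1 ≤ α → 0 < δ → δ < 1 →
      ∃ (G S : Prog) (P : Polynomial ℕ), ∀ (n : ℕ), 1 ≤ n → ∀ C : IQPCircuit n,
        (∀ κ : Fin n → Option ℚ,
          OutputsDist n G S (C.codeWithRates κ) (P.eval (n + C.size + ∑ j, rateBits (κ j)))) ∧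
        ∀ (ε : Fin n → ℝ) (εmin : ℝ) (lam : Fin n → ℚ),
          (∀ j, 0 < ε j ∧ ε j < 1) → IsLeast (Set.range ε) εmin →
          ∑ x, C.outputDist x ^ 2 ≤ α / 2 ^ n →
          1 ≤ εmin / lamMin → εmin / lamMin ≤ 1 + 1 / precision α δ →
          (∀ j, ε j ≠ εmin →
            0 ≤ ε j - (lam j : ℝ) ∧ ε j - (lam j : ℝ) ≤ lamMin / precision α δ) →
          1 - 1 / Real.exp n ≤
            closeProb G S (C.codeWithRates (knownRates ε εmin lam))
              (P.eval (n + C.size + ∑ j, rateBits (knownRates ε εmin lam j)))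
              (C.inputNoiseDist ε) ((1 + 1 / (1 - lamMin)) * δ)) := by
  refine ⟨fun n C ε _ _ => ?_, fun n C ε _ => ?_, fun α δ lam hα hδ hδ1 => ?_,
    fun α δ lamMin hα hδ hδ1 => ?_⟩
  · rw [C.inputNoiseDist_eq, C.outputNoiseDist_eq]
  · rw [C.inputNoiseDist_eq, C.outputNoiseDist_eq]
  · obtain ⟨G, S, P, h⟩ := SimParams.exists_algorithms lam hα hδ hδ1
    refine ⟨G, S, P, fun n hn C => ?_⟩
    have : Nonempty (Fin n) := ⟨⟨0, hn⟩⟩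
    obtain ⟨h1, h2⟩ := h n C _ _ (SimParams.describes_code C) (n + C.size) (by simp [rateBits])
    refine ⟨h1, fun ε hε hε1 hp hle hge => ?_⟩
    refine (h2 (fun _ => ε) ε (fun _ => 0) ?_ (fun _ => ⟨hε, hε1⟩) ?_ hp hle hge ?_).2.2 δ le_rfl
    · ext j; simp [knownRates]
    · rw [Set.range_const]; exact isLeast_singleton
    · exact fun j hj => absurd rfl hj
  · obtain ⟨G, S, P, h⟩ := SimParams.exists_algorithms lamMin hα hδ hδ1
    refine ⟨G, S, P, fun n _ C => ⟨fun κ => ?_, fun ε εmin lam hε hmin hp hle hge hlam => ?_⟩⟩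
    · exact (h n C κ _ (SimParams.describes_codeWithRates C κ) _ rfl).1
    · obtain ⟨-, h1, h2⟩ := (h n C _ _ (SimParams.describes_codeWithRates C _) _ rfl).2 ε εmin lam
        rfl hε hmin hp hle hge hlam
      -- The error `δ` itself is achieved; the factor `1 + 1 / (1 - lamMin)` is at least `1` because
      -- `lamMin < 1`.
      refine h2 _ (le_mul_of_one_le_left hδ.le ?_)
      have : 0 ≤ 1 / (1 - lamMin) := by
        apply one_div_nonneg.2; linarith
      linarith
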